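/- Let $n\ge 2$ and $d\ge 0$ be integers, and let $Y=f+\xi$ where $f=(F(1/n),F(2/n),\ldots,F(n/n))\in\mathbb{R}^n$ for an unknown function $F$ on $(0,1]$, and where the components $\xi_1,\ldots,\xi_n$ of $\xi$ are independent, centered real random variables such that, for some numbers $\sigma,c\ge 0$, \[ \mathbb{E}\left[e^{\lambda\xi_i}\right]<\infty\quad\text{and}\quad \log\mathbb{E}\left[e^{\lambda\xi_i}\right]\le\frac{\lambda^2\sigma^2}{2(1-|\lambda|c)}\qquad\text{for all }\lambda\in(-1/c,1/c)\text{ and }i=1,\ldots,n \] (with $1/0=+\infty$). Call a partition $m$ of $\{1,\ldots,n\}$ admissible if each of its blocks $I$ consists of at least $d+1$ consecutive integers. For an admissible $m$, let $S_m\subset\mathbb{R}^n$ be the linear span of the vectors $(P(1/n),\ldots,P(n/n))$, where $P$ runs over the piecewise polynomials of degree at most $d$ based on the partition of $(0,1]$ into the intervals $\left(\frac{\min I-1}{n},\frac{\max I}{n}\right]$, $I\in m$; let $D_m=\dim S_m$, and let $\hat f_m$ be the orthogonal projection of $Y$ onto $S_m$. Let $\mathfrak{m}$ be an admissible partition and $\mathcal{M}$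 a collection of admissible partitions such that $S_m\subset S_{\mathfrak{m}}$ for all $m\in\mathcal{M}$. Let $(\Delta_m)_{m\in\mathcal{M}}$ be nonnegative numbers and set $\Sigma=\sum_{m\in\mathcal{M}}e^{-\Delta_m}$. Write $|\cdot|_2$ for the Euclidean norm, and let $\kappa=18$. Let $a,b>0$ and assume that \[ |I|\ge(d+1)a^2\log^2 n\ge d+1\qquad\text{for all } I\in\mathfrak{m}. \] Let $K>1$, and let $\mathrm{pen}:\mathcal{M}\to\mathbb{R}_+$ satisfy \[ \mathrm{pen}(m)\ge K\kappa^2\left(\sigma^2+c\,\frac{4\sqrt2(\sigma+c)(d+1)(b+2)}{a\kappa}\right)(D_m+\Delta_m)\qquad\text{for all } m\in\mathcal{M}. \] If $\hat m$ is selected from the data as any minimizer over $\mathcal{M}$ of $\mathrm{crit}(m)=|Y-\hat f_m|_2^2+\mathrm{pen}(m)$, then \[ \mathbb{E}\left[|f-\hat f_{\hat m}|_2^2\right]\le \frac{K(K^2+K-1)}{(K-1)^3}\left[\inf_{m\in\mathcal{M}}\left\{\mathbb{E}\left[|f-\hat f_m|_2^2\right]+\mathrm{pen}(m)\right\}+R\right],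 \] where all the expectations are finite and \[ R=\kappa^2\left(\sigma^2+c\,\frac{4\sqrt2(\sigma+c)(d+1)(b+2)}{a\kappa}\right)\Sigma+4\,\frac{(c+\sigma)^2(b+2)^2}{a^2n^b}. \] -/

import Mathlib

open MeasureTheory ProbabilityTheory Polynomial

namespace PiecewisePolySelection

noncomputable section

/-- The numerical constant `κ = 18`. -/
def kappa : ℝ := 18

/-- The constant `C(K) = K (K² + K - 1) / (K - 1)³`. -/
def oracleConst (K : ℝ) : ℝ := K * (K ^ 2 + K - 1) / (K - 1) ^ 3

/-- Partitions of `{1, …, n}`. The integer `k ∈ {1, …, n}` is represented by the element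
`k - 1` of `Fin n`. -/
abbrev BlockPartition (n : ℕ) : Type := Finpartition (Finset.univ : Finset (Fin n))

/-- The design point `x_k = k / n`, where `k = i + 1`. -/
def design (n : ℕ) (i : Fin n) : ℝ := ((i : ℝ) + 1) / n

/-- Every block consists of at least `d + 1` consecutive integers. -/
def Admissible (d : ℕ) {n : ℕ} (m : BlockPartition n) : Prop :=
  ∀ I ∈ m.parts, (I : Set (Fin n)).OrdConnected ∧ d + 1 ≤ I.card

/-- The interval `((min I - 1) / n, max I / n]` attached to a block `I` (`min` and `max` refer to
the labels `1, …, n`, which are the elements of `Fin n` shifted by one). -/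
def cell {n : ℕ} (I : Finset (Fin n)) (hI : I.Nonempty) : Set ℝ :=
  Set.Ioc ((((I.min' hI : Fin n) : ℕ) : ℝ) / n) (((((I.max' hI : Fin n) : ℕ) : ℝ) + 1) / n)

/-- `P` is a piecewise polynomial of degree at most `d` based on the partition of `(0, 1]`
into the intervals attached to the blocks of `m`. -/
def IsPiecewisePoly (d : ℕ) {n : ℕ} (m : BlockPartition n) (P : ℝ → ℝ) : Prop :=
  ∀ (I : Finset (Fin n)) (hI : I ∈ m.parts), ∃ p : ℝ[X], p.natDegree ≤ d ∧
    ∀ x ∈ cell I (m.nonempty_of_mem_parts hI), P x = p.eval x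

/-- The vector `(F(1/n), …, F(n/n))`. -/
def sample (n : ℕ) (F : ℝ → ℝ) : EuclideanSpace ℝ (Fin n) :=
  WithLp.toLp 2 (fun i => F (design n i))

/-- The model `S_m`: the span of the vectors `(P(1/n), …, P(n/n))`, with `P` a piecewise
polynomial of degree at most `d` based on `m`. -/
def model (d : ℕ) {n : ℕ} (m : BlockPartition n) : Submodule ℝ (EuclideanSpace ℝ (Fin n)) :=
  Submodule.span ℝ {v | ∃ P : ℝ → ℝ, IsPiecewisePoly d m P ∧ v = sample n P}

/-- `D_m`, the dimension of `S_m`. -/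
def modelDim (d : ℕ) {n : ℕ} (m : BlockPartition n) : ℕ := Module.finrank ℝ (model d m)

/-- The least-squares estimator, that is, the orthogonal projection of `y` onto `S_m`. -/
def lse (d : ℕ) {n : ℕ} (m : BlockPartition n) (y : EuclideanSpace ℝ (Fin n)) :
    EuclideanSpace ℝ (Fin n) :=
  (model d m).starProjection y

/-- The penalized least-squares criterion. -/
def crit (d : ℕ) {n : ℕ} (pen : BlockPartition n → ℝ) (y : EuclideanSpace ℝ (Fin n)) (m : BlockPartition n) : ℝ :=
  ‖y - lse d m y‖ ^ 2 + pen m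

/-- The observation `Y = f + ξ`. -/
def obs {Ω : Type*} {n : ℕ} (f : EuclideanSpace ℝ (Fin n)) (ξ : Fin n → Ω → ℝ) (ω : Ω) :
    EuclideanSpace ℝ (Fin n) :=
  f + WithLp.toLp 2 (fun i => ξ i ω)

/-- The squared Euclidean loss of the least-squares estimator on `S_m`. -/
def loss (d : ℕ) {Ω : Type*} {n : ℕ} (f : EuclideanSpace ℝ (Fin n)) (ξ : Fin n → Ω → ℝ)
    (m : BlockPartition n) (ω : Ω) : ℝ :=
  ‖f - lse d m (obs f ξ ω)‖ ^ 2

/-- The real random variable `X` has exponential moments, and a log-Laplace transform bounded by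
`λ² σ² / (2 (1 - |λ| c))`, for all `λ ∈ (-1/c, 1/c)` with the convention `1/0 = +∞`, that is, for
all `λ` such that `|λ| c < 1`. -/
def BernsteinCond {Ω : Type*} [MeasurableSpace Ω] (μ : Measure Ω) (X : Ω → ℝ) (σ c : ℝ) : Prop :=
  ∀ l : ℝ, |l| * c < 1 → Integrable (fun ω => Real.exp (l * X ω)) μ ∧
    Real.log (∫ ω, Real.exp (l * X ω) ∂μ) ≤ l ^ 2 * σ ^ 2 / (2 * (1 - |l| * c))

/-- The factor `κ² (σ² + c · 4 √2 (σ + c) (d + 1) (b + 2) / (a κ))`. -/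
def penFactor (d : ℕ) (a b σ c : ℝ) : ℝ :=
  kappa ^ 2 * (σ ^ 2 + c * (4 * √2 * (σ + c) * ((d : ℝ) + 1) * (b + 2) / (a * kappa)))

/-- The remainder term `R`, as a function of `S = ∑ exp (-Δ_m)`. -/
def remainder (d n : ℕ) (a b σ c S : ℝ) : ℝ :=
  penFactor d a b σ c * S + 4 * ((c + σ) ^ 2 * (b + 2) ^ 2 / (a ^ 2 * (n : ℝ) ^ b))

end

end PiecewisePolySelection

namespace PiecewisePolySelection

/-! ### Leverage of discrete polynomials -/

section Leverage

open Finset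

/-! Notation: D = d + 1, Q = `penFactor`, φ is the projection of f onto the reference model, and
`res d I φ` is the residual of the best fit of φ by a polynomial of degree at most d on the interval
I.

Minimality of the criterion gives (`loss_add_pen_le`) that the selected model m' does no worse than
a fixed m, up to the linear term 2⟨Π_{m'} f − Π_m f, ξ⟩ and the quadratic term 2‖Π_{m'} ξ‖². Both
have to be controlled uniformly in m' and paid for by the penalty.

Leverage. A polynomial of degree at most d satisfies N p(x)² ≤ D² ∑ p² on N consecutive integers
(`poly_leverage`). With the lower bound on block sizes, vectors of the reference model have
coordinates at most `lev n d a` times their norm, which tames the linear part of the Bernstein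
tails.

Quadratic term (`exists_chi_envelope`). On the event where the coordinates of all local projections
of ξ are at most `goodLevel`, a 1/2-net and the Bernstein tail give ‖Π_m ξ‖² ≤ (Q/9)(dim + Δ_m) up
to an excess of mean at most (Q/9) exp(−Δ_m). The complement has probability at most 2/n², and
fourth moments bound its cost by 0.06 Q. This is absorbed by the penalty, so the n^(−b) term of the
remainder is not needed.

Linear term, K ≤ 7.5 (`bound_of_refinement`). Cauchy–Schwarz on the common refinement of m and m',
whose number of blocks is at most the sum of the two, reduces it to the quadratic term. This puts a
factor 1 + θ before the loss of m.

Linear term, K ≥ 7.5 (`bound_of_envelope`). Since `oracleConst K` is 1 + 4/K to first order, the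
loss of m must now have coefficient 1. The part of the linear term attached to m is centred. The
part attached to m' splits over blocks into ⟨res_I φ, ξ⟩, and `hasEnvelope` bounds ∑_I (2|⟨res_I φ,
ξ⟩| − α‖res_I φ‖² − B) by one integrable variable for all partitions at once, without help from the
weights Δ. If log n ≤ 36 D, a union bound over at most n² intervals suffices. Otherwise no log n per
block can be afforded, and two facts replace the union bound. First, the residuals of intervals
containing a fixed gap have covering numbers depending on d but not on n (`res_close_of_code`,
`exists_gap_cover`), so chaining gives deviations of order D. Second, for every partition m, the
intervals with squared residual norm about h are pierced by O(|m| + ‖φ − Π_m φ‖²/h) gaps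
(`exists_packing_piercing`, `card_packing_le`). Summing over dyadic h gives the envelope. -/

lemma exists_poly_fwdDiff_iter (p : ℝ[X]) (k : ℕ) :
    ∃ q : ℝ[X], q.natDegree ≤ p.natDegree - k ∧ ∀ x, q.eval x = ((fwdDiff (1 : ℝ))^[k] p.eval) x := by
  induction k with
  | zero => exact ⟨p, le_rfl, fun x => rfl⟩
  | succ k ih =>
    obtain ⟨q, hq, hqe⟩ := ih
    refine ⟨taylor 1 q - q, ?_, fun x => ?_⟩
    · have key : (taylor 1 q - q).natDegree ≤ q.natDegree - 1 := by
        by_cases h0 : q.natDegree = 0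
        · obtain ⟨c, rfl⟩ := natDegree_eq_zero.1 h0
          simp
        · have hq0 : taylor 1 q ≠ 0 := by
            intro h
            apply h0
            rw [← natDegree_taylor q 1, h, natDegree_zero]
          have h1 : (taylor 1 q).degree = q.degree := degree_taylor q 1
          have h2 := degree_sub_lt_left h1 hq0 (leadingCoeff_taylor _ _)
          rw [h1] at h2
          by_cases h3 : taylor 1 q - q = 0
          · simp [h3]
          · have := natDegree_lt_natDegree h3 h2
            omega
      omega
    · rw [Function.iterate_succ_apply', fwdDiff, ← hqe, ← hqe, eval_sub, taylor_eval]

lemma poly_alternating_sum_eq_zero {D : ℕ} (p : ℝ[X]) (hp : p.natDegree < D) (y : ℝ) :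
    ∑ j ∈ range (D + 1), ((-1 : ℝ) ^ (D - j) * D.choose j) * p.eval (y - j) = 0 := by
  have h1 : (p.comp (C y - X)).natDegree < D := by
    refine lt_of_le_of_lt natDegree_comp_le ?_
    have : (C y - X : ℝ[X]).natDegree ≤ 1 := by
      refine (natDegree_sub_le _ _).trans ?_
      simp
    nlinarith
  have h2 := congrFun (fwdDiff_iter_eq_zero_of_degree_lt h1) 0
  rw [fwdDiff_iter_eq_sum_shift] at h2
  simp only [Pi.zero_apply] at h2
  rw [← h2]
  refine sum_congr rfl fun j _ => ?_
  simp [zsmul_eq_mul]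

/-- Summation by parts against a polynomial, for a test function vanishing near both ends. -/
lemma sum_fwdDiff_mul_poly {D N : ℕ} (hDN : D < N) (g : ℝ → ℝ)
    (hg1 : ∀ k : ℕ, 1 ≤ k → k < D → g k = 0) (hg2 : ∀ k : ℕ, N ≤ k → k < N + D → g k = 0)
    (p : ℝ[X]) (hp : p.natDegree < D) :
    ∑ x ∈ range N, ((fwdDiff (1 : ℝ))^[D] g) x * p.eval (x : ℝ) = (-1) ^ D * g 0 * p.eval 0 := by
  have h1 : ∀ x : ℕ, ((fwdDiff (1 : ℝ))^[D] g) (x : ℝ) * p.eval (x : ℝ) =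
      ∑ j ∈ range (D + 1), ((-1 : ℝ) ^ (D - j) * D.choose j) *
        (g ((x + j : ℕ) : ℝ) * p.eval (x : ℝ)) := by
    intro x
    rw [fwdDiff_iter_eq_sum_shift, sum_mul]
    refine sum_congr rfl fun j _ => ?_
    simp [zsmul_eq_mul, mul_assoc]
  have h2 : ∀ j ∈ range (D + 1), ∑ x ∈ range N, g ((x + j : ℕ) : ℝ) * p.eval (x : ℝ) =
      ∑ k ∈ range (N + D), if j ≤ k ∧ k < N + j then g k * p.eval ((k : ℝ) - j) else 0 := by
    intro j hj
    rw [mem_range] at hj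
    rw [← sum_filter]
    refine sum_nbij' (fun x => x + j) (fun k => k - j) ?_ ?_ ?_ ?_ ?_
    · intro x hx
      simp only [mem_filter, mem_range] at *
      omega
    · intro x hx
      simp only [mem_filter, mem_range] at *
      omega
    · intro x hx
      simp
    · intro x hx
      simp only [mem_filter, mem_range] at *
      omega
    · intro x hx
      simp
  simp_rw [h1]
  rw [sum_comm]
  simp_rw [← mul_sum]
  rw [sum_congr rfl fun j hj => by rw [h2 j hj]]
  simp_rw [mul_sum]
  -- Grouped by k, the coefficient of g k is a complete alternating sum of p when D ≤ k < N, hence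
  -- zero. For the other k ≥ 1 the factor g k vanishes, and k = 0 retains only j = 0.
  rw [sum_comm, ← sum_subset (s₁ := {0})]
  · rw [sum_singleton, sum_eq_single 0]
    · rw [if_pos ⟨le_rfl, by omega⟩]
      simp
      ring
    · intro j _ hj0
      rw [if_neg (by omega), mul_zero]
    · simp
  · intro x hx
    simp only [mem_singleton] at hx
    simp [hx]
    omega
  · intro k hk hk0
    simp only [mem_range, mem_singleton] at hk hk0
    rcases lt_or_ge k D with h | h
    · rw [hg1 k (by omega) h]
      simp
    rcases lt_or_ge k N with h' | h'
    · rw [← mul_zero (g k), ← poly_alternating_sum_eq_zero p hp k, mul_sum]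
      refine sum_congr rfl fun j hj => ?_
      rw [mem_range] at hj
      rw [if_pos ⟨by omega, by omega⟩]
      ring
    · rw [hg2 k h' hk]
      simp

/-- With P and R the two products, 1 − R/P is the exact leverage of the endpoint found in
`poly_endpoint_leverage`; this turns it into a rational bound. The induction closes because the
cross-multiplied difference of consecutive steps is an explicit nonnegative polynomial times P. -/
lemma prod_ratio_bound (N D : ℕ) (h : D < N) :
    (2 * (N : ℝ) - 1 - D ^ 2) * ∏ k ∈ range D, ((N : ℝ) + k) ≤
      (2 * (N : ℝ) - 1 + D ^ 2) * ∏ k ∈ range D, ((N : ℝ) - 1 - k) := by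
  induction D with
  | zero => simp
  | succ D ih =>
    have ih := ih (by omega)
    have hN : (D : ℝ) + 2 ≤ N := by exact_mod_cast h
    rw [prod_range_succ, prod_range_succ]
    have hP : 0 < ∏ k ∈ range D, ((N : ℝ) + k) := prod_pos fun k _ => by
      have : (0 : ℝ) ≤ k := by positivity
      have : (0 : ℝ) ≤ D := by positivity
      linarith
    set P := ∏ k ∈ range D, ((N : ℝ) + k)
    set R := ∏ k ∈ range D, ((N : ℝ) - 1 - k)
    push_cast
    have hD : (0 : ℝ) ≤ D := by positivity
    generalize (N : ℝ) = n at *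
    generalize (D : ℝ) = e at *
    have hpos : 0 < 2 * n - 1 + e ^ 2 := by nlinarith
    have h1 : (2 * n - 1 + (e + 1) ^ 2) * ((2 * n - 1 - e ^ 2) * P) * (n - 1 - e) ≤
        (2 * n - 1 + (e + 1) ^ 2) * ((2 * n - 1 + e ^ 2) * R) * (n - 1 - e) := by
      apply mul_le_mul_of_nonneg_right _ (by linarith)
      exact mul_le_mul_of_nonneg_left ih (by nlinarith)
    have h2 : (2 * n - 1 + e ^ 2) * ((2 * n - 1 - (e + 1) ^ 2) * (P * (n + e))) ≤
        (2 * n - 1 + (e + 1) ^ 2) * ((2 * n - 1 - e ^ 2) * P) * (n - 1 - e) := by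
      have : (2 * n - 1 + (e + 1) ^ 2) * ((2 * n - 1 - e ^ 2) * P) * (n - 1 - e) -
        (2 * n - 1 + e ^ 2) * ((2 * n - 1 - (e + 1) ^ 2) * (P * (n + e))) =
        P * (((e + 1) ^ 2) * e ^ 2 * (2 * e + 1)) := by ring
      have h3 : 0 ≤ P * (((e + 1) ^ 2) * e ^ 2 * (2 * e + 1)) := by positivity
      linarith
    have h4 := h2.trans h1
    have h5 : (2 * n - 1 + (e + 1) ^ 2) * ((2 * n - 1 + e ^ 2) * R) * (n - 1 - e) =
      (2 * n - 1 + e ^ 2) * ((2 * n - 1 + (e + 1) ^ 2) * (R * (n - 1 - e))) := by ring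
    rw [h5] at h4
    exact le_of_mul_le_mul_left h4 hpos

/-- Leverage of polynomials at an endpoint of a discrete interval. -/
lemma poly_endpoint_leverage {d N : ℕ} (hN : 0 < N) (p : ℝ[X]) (hp : p.natDegree ≤ d) :
    (((d : ℝ) + 1) ^ 2 + 2 * N - 1) * p.eval 0 ^ 2 ≤
      2 * ((d : ℝ) + 1) ^ 2 * ∑ x ∈ range N, p.eval (x : ℝ) ^ 2 := by
  obtain ⟨D, hD⟩ : ∃ D, D = d + 1 := ⟨_, rfl⟩
  have hDr : (d : ℝ) + 1 = D := by rw [hD]; push_cast; ring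
  rw [hDr]
  have hD1 : (1 : ℝ) ≤ D := by exact_mod_cast (by omega : 1 ≤ D)
  have hN1 : (1 : ℝ) ≤ N := by exact_mod_cast hN
  rcases le_or_gt N D with hND | hND
  · have h0 : p.eval 0 ^ 2 ≤ ∑ x ∈ range N, p.eval (x : ℝ) ^ 2 := by
      have := single_le_sum (f := fun x : ℕ => p.eval (x : ℝ) ^ 2) (s := range N)
        (fun i _ => sq_nonneg _) (mem_range.2 hN)
      simpa using this
    have hND' : (N : ℝ) ≤ D := by exact_mod_cast hND
    have h1 : (D : ℝ) ^ 2 + 2 * N - 1 ≤ 2 * D ^ 2 := by nlinarith [sq_nonneg ((D : ℝ) - 1)]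
    exact mul_le_mul h1 h0 (sq_nonneg _) (by positivity)
  -- A discrete Rodrigues formula: g vanishes at 1, …, D − 1 and at N, …, N + D − 1, and has degree
  -- at most 2D − 1. Its D-th difference w therefore has degree below D and represents, up to the
  -- factor A, evaluation at 0.
  · set g : ℝ[X] := (∏ i ∈ Ico 1 D, (X - C (i : ℝ))) * ∏ i ∈ range D, (X - C ((N : ℝ) + i))
      with hgdef
    have hge : ∀ x : ℝ, g.eval x =
        (∏ i ∈ Ico 1 D, (x - i)) * ∏ i ∈ range D, (x - (N + i)) := by
      intro x
      rw [hgdef, eval_mul, eval_prod, eval_prod]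
      simp
    have hgdeg : g.natDegree ≤ 2 * D - 1 := by
      refine natDegree_mul_le.trans ?_
      have a1 := natDegree_prod_le (Ico 1 D) (fun i : ℕ => (X - C (i : ℝ)))
      have a2 := natDegree_prod_le (range D) (fun i : ℕ => (X - C ((N : ℝ) + i)))
      simp only [natDegree_X_sub_C, sum_const, Nat.card_Ico, card_range,
        smul_eq_mul, mul_one] at a1 a2
      omega
    obtain ⟨w, hw, hwe⟩ := exists_poly_fwdDiff_iter g D
    have hg1 : ∀ k : ℕ, 1 ≤ k → k < D → g.eval (k : ℝ) = 0 := by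
      intro k h1 h2
      rw [hge, prod_eq_zero (i := k) (mem_Ico.2 ⟨h1, h2⟩) (sub_self _), zero_mul]
    have hg2 : ∀ k : ℕ, N ≤ k → k < N + D → g.eval (k : ℝ) = 0 := by
      intro k h1 h2
      rw [hge, prod_eq_zero (s := range D) (i := k - N) (mem_range.2 (by omega)), mul_zero]
      rw [Nat.cast_sub h1]
      ring
    have rep : ∀ q : ℝ[X], q.natDegree < D → ∑ x ∈ range N, w.eval (x : ℝ) * q.eval (x : ℝ) =
        (-1) ^ D * g.eval 0 * q.eval 0 := by
      intro q hq
      rw [← sum_fwdDiff_mul_poly hND g.eval hg1 hg2 q hq]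
      exact sum_congr rfl fun x _ => by rw [hwe]
    have hwD : w.natDegree < D := by omega
    have hw0 : w.eval 0 = (-1) ^ D * g.eval 0 + g.eval (D : ℝ) := by
      rw [hwe, fwdDiff_iter_eq_sum_shift, sum_range_succ, ← sum_subset (s₁ := {0})]
      · simp [zsmul_eq_mul]
      · intro x hx
        simp only [mem_singleton] at hx
        simp [hx]
        omega
      · intro k hk hk0
        simp only [mem_range, mem_singleton] at hk hk0
        have := hg1 k (by omega) hk
        simp [this]
    set A : ℝ := (-1) ^ D * g.eval 0 with hA
    obtain ⟨F, hF, hF0⟩ : ∃ F : ℝ, F = ∏ i ∈ Ico 1 D, ((D : ℝ) - i) ∧ 0 < F := by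
      refine ⟨_, rfl, prod_pos fun i hi => ?_⟩
      rw [mem_Ico] at hi
      have : (i : ℝ) < D := by exact_mod_cast hi.2
      linarith
    have hFi : ∏ i ∈ Ico 1 D, (i : ℝ) = F := by
      rw [hF]
      refine prod_nbij' (fun i => D - i) (fun i => D - i) ?_ ?_ ?_ ?_ ?_
      all_goals intro i hi; rw [mem_Ico] at hi
      · rw [mem_Ico]; omega
      · rw [mem_Ico]; omega
      · omega
      · omega
      · rw [Nat.cast_sub hi.2.le]; ring
    set P := ∏ k ∈ range D, ((N : ℝ) + k) with hP
    set R := ∏ k ∈ range D, ((N : ℝ) - 1 - k) with hR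
    have hPpos : 0 < P := prod_pos fun k _ => by positivity
    have hg0 : g.eval 0 = -(F * P) := by
      rw [hge]
      simp only [zero_sub]
      rw [prod_neg, prod_neg, hFi, Nat.card_Ico, card_range]
      rw [show (-1 : ℝ) ^ (D - 1) * F * ((-1) ^ D * P) = (-1) ^ (D - 1) * (-1) ^ D * (F * P) by ring,
        ← pow_add, show D - 1 + D = 2 * (D - 1) + 1 by omega, pow_succ, pow_mul]
      simp
    have hgD : g.eval (D : ℝ) = (-1) ^ D * (F * R) := by
      rw [hge, ← hF]
      have : ∏ i ∈ range D, ((D : ℝ) - (N + i)) = (-1) ^ D * R := by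
        have hn := prod_neg (s := range D) (f := fun k : ℕ => (N : ℝ) - 1 - k)
        rw [card_range] at hn
        rw [hR, ← hn, ← prod_range_reflect]
        refine prod_congr rfl fun i hi => ?_
        rw [mem_range] at hi
        rw [show D - 1 - i = D - (1 + i) by omega, Nat.cast_sub (by omega)]
        push_cast
        ring
      rw [this]
      ring
    -- Testing the representer against itself gives ∑ w² = A · w(0), so Cauchy–Schwarz against p
    -- loses nothing.
    have hww := rep w hwD
    have hCS : (∑ x ∈ range N, w.eval (x : ℝ) * p.eval (x : ℝ)) ^ 2 ≤
        (∑ x ∈ range N, w.eval (x : ℝ) ^ 2) * ∑ x ∈ range N, p.eval (x : ℝ) ^ 2 :=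
      sum_mul_sq_le_sq_mul_sq _ _ _
    rw [rep p (by omega)] at hCS
    simp_rw [← pow_two] at hww
    rw [hww, hw0, hgD, hA, hg0] at hCS
    have hs : ((-1 : ℝ) ^ D) ^ 2 = 1 := by rw [← pow_mul, mul_comm, pow_mul]; simp
    set T := ∑ x ∈ range N, p.eval (x : ℝ) ^ 2
    have hT : 0 ≤ T := sum_nonneg fun i _ => sq_nonneg _
    have e1 : ((-1) ^ D * -(F * P) * eval 0 p) ^ 2 = F ^ 2 * P * (P * eval 0 p ^ 2) := by
      rw [show ((-1) ^ D * -(F * P) * eval 0 p) ^ 2 =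
        ((-1 : ℝ) ^ D) ^ 2 * (F ^ 2 * P * (P * eval 0 p ^ 2)) by ring, hs, one_mul]
    have e2 : (-1) ^ D * -(F * P) * ((-1) ^ D * -(F * P) + (-1) ^ D * (F * R)) * T =
        F ^ 2 * P * ((P - R) * T) := by
      rw [show (-1) ^ D * -(F * P) * ((-1) ^ D * -(F * P) + (-1) ^ D * (F * R)) * T =
        ((-1 : ℝ) ^ D) ^ 2 * (F ^ 2 * P * ((P - R) * T)) by ring, hs, one_mul]
    rw [e1, e2] at hCS
    have h1 : P * eval 0 p ^ 2 ≤ (P - R) * T := le_of_mul_le_mul_left hCS (by positivity)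
    have h2 := prod_ratio_bound N D hND
    rw [← hP, ← hR] at h2
    have h3 : (2 * (N : ℝ) - 1 + D ^ 2) * (P - R) ≤ 2 * D ^ 2 * P := by linarith
    have h4 : P * ((D ^ 2 + 2 * N - 1) * eval 0 p ^ 2) ≤ P * (2 * D ^ 2 * T) := by
      have hpos : 0 ≤ 2 * (N : ℝ) - 1 + D ^ 2 := by nlinarith
      have := mul_le_mul_of_nonneg_left h1 hpos
      have := mul_le_mul_of_nonneg_right h3 hT
      linarith
    exact le_of_mul_le_mul_left h4 hPpos

/-- Leverage of polynomials on a discrete interval. -/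
lemma poly_leverage {d N x : ℕ} (hx : x < N) (p : ℝ[X]) (hp : p.natDegree ≤ d) :
    N * p.eval (x : ℝ) ^ 2 ≤ ((d : ℝ) + 1) ^ 2 * ∑ i ∈ range N, p.eval (i : ℝ) ^ 2 := by
  have hc1 : (p.comp (X + C (x : ℝ))).natDegree ≤ d := by
    rw [natDegree_comp, natDegree_X_add_C, mul_one]
    exact hp
  have hc2 : (p.comp (C (x : ℝ) - X)).natDegree ≤ d := by
    refine natDegree_comp_le.trans ?_
    have : (C (x : ℝ) - X : ℝ[X]).natDegree ≤ 1 := by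
      refine (natDegree_sub_le _ _).trans ?_
      simp
    nlinarith
  -- The point x is an endpoint of both {x, …, N − 1} and {0, …, x}. Adding the two endpoint bounds
  -- counts x twice, and the extra term 2(d + 1)² p(x)² cancels against the left side.
  have h1 := poly_endpoint_leverage (N := N - x) (by omega) _ hc1
  have h2 := poly_endpoint_leverage (N := x + 1) (by omega) _ hc2
  simp only [eval_comp, eval_add, eval_sub, eval_X, eval_C, zero_add, sub_zero] at h1 h2
  have s1 : ∑ i ∈ range (N - x), eval ((i : ℝ) + x) p ^ 2 + ∑ i ∈ range x, eval (i : ℝ) p ^ 2 =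
      ∑ i ∈ range N, p.eval (i : ℝ) ^ 2 := by
    have := sum_range_add_sum_Ico (fun i : ℕ => eval (i : ℝ) p ^ 2) hx.le
    rw [← this, sum_Ico_eq_sum_range, add_comm]
    congr 1
    refine sum_congr rfl fun i _ => ?_
    push_cast
    rw [add_comm]
  have s2 : ∑ i ∈ range (x + 1), eval ((x : ℝ) - i) p ^ 2 =
      ∑ i ∈ range x, eval (i : ℝ) p ^ 2 + eval (x : ℝ) p ^ 2 := by
    rw [← sum_range_succ (fun i : ℕ => eval (i : ℝ) p ^ 2), ← sum_range_reflect]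
    refine sum_congr rfl fun i hi => ?_
    rw [mem_range] at hi
    rw [show x + 1 - 1 - i = x - i by omega, Nat.cast_sub (by omega)]
    ring_nf
  rw [s2] at h2
  rw [← s1]
  rw [Nat.cast_sub hx.le] at h1
  push_cast at h2
  nlinarith

end Leverage

/-! ### Piecewise polynomial vectors -/

noncomputable section

/-- The space `ℝⁿ` with its Euclidean norm. -/
abbrev Vec (n : ℕ) : Type := EuclideanSpace ℝ (Fin n)

variable {n d : ℕ}

lemma vec_inner (u v : Vec n) : inner ℝ u v = ∑ i, u i * v i := by
  rw [PiLp.inner_apply]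
  exact Finset.sum_congr rfl fun i _ => by simp [mul_comm]

lemma vec_norm_sq (u : Vec n) : ‖u‖ ^ 2 = ∑ i, u i ^ 2 := by
  rw [EuclideanSpace.norm_sq_eq]
  simp

lemma abs_apply_le_norm (u : Vec n) (i : Fin n) : |u i| ≤ ‖u‖ := by
  simpa using PiLp.norm_apply_le u i

/-- The vector whose coordinates outside `I` are replaced by `0`. -/
def restr (I : Finset (Fin n)) : Vec n →ₗ[ℝ] Vec n where
  toFun v := WithLp.toLp 2 (fun i => if i ∈ I then v i else 0)
  map_add' u v := by ext i; by_cases h : i ∈ I <;> simp [h]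
  map_smul' r v := by ext i; by_cases h : i ∈ I <;> simp [h]

@[simp] lemma restr_apply (I : Finset (Fin n)) (v : Vec n) (i : Fin n) :
    restr I v i = if i ∈ I then v i else 0 := rfl

/-- The vector `(p(0), …, p(n-1))`. -/
def polyVec (n : ℕ) : ℝ[X] →ₗ[ℝ] Vec n where
  toFun p := WithLp.toLp 2 (fun i : Fin n => p.eval (i : ℝ))
  map_add' u v := by ext i; simp
  map_smul' r v := by ext i; simp

@[simp] lemma polyVec_apply (p : ℝ[X]) (i : Fin n) : polyVec n p i = p.eval (i : ℝ) := rfl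

lemma restr_restr (I J : Finset (Fin n)) (v : Vec n) :
    restr I (restr J v) = restr (I ∩ J) v := by
  ext i
  by_cases h : i ∈ I <;> simp [h]

lemma restr_restr_of_subset {I J : Finset (Fin n)} (h : I ⊆ J) (v : Vec n) :
    restr I (restr J v) = restr I v := by
  rw [restr_restr, Finset.inter_eq_left.2 h]

lemma restr_restr_of_subset' {I J : Finset (Fin n)} (h : I ⊆ J) (v : Vec n) :
    restr J (restr I v) = restr I v := by
  rw [restr_restr, Finset.inter_eq_right.2 h]

lemma inner_restr (I : Finset (Fin n)) (u v : Vec n) :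
    inner ℝ (restr I u) v = inner ℝ u (restr I v) := by
  rw [vec_inner, vec_inner]
  refine Finset.sum_congr rfl fun i _ => ?_
  by_cases h : i ∈ I <;> simp [h]

lemma inner_restr_restr (I : Finset (Fin n)) (u v : Vec n) :
    inner ℝ (restr I u) (restr I v) = inner ℝ u (restr I v) := by
  rw [inner_restr, restr_restr, Finset.inter_self]

lemma inner_restr_disjoint {I J : Finset (Fin n)} (h : Disjoint I J) (u v : Vec n) :
    inner ℝ (restr I u) (restr J v) = 0 := by
  rw [inner_restr, restr_restr, Finset.disjoint_iff_inter_eq_empty.1 h, vec_inner]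
  simp

lemma norm_sq_restr (I : Finset (Fin n)) (v : Vec n) : ‖restr I v‖ ^ 2 = ∑ i ∈ I, v i ^ 2 := by
  rw [vec_norm_sq, ← Finset.sum_subset (Finset.subset_univ I)]
  · exact Finset.sum_congr rfl fun i hi => by simp [hi]
  · intro i _ hi
    simp [hi]

lemma norm_restr_le (I : Finset (Fin n)) (v : Vec n) : ‖restr I v‖ ≤ ‖v‖ := by
  refine le_of_sq_le_sq ?_ (norm_nonneg _)
  rw [norm_sq_restr, vec_norm_sq]
  exact Finset.sum_le_sum_of_subset_of_nonneg (Finset.subset_univ _) fun i _ _ => sq_nonneg _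

lemma parts_inter_eq_empty {m : BlockPartition n} {I J : Finset (Fin n)} (hI : I ∈ m.parts)
    (hJ : J ∈ m.parts) (h : I ≠ J) : I ∩ J = ∅ :=
  Finset.disjoint_iff_inter_eq_empty.1 (m.disjoint hI hJ h)

lemma restr_empty (v : Vec n) : restr ∅ v = 0 := by
  ext i
  simp

lemma sum_restr (m : BlockPartition n) (v : Vec n) : ∑ I ∈ m.parts, restr I v = v := by
  ext i
  obtain ⟨J, ⟨hJ, hiJ⟩, hu⟩ := m.existsUnique_mem (Finset.mem_univ i)
  rw [show (∑ I ∈ m.parts, restr I v) i = ∑ I ∈ m.parts, restr I v i by simp,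
    Finset.sum_eq_single J]
  · simp [hiJ]
  · intro I hI hIJ
    simp only [restr_apply, ite_eq_right_iff]
    exact fun hi => absurd (hu I ⟨hI, hi⟩) hIJ
  · exact fun h => absurd hJ h

lemma norm_sq_eq_sum_restr (m : BlockPartition n) (v : Vec n) :
    ‖v‖ ^ 2 = ∑ I ∈ m.parts, ‖restr I v‖ ^ 2 := by
  rw [← real_inner_self_eq_norm_sq]
  conv_lhs => rw [← sum_restr m v, sum_inner]
  refine Finset.sum_congr rfl fun I _ => ?_
  rw [sum_restr, ← real_inner_self_eq_norm_sq, inner_restr_restr, inner_restr]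

/-- Vectors supported by `I` which are polynomials of degree at most `d` on `I`. -/
def locPoly (d : ℕ) (I : Finset (Fin n)) : Submodule ℝ (Vec n) :=
  (degreeLT ℝ (d + 1)).map (restr I ∘ₗ polyVec n)

lemma mem_degreeLT_succ {p : ℝ[X]} : p ∈ degreeLT ℝ (d + 1) ↔ p.natDegree ≤ d := by
  rw [mem_degreeLT, ← Nat.lt_succ_iff]
  rcases eq_or_ne p 0 with rfl | h
  · simp
  · rw [degree_eq_natDegree h]
    exact Nat.cast_lt

lemma mem_locPoly {I : Finset (Fin n)} {v : Vec n} :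
    v ∈ locPoly d I ↔ ∃ p : ℝ[X], p.natDegree ≤ d ∧ v = restr I (polyVec n p) := by
  simp only [locPoly, Submodule.mem_map, mem_degreeLT_succ]
  exact ⟨fun ⟨p, h1, h2⟩ => ⟨p, h1, h2.symm⟩, fun ⟨p, h1, h2⟩ => ⟨p, h1, h2.symm⟩⟩

lemma restr_polyVec_mem (I : Finset (Fin n)) {p : ℝ[X]} (hp : p.natDegree ≤ d) :
    restr I (polyVec n p) ∈ locPoly d I := mem_locPoly.2 ⟨p, hp, rfl⟩

lemma restr_of_mem_locPoly {I J : Finset (Fin n)} (h : I ⊆ J) {v : Vec n}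
    (hv : v ∈ locPoly d I) : restr J v = v := by
  obtain ⟨p, hp, rfl⟩ := mem_locPoly.1 hv
  rw [restr_restr_of_subset' h]

lemma restr_mem_locPoly {I J : Finset (Fin n)} (h : I ⊆ J) {v : Vec n}
    (hv : v ∈ locPoly d J) : restr I v ∈ locPoly d I := by
  obtain ⟨p, hp, rfl⟩ := mem_locPoly.1 hv
  rw [restr_restr_of_subset h]
  exact restr_polyVec_mem I hp

/-- The map sending a family of polynomials indexed by the blocks to the corresponding vector. -/
def pwMap (d : ℕ) (m : BlockPartition n) :
    ((I : m.parts) → degreeLT ℝ (d + 1)) →ₗ[ℝ] Vec n :=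
  ∑ I : m.parts, (restr (I : Finset (Fin n)) ∘ₗ polyVec n ∘ₗ (degreeLT ℝ (d + 1)).subtype) ∘ₗ
    LinearMap.proj I

lemma pwMap_apply (m : BlockPartition n) (f : (I : m.parts) → degreeLT ℝ (d + 1)) :
    pwMap d m f = ∑ I : m.parts, restr (I : Finset (Fin n)) (polyVec n (f I)) := by
  simp [pwMap]

lemma restr_pwMap (m : BlockPartition n) (f : (I : m.parts) → degreeLT ℝ (d + 1))
    (J : m.parts) : restr (J : Finset (Fin n)) (pwMap d m f) =
      restr (J : Finset (Fin n)) (polyVec n (f J)) := by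
  rw [pwMap_apply, map_sum, Finset.sum_eq_single J]
  · rw [restr_restr, Finset.inter_self]
  · intro I _ hIJ
    rw [restr_restr, parts_inter_eq_empty J.2 I.2 (fun h => hIJ (Subtype.ext h).symm), restr_empty]
  · simp

/-- Vectors which are polynomials of degree at most `d` on each block of `m`. -/
def pw (d : ℕ) (m : BlockPartition n) : Submodule ℝ (Vec n) := LinearMap.range (pwMap d m)

lemma mem_pw {m : BlockPartition n} {v : Vec n} :
    v ∈ pw d m ↔ ∀ I ∈ m.parts, restr I v ∈ locPoly d I := by
  constructor
  · rintro ⟨f, rfl⟩ I hI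
    rw [restr_pwMap m f ⟨I, hI⟩]
    exact restr_polyVec_mem I (mem_degreeLT_succ.1 (f ⟨I, hI⟩).2)
  · intro h
    choose! p hp hpe using fun I hI => mem_locPoly.1 (h I hI)
    refine ⟨fun I => ⟨p I, mem_degreeLT_succ.2 (hp I I.2)⟩, ?_⟩
    rw [pwMap_apply]
    rw [← sum_restr m v, ← Finset.sum_coe_sort m.parts (fun I => restr I v)]
    exact Finset.sum_congr rfl fun I _ => (hpe I I.2).symm

lemma locPoly_le_pw {m : BlockPartition n} {I : Finset (Fin n)} (hI : I ∈ m.parts) :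
    locPoly d I ≤ pw d m := by
  intro v hv
  rw [mem_pw]
  intro J hJ
  by_cases h : J = I
  · subst h
    rw [restr_of_mem_locPoly subset_rfl hv]
    exact hv
  · obtain ⟨p, hp, rfl⟩ := mem_locPoly.1 hv
    rw [restr_restr, parts_inter_eq_empty hJ hI h, restr_empty]
    exact (locPoly d J).zero_mem

lemma restr_mem_pw {m : BlockPartition n} {I : Finset (Fin n)} (hI : I ∈ m.parts) {v : Vec n}
    (hv : v ∈ pw d m) : restr I v ∈ pw d m := locPoly_le_pw hI (mem_pw.1 hv I hI)

lemma polyVec_mem_pw (m : BlockPartition n) {p : ℝ[X]} (hp : p.natDegree ≤ d) :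
    polyVec n p ∈ pw d m := mem_pw.2 fun I _ => restr_polyVec_mem I hp

lemma finrank_degreeLT (k : ℕ) : Module.finrank ℝ (degreeLT ℝ k) = k := by
  rw [(degreeLTEquiv ℝ k).finrank_eq]
  simp

instance (k : ℕ) : Module.Finite ℝ (degreeLT ℝ k) :=
  Module.Finite.equiv (degreeLTEquiv ℝ k).symm

lemma finrank_pw_le (m : BlockPartition n) :
    Module.finrank ℝ (pw d m) ≤ (d + 1) * m.parts.card := by
  refine (LinearMap.finrank_range_le _).trans ?_
  rw [Module.finrank_pi_fintype]
  simp [finrank_degreeLT, mul_comm]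

lemma poly_eq_zero_of_restr {I : Finset (Fin n)} (hI : d + 1 ≤ I.card) {p : ℝ[X]}
    (hp : p.natDegree ≤ d) (h : restr I (polyVec n p) = 0) : p = 0 := by
  refine eq_zero_of_natDegree_lt_card_of_eval_eq_zero' p
    (I.image fun i : Fin n => (i : ℝ)) ?_ ?_
  · intro x hx
    obtain ⟨i, hi, rfl⟩ := Finset.mem_image.1 hx
    have := congrArg (fun v : Vec n => v i) h
    simpa [hi] using this
  · rw [Finset.card_image_of_injective]
    · omega
    · intro i j hij
      simp only [Nat.cast_inj] at hij
      exact Fin.ext hij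

/-- A block with at least d + 1 points determines a polynomial of degree at most d, so the
parametrization by families of polynomials is injective. -/
lemma finrank_pw {m : BlockPartition n} (hm : Admissible d m) :
    Module.finrank ℝ (pw d m) = (d + 1) * m.parts.card := by
  rw [pw, LinearMap.finrank_range_of_inj, Module.finrank_pi_fintype]
  · simp [finrank_degreeLT, mul_comm]
  · rw [← LinearMap.ker_eq_bot, LinearMap.ker_eq_bot']
    intro f hf
    ext1 J
    have h := restr_pwMap m f J
    rw [hf, map_zero] at h
    have := poly_eq_zero_of_restr (hm J J.2).2 (mem_degreeLT_succ.1 (f J).2) h.symm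
    exact Subtype.ext this

/-- The orthogonal projection onto piecewise polynomial vectors acts blockwise. -/
lemma starProjection_pw (m : BlockPartition n) (v : Vec n) :
    (pw d m).starProjection v = ∑ I ∈ m.parts, (locPoly d I).starProjection v := by
  apply Submodule.eq_starProjection_of_mem_of_inner_eq_zero
  · exact Submodule.sum_mem _ fun I hI =>
      locPoly_le_pw hI (Submodule.starProjection_apply_mem _ _)
  · intro w hw
    have h1 : ∀ I ∈ m.parts, inner ℝ ((locPoly d I).starProjection v) w =
        inner ℝ (restr I v) w := by
      intro I hI
      have h2 := mem_pw.1 hw I hI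
      rw [← restr_of_mem_locPoly subset_rfl (Submodule.starProjection_apply_mem (locPoly d I) v),
        inner_restr, Submodule.inner_starProjection_left_eq_right,
        Submodule.starProjection_eq_self_iff.2 h2, inner_restr]
    rw [inner_sub_left, sum_inner, Finset.sum_congr rfl h1, ← sum_inner, sum_restr, sub_self]

end

noncomputable section

variable {n d : ℕ}

/-! ### The models as spaces of piecewise polynomial vectors -/

/-- The index is the one whose grid interval contains x; it belongs to I because I has no holes.
Consequently cells of disjoint blocks are disjoint. -/
lemma exists_mem_of_mem_cell {I : Finset (Fin n)} (hI : I.Nonempty)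
    (hc : (I : Set (Fin n)).OrdConnected) {x : ℝ} (hx : x ∈ cell I hI) :
    ∃ i ∈ I, (i : ℕ) = ⌈n * x⌉₊ - 1 := by
  have hn : 0 < n := by
    obtain ⟨i, _⟩ := hI
    exact Fin.pos i
  have hn' : (0 : ℝ) < n := by exact_mod_cast hn
  obtain ⟨h1, h2⟩ := hx
  rw [div_lt_iff₀ hn', mul_comm] at h1
  rw [le_div_iff₀ hn', mul_comm] at h2
  have h3 : ((I.min' hI : Fin n) : ℕ) < ⌈n * x⌉₊ := Nat.lt_ceil.2 h1
  have h4 : ⌈n * x⌉₊ ≤ ((I.max' hI : Fin n) : ℕ) + 1 := Nat.ceil_le.2 (by exact_mod_cast h2)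
  have h5 : ⌈n * x⌉₊ - 1 < n := by
    have := (I.max' hI).2
    omega
  refine ⟨⟨_, h5⟩, ?_, rfl⟩
  have := hc.out (x := I.min' hI) (y := I.max' hI) (by exact_mod_cast I.min'_mem hI)
    (by exact_mod_cast I.max'_mem hI)
  have h6 := this (a := ⟨⌈n * x⌉₊ - 1, h5⟩) ⟨by rw [Fin.le_def]; simp only; omega,
    by rw [Fin.le_def]; simp only; omega⟩
  exact_mod_cast h6

lemma mul_design (i : Fin n) : (n : ℝ) * design n i = (i : ℝ) + 1 := by
  have : (n : ℝ) ≠ 0 := by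
    have := Fin.pos i
    positivity
  rw [design]
  field_simp

lemma ceil_mul_design (i : Fin n) : ⌈n * design n i⌉₊ - 1 = (i : ℕ) := by
  rw [mul_design, show ((i : ℕ) : ℝ) + 1 = ((i + 1 : ℕ) : ℝ) by push_cast; rfl, Nat.ceil_natCast]
  simp

lemma design_mem_cell {I : Finset (Fin n)} (hI : I.Nonempty) {i : Fin n} (hi : i ∈ I) :
    design n i ∈ cell I hI := by
  have hn : (0 : ℝ) < n := by
    have := Fin.pos i
    positivity
  constructor
  · refine div_lt_div_of_pos_right ?_ hn
    have h1 : ((I.min' hI : Fin n) : ℕ) ≤ i := I.min'_le i hi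
    have h2 : (((I.min' hI : Fin n) : ℕ) : ℝ) ≤ (i : ℕ) := by exact_mod_cast h1
    linarith
  · refine div_le_div_of_nonneg_right ?_ hn.le
    have h1 : (i : ℕ) ≤ ((I.max' hI : Fin n) : ℕ) := I.le_max' i hi
    have h2 : ((i : ℕ) : ℝ) ≤ ((I.max' hI : Fin n) : ℕ) := by exact_mod_cast h1
    linarith

lemma design_mem_cell_iff {I : Finset (Fin n)} (hI : I.Nonempty)
    (hc : (I : Set (Fin n)).OrdConnected) (i : Fin n) : design n i ∈ cell I hI ↔ i ∈ I := by
  refine ⟨fun h => ?_, design_mem_cell hI⟩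
  obtain ⟨j, hj, hji⟩ := exists_mem_of_mem_cell hI hc h
  rw [ceil_mul_design] at hji
  rwa [← Fin.ext hji]

/-- An affine change of variable passes between x and the index n x − 1. Conversely, a polynomial on
one block extends by zero to a piecewise polynomial because distinct cells do not meet. -/
lemma model_eq_pw {m : BlockPartition n} (hm : Admissible d m) : model d m = pw d m := by
  apply le_antisymm
  · refine Submodule.span_le.2 ?_
    rintro v ⟨P, hP, rfl⟩
    refine mem_pw.2 fun I hI => ?_
    obtain ⟨p, hp, hpe⟩ := hP I hI
    refine mem_locPoly.2 ⟨p.comp (C (n : ℝ)⁻¹ * (X + 1)), ?_, ?_⟩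
    · refine natDegree_comp_le.trans ?_
      have : (C (n : ℝ)⁻¹ * (X + 1) : ℝ[X]).natDegree ≤ 1 := by
        refine (natDegree_C_mul_le _ _).trans ?_
        rw [← C_1, natDegree_X_add_C]
      nlinarith
    · ext i
      by_cases hi : i ∈ I
      · simp only [restr_apply, hi, if_true, polyVec_apply, sample]
        rw [hpe _ (design_mem_cell _ hi), eval_comp]
        congr 1
        simp only [eval_mul, eval_C, eval_add, eval_X, eval_one, design]
        ring
      · simp [hi]
  · intro v hv
    rw [← sum_restr m v]
    refine Submodule.sum_mem _ fun I hI => ?_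
    obtain ⟨p, hp, hpe⟩ := mem_locPoly.1 (mem_pw.1 hv I hI)
    rw [hpe]
    classical
    have hIn := m.nonempty_of_mem_parts hI
    refine Submodule.subset_span ⟨fun x => if x ∈ cell I hIn then
      (p.comp (C (n : ℝ) * X - 1)).eval x else 0, ?_, ?_⟩
    · intro J hJ
      by_cases hJI : J = I
      · subst hJI
        refine ⟨p.comp (C (n : ℝ) * X - 1), ?_, fun x hx => by simp [hx]⟩
        refine natDegree_comp_le.trans ?_
        have : (C (n : ℝ) * X - 1 : ℝ[X]).natDegree ≤ 1 := by
          refine (natDegree_sub_le _ _).trans ?_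
          have := natDegree_C_mul_le (n : ℝ) (X : ℝ[X])
          rw [natDegree_X] at this
          simpa using this
        nlinarith
      · refine ⟨0, by simp, fun x hx => ?_⟩
        simp only [eval_zero]
        rw [if_neg]
        intro hx'
        obtain ⟨i, hi, h1⟩ := exists_mem_of_mem_cell _ (hm J hJ).1 hx
        obtain ⟨j, hj, h2⟩ := exists_mem_of_mem_cell _ (hm I hI).1 hx'
        have hij : i = j := Fin.ext (h1.trans h2.symm)
        have := parts_inter_eq_empty hJ hI hJI
        have h3 : i ∈ J ∩ I := Finset.mem_inter.2 ⟨hi, hij ▸ hj⟩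
        rw [this] at h3
        simp at h3
    · ext i
      by_cases hi : i ∈ I
      · simp only [restr_apply, hi, if_true, polyVec_apply, sample]
        rw [if_pos ((design_mem_cell_iff hIn (hm I hI).1 i).2 hi), eval_comp]
        congr 1
        simp only [eval_mul, eval_C, eval_sub, eval_X, eval_one, mul_design]
        ring
      · simp only [restr_apply, hi, if_false, sample]
        rw [if_neg]
        rwa [design_mem_cell_iff hIn (hm I hI).1 i]

lemma modelDim_eq {m : BlockPartition n} (hm : Admissible d m) :
    modelDim d m = (d + 1) * m.parts.card := by
  rw [modelDim, model_eq_pw hm, finrank_pw hm]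

/-! ### Intervals compatible with the reference model, and common refinements -/

/-- `I` is an interval, and restricting a vector of `S` to `I` does not leave `S`. -/
def Stable (S : Submodule ℝ (Vec n)) (I : Finset (Fin n)) : Prop :=
  (I : Set (Fin n)).OrdConnected ∧ ∀ v ∈ S, restr I v ∈ S

lemma Stable.inter {S : Submodule ℝ (Vec n)} {I J : Finset (Fin n)} (hI : Stable S I)
    (hJ : Stable S J) : Stable S (I ∩ J) := by
  refine ⟨?_, fun v hv => ?_⟩
  · rw [Finset.coe_inter]
    exact hI.1.inter hJ.1
  · rw [← restr_restr]
    exact hI.2 _ (hJ.2 _ hv)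

/-- On a block B of the reference partition a vector agrees with a global polynomial p. The
restriction of p to I lies in the model of m, hence in the reference one, and its restriction to B
is therefore polynomial there. Unlike admissibility, this property survives intersection, so it
applies to common refinements. -/
lemma stable_of_le {m m₀ : BlockPartition n} (h : pw d m ≤ pw d m₀) (hm : Admissible d m)
    {I : Finset (Fin n)} (hI : I ∈ m.parts) : Stable (pw d m₀) I := by
  refine ⟨(hm I hI).1, fun v hv => mem_pw.2 fun B hB => ?_⟩
  obtain ⟨p, hp, hpe⟩ := mem_locPoly.1 (mem_pw.1 hv B hB)
  have h1 : restr I (polyVec n p) ∈ pw d m₀ := h (restr_mem_pw hI (polyVec_mem_pw m hp))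
  have h2 := mem_pw.1 h1 B hB
  rw [restr_restr, Finset.inter_comm, ← restr_restr] at h2 ⊢
  rwa [hpe]

lemma Stable.locPoly_le {m₀ : BlockPartition n} {I : Finset (Fin n)}
    (h : Stable (pw d m₀) I) : locPoly d I ≤ pw d m₀ := by
  intro v hv
  obtain ⟨p, hp, rfl⟩ := mem_locPoly.1 hv
  exact h.2 _ (polyVec_mem_pw m₀ hp)

lemma exists_inter_of_mem_inf {m m' : BlockPartition n} {P : Finset (Fin n)}
    (hP : P ∈ (m ⊓ m').parts) : ∃ I ∈ m.parts, ∃ J ∈ m'.parts, P = I ∩ J := by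
  rw [Finpartition.parts_inf, Finset.mem_erase, Finset.mem_image] at hP
  obtain ⟨_, ⟨I, J⟩, h, rfl⟩ := hP
  rw [Finset.mem_product] at h
  exact ⟨I, h.1, J, h.2, rfl⟩

lemma pw_le_of_stable {m m₀ : BlockPartition n} (h : ∀ I ∈ m.parts, Stable (pw d m₀) I) :
    pw d m ≤ pw d m₀ := by
  intro v hv
  rw [← sum_restr m v]
  exact Submodule.sum_mem _ fun I hI => (h I hI).locPoly_le (mem_pw.1 hv I hI)

lemma pw_le_pw_inf_left (m m' : BlockPartition n) : pw d m ≤ pw d (m ⊓ m') := by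
  intro v hv
  refine mem_pw.2 fun P hP => ?_
  obtain ⟨I, hI, J, hJ, rfl⟩ := exists_inter_of_mem_inf hP
  have := restr_mem_locPoly (Finset.inter_subset_left (s₁ := I) (s₂ := J)) (mem_pw.1 hv I hI)
  rwa [restr_restr_of_subset Finset.inter_subset_left] at this

lemma pw_le_pw_inf_right (m m' : BlockPartition n) : pw d m' ≤ pw d (m ⊓ m') := by
  rw [inf_comm]
  exact pw_le_pw_inf_left m' m

/-- The largest element of a nonempty intersection of two intervals is the largest element of one of
them. Blocks of the refinement are disjoint, so they are determined by their maxima. -/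
lemma card_parts_inf_le (m m' : BlockPartition n) (hm : ∀ I ∈ m.parts, (I : Set (Fin n)).OrdConnected)
    (hm' : ∀ I ∈ m'.parts, (I : Set (Fin n)).OrdConnected) :
    (m ⊓ m').parts.card ≤ m.parts.card + m'.parts.card := by
  classical
  let f : Finset (Fin n) → WithBot (Fin n) := fun I => I.max
  have hsub : (m ⊓ m').parts.image f ⊆ m.parts.image f ∪ m'.parts.image f := by
    intro x hx
    obtain ⟨P, hP, rfl⟩ := Finset.mem_image.1 hx
    obtain ⟨I, hI, J, hJ, rfl⟩ := exists_inter_of_mem_inf hP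
    have hne := (m ⊓ m').nonempty_of_mem_parts hP
    obtain ⟨k, hk⟩ := id hne
    rw [Finset.mem_inter] at hk
    have hIn : I.Nonempty := ⟨k, hk.1⟩
    have hJn : J.Nonempty := ⟨k, hk.2⟩
    have key : ∀ {I J : Finset (Fin n)} (hIn : I.Nonempty) (hJn : J.Nonempty),
        (J : Set (Fin n)).OrdConnected → k ∈ I → k ∈ J → I.max' hIn ≤ J.max' hJn →
        (I ∩ J).max = I.max := by
      intro I J hIn hJn hJc hkI hkJ hle
      have h1 : I.max' hIn ∈ J := by
        have := hJc.out (x := k) (y := J.max' hJn) (by exact_mod_cast hkJ)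
          (by exact_mod_cast J.max'_mem hJn)
        exact_mod_cast this ⟨I.le_max' k hkI, hle⟩
      apply le_antisymm (Finset.max_mono Finset.inter_subset_left)
      rw [← Finset.coe_max' hIn]
      exact Finset.le_max (Finset.mem_inter.2 ⟨I.max'_mem hIn, h1⟩)
    rw [Finset.mem_union]
    rcases le_total (I.max' hIn) (J.max' hJn) with h | h
    · left
      exact Finset.mem_image.2 ⟨I, hI, (key hIn hJn (hm' J hJ) hk.1 hk.2 h).symm⟩
    · right
      refine Finset.mem_image.2 ⟨J, hJ, ?_⟩
      have := key hJn hIn (hm I hI) hk.2 hk.1 h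
      rw [Finset.inter_comm] at this
      exact this.symm
  have hinj : Set.InjOn f ((m ⊓ m').parts : Set (Finset (Fin n))) := by
    intro P hP P' hP' h
    have hP : P ∈ (m ⊓ m').parts := hP
    have hP' : P' ∈ (m ⊓ m').parts := hP'
    by_contra hne
    have hd := parts_inter_eq_empty hP hP' hne
    have hPn := (m ⊓ m').nonempty_of_mem_parts hP
    have h1 := Finset.mem_of_max (Finset.coe_max' hPn).symm
    have h2 : P'.max = ((P.max' hPn : Fin n) : WithBot (Fin n)) := by
      rw [Finset.coe_max' hPn]
      exact h.symm
    have h3 := Finset.mem_of_max h2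
    have : P.max' hPn ∈ P ∩ P' := Finset.mem_inter.2 ⟨h1, h3⟩
    rw [hd] at this
    simp at this
  rw [← Finset.card_image_of_injOn hinj]
  refine (Finset.card_le_card hsub).trans ((Finset.card_union_le _ _).trans ?_)
  exact add_le_add Finset.card_image_le Finset.card_image_le

/-! ### Intervals -/

/-- The interval of indices `l ≤ i < r`. -/
def blk (n l r : ℕ) : Finset (Fin n) := Finset.univ.filter fun i => l ≤ (i : ℕ) ∧ (i : ℕ) < r

@[simp] lemma mem_blk {l r : ℕ} {i : Fin n} : i ∈ blk n l r ↔ l ≤ (i : ℕ) ∧ (i : ℕ) < r := by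
  simp [blk]

lemma blk_ordConnected (l r : ℕ) : (blk n l r : Set (Fin n)).OrdConnected := by
  refine ⟨fun x hx y hy z hz => ?_⟩
  have h1 := mem_blk.1 (Finset.mem_coe.1 hx)
  have h2 := mem_blk.1 (Finset.mem_coe.1 hy)
  have h3 : (x : ℕ) ≤ z := hz.1
  have h4 : (z : ℕ) ≤ y := hz.2
  exact Finset.mem_coe.2 (mem_blk.2 (by omega))

lemma exists_eq_blk {I : Finset (Fin n)} (hI : I.Nonempty)
    (hc : (I : Set (Fin n)).OrdConnected) : ∃ l r, l < r ∧ r ≤ n ∧ I = blk n l r := by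
  refine ⟨I.min' hI, I.max' hI + 1, ?_, (I.max' hI).2, ?_⟩
  · have : ((I.min' hI : Fin n) : ℕ) ≤ I.max' hI := I.min'_le _ (I.max'_mem hI)
    omega
  · ext i
    rw [mem_blk]
    constructor
    · intro hi
      have h1 : ((I.min' hI : Fin n) : ℕ) ≤ i := I.min'_le i hi
      have h2 : (i : ℕ) ≤ ((I.max' hI : Fin n) : ℕ) := I.le_max' i hi
      omega
    · rintro ⟨h1, h2⟩
      have := hc.out (x := I.min' hI) (y := I.max' hI) (by exact_mod_cast I.min'_mem hI)
        (by exact_mod_cast I.max'_mem hI)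
      have h3 := this (a := i) ⟨by rw [Fin.le_def]; exact h1, by rw [Fin.le_def]; omega⟩
      exact_mod_cast h3

lemma sum_blk {l r : ℕ} (hr : r ≤ n) (g : ℕ → ℝ) :
    ∑ i ∈ blk n l r, g i = ∑ k ∈ Finset.range (r - l), g (l + k) := by
  rw [← Finset.sum_Ico_eq_sum_range]
  refine Finset.sum_bij (fun i _ => (i : ℕ)) ?_ ?_ ?_ ?_
  · intro i hi
    rw [mem_blk] at hi
    exact Finset.mem_Ico.2 hi
  · intro i _ j _ h
    exact Fin.ext h
  · intro k hk
    rw [Finset.mem_Ico] at hk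
    exact ⟨⟨k, by omega⟩, mem_blk.2 hk, rfl⟩
  · intro i _
    rfl

lemma card_blk {l r : ℕ} (hr : r ≤ n) : (blk n l r).card = r - l := by
  have := sum_blk (l := l) hr (fun _ => (1 : ℝ))
  simp only [Finset.sum_const, Finset.card_range, nsmul_eq_mul, mul_one] at this
  exact_mod_cast this

/-- Leverage of polynomials on an interval of indices. -/
lemma locPoly_leverage {I : Finset (Fin n)} (hc : (I : Set (Fin n)).OrdConnected) {v : Vec n}
    (hv : v ∈ locPoly d I) (i : Fin n) :
    I.card * v i ^ 2 ≤ ((d : ℝ) + 1) ^ 2 * ‖v‖ ^ 2 := by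
  obtain ⟨p, hp, rfl⟩ := mem_locPoly.1 hv
  by_cases hi : i ∈ I
  · obtain ⟨l, r, hlr, hr, rfl⟩ := exists_eq_blk ⟨i, hi⟩ hc
    have hi' := mem_blk.1 hi
    rw [norm_sq_restr, card_blk hr]
    have hc : (p.comp (X + C (l : ℝ))).natDegree ≤ d := by
      rw [natDegree_comp, natDegree_X_add_C, mul_one]
      exact hp
    have := poly_leverage (N := r - l) (x := i - l) (by omega) _ hc
    simp only [polyVec_apply, restr_apply, hi, if_true]
    rw [sum_blk hr (fun k => p.eval (k : ℝ) ^ 2)]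
    simp only [eval_comp, eval_add, eval_X, eval_C] at this
    rw [Nat.cast_sub hi'.1, sub_add_cancel] at this
    refine this.trans_eq ?_
    congr 1
    refine Finset.sum_congr rfl fun k _ => ?_
    push_cast
    rw [add_comm]
  · simp only [restr_apply, hi, if_false]
    simp only [ne_eq, OfNat.ofNat_ne_zero, not_false_eq_true, zero_pow, mul_zero]
    positivity

lemma pw_leverage {m : BlockPartition n} (hm : ∀ I ∈ m.parts, (I : Set (Fin n)).OrdConnected)
    {V : ℝ} (hV : ∀ I ∈ m.parts, ((d : ℝ) + 1) ^ 2 ≤ V * I.card) {v : Vec n}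
    (hv : v ∈ pw d m) (i : Fin n) : v i ^ 2 ≤ V * ‖v‖ ^ 2 := by
  obtain ⟨I, ⟨hI, hi⟩, -⟩ := m.existsUnique_mem (Finset.mem_univ i)
  have h1 := locPoly_leverage (hm I hI) (mem_pw.1 hv I hI) i
  have hcard : (0 : ℝ) < I.card := by
    exact_mod_cast Finset.card_pos.2 ⟨i, hi⟩
  have h2 : ‖restr I v‖ ^ 2 ≤ ‖v‖ ^ 2 := pow_le_pow_left₀ (norm_nonneg _) (norm_restr_le I v) 2
  have h3 : (I.card : ℝ) * v i ^ 2 ≤ I.card * (V * ‖v‖ ^ 2) := by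
    simp only [restr_apply, hi, if_true] at h1
    calc (I.card : ℝ) * v i ^ 2 ≤ ((d : ℝ) + 1) ^ 2 * ‖restr I v‖ ^ 2 := h1
      _ ≤ (V * I.card) * ‖v‖ ^ 2 := mul_le_mul (hV I hI) h2 (by positivity)
          ((sq_nonneg _).trans (hV I hI))
      _ = _ := by ring
  exact le_of_mul_le_mul_left h3 hcard

/-- Leverage summed over J: a polynomial cannot concentrate its energy on a relatively small subset.
This is how leverage enters the comparison of residuals on different intervals. -/
lemma locPoly_restr_le {I J : Finset (Fin n)} (hc : (I : Set (Fin n)).OrdConnected) {v : Vec n}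
    (hv : v ∈ locPoly d I) :
    I.card * ‖restr J v‖ ^ 2 ≤ ((d : ℝ) + 1) ^ 2 * J.card * ‖v‖ ^ 2 := by
  rw [norm_sq_restr, Finset.mul_sum]
  refine (Finset.sum_le_card_nsmul _ _ _ fun i _ => locPoly_leverage hc hv i).trans_eq ?_
  rw [nsmul_eq_mul]
  ring

end

noncomputable section

variable {n d : ℕ} {Ω : Type*}
  {ξ : Fin n → Ω → ℝ} {σ c : ℝ}

/-! ### Deviations of linear functionals of the noise -/

/-- The noise as a random vector. -/
def noise (ξ : Fin n → Ω → ℝ) (ω : Ω) : Vec n := WithLp.toLp 2 (fun i => ξ i ω)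

@[simp] lemma noise_apply (ξ : Fin n → Ω → ℝ) (ω : Ω) (i : Fin n) : noise ξ ω i = ξ i ω := rfl

variable [MeasurableSpace Ω] {μ : Measure Ω}

/-- Independent centered noise variables satisfying the Bernstein condition. -/
structure IsBernsteinNoise (μ : Measure Ω) (ξ : Fin n → Ω → ℝ) (σ c : ℝ) : Prop where
  c_nonneg : 0 ≤ c
  measurable : ∀ i, Measurable (ξ i)
  indep : iIndepFun ξ μ
  centered : ∀ i, ∫ ω, ξ i ω ∂μ = 0
  bernstein : ∀ i, BernsteinCond μ (ξ i) σ c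

lemma measurable_noise (hξ : ∀ i, Measurable (ξ i)) : Measurable (noise ξ) :=
  (WithLp.measurable_toLp 2 _).comp (measurable_pi_lambda _ hξ)

lemma measurable_inner_noise (hξ : ∀ i, Measurable (ξ i)) (t : Vec n) :
    Measurable fun ω => inner ℝ t (noise ξ ω) := by
  have h : ∀ ω, inner ℝ t (noise ξ ω) = ∑ i, t i * ξ i ω := fun ω => vec_inner _ _
  simp_rw [h]
  exact Finset.measurable_sum _ fun i _ => (hξ i).const_mul _

namespace IsBernsteinNoise

variable [IsProbabilityMeasure μ] (h : IsBernsteinNoise μ ξ σ c)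
include h

lemma exp_inner (t : Vec n) {β l : ℝ} (hβ : ∀ i, |t i| ≤ β) (hl : |l| * (c * β) < 1) :
    Integrable (fun ω => Real.exp (l * inner ℝ t (noise ξ ω))) μ ∧
      ∫ ω, Real.exp (l * inner ℝ t (noise ξ ω)) ∂μ ≤
        Real.exp (l ^ 2 * (σ ^ 2 * ‖t‖ ^ 2) / (2 * (1 - |l| * (c * β)))) := by
  have hc := h.c_nonneg
  have hX : iIndepFun (fun i ω => t i * ξ i ω) μ :=
    h.indep.comp (fun i x => t i * x) fun i => measurable_const_mul _
  have hm : ∀ i, Measurable fun ω => t i * ξ i ω := fun i => (h.measurable i).const_mul _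
  have hsum : ∀ ω, inner ℝ t (noise ξ ω) = (∑ i, fun ω => t i * ξ i ω) ω := fun ω => by
    rw [vec_inner]
    simp
  have hi : ∀ i, |l * t i| * c ≤ |l| * (c * β) := fun i => by
    rw [abs_mul, mul_assoc, mul_comm (|t i|)]
    exact mul_le_mul_of_nonneg_left (mul_le_mul_of_nonneg_left (hβ i) hc) (abs_nonneg _)
  have hint : ∀ i, Integrable (fun ω => Real.exp (l * (t i * ξ i ω))) μ := fun i => by
    have := (h.bernstein i (l * t i) ((hi i).trans_lt hl)).1
    simpa only [mul_assoc] using this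
  have hbd : ∀ i, ∫ ω, Real.exp (l * (t i * ξ i ω)) ∂μ ≤
      Real.exp (l ^ 2 * (σ ^ 2 * t i ^ 2) / (2 * (1 - |l| * (c * β)))) := fun i => by
    have h1 := (h.bernstein i (l * t i) ((hi i).trans_lt hl)).2
    have h2 : ∫ ω, Real.exp (l * t i * ξ i ω) ∂μ = ∫ ω, Real.exp (l * (t i * ξ i ω)) ∂μ := by
      simp only [mul_assoc]
    rw [h2] at h1
    have hpos : 0 < ∫ ω, Real.exp (l * (t i * ξ i ω)) ∂μ := integral_exp_pos (hint i)
    rw [← Real.log_le_iff_le_exp hpos]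
    refine h1.trans ?_
    rw [show (l * t i) ^ 2 * σ ^ 2 = l ^ 2 * (σ ^ 2 * t i ^ 2) by ring]
    have := hi i
    refine div_le_div_of_nonneg_left (by positivity) (by linarith) (by linarith)
  refine ⟨?_, ?_⟩
  · simp_rw [hsum]
    exact hX.integrable_exp_mul_sum hm fun i _ => hint i
  · have h1 := hX.mgf_sum hm Finset.univ (t := l)
    simp only [mgf] at h1
    simp_rw [hsum]
    rw [h1]
    refine (Finset.prod_le_prod (fun i _ => integral_nonneg fun ω => (Real.exp_pos _).le)
      fun i _ => hbd i).trans_eq ?_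
    rw [← Real.exp_sum, vec_norm_sq, Finset.mul_sum, Finset.mul_sum, Finset.sum_div]

lemma tail_aux (t : Vec n) {β v s : ℝ} (hβ : ∀ i, |t i| ≤ β) (hβ0 : 0 ≤ β)
    (hv : σ ^ 2 * ‖t‖ ^ 2 ≤ v) (hs : 0 ≤ s) :
    μ.real {ω | v * s + c * β * (v * s ^ 2 / 2) ≤ inner ℝ t (noise ξ ω)} ≤
      Real.exp (-(v * s ^ 2 / 2)) := by
  have hc := h.c_nonneg
  -- The Chernoff parameter s / q makes 1 − (s / q) c β equal to 1 / q, and the exponent is then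
  -- exactly −v s² / 2.
  set q := 1 + c * β * s with hq
  have hq0 : 0 < q := by positivity
  have hl0 : 0 ≤ s / q := by positivity
  have h1 : 1 - |s / q| * (c * β) = 1 / q := by
    rw [abs_of_nonneg hl0]
    field_simp
    rw [hq]
    ring
  have hl : |s / q| * (c * β) < 1 := by
    have : 0 < 1 / q := by positivity
    linarith
  obtain ⟨hi, hb⟩ := h.exp_inner t hβ hl
  refine (measure_ge_le_exp_mul_mgf _ hl0 hi).trans ?_
  rw [mgf]
  refine (mul_le_mul_of_nonneg_left hb (Real.exp_pos _).le).trans ?_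
  rw [← Real.exp_add, h1, Real.exp_le_exp]
  have h2 : (s / q) ^ 2 * (σ ^ 2 * ‖t‖ ^ 2) / (2 * (1 / q)) ≤ (s / q) ^ 2 * v / (2 * (1 / q)) := by
    gcongr
  refine (add_le_add_right h2 _).trans_eq ?_
  field_simp
  rw [hq]
  ring

end IsBernsteinNoise

/-- The deviation bound at level `e^{-y}` of a linear functional of the noise attached to a unit
vector whose coordinates are bounded by `lam`. -/
def dev (σ c lam y : ℝ) : ℝ := √(2 * σ ^ 2 * y) + c * lam * y

lemma dev_nonneg {lam y : ℝ} (hc : 0 ≤ c) (hl : 0 ≤ lam) (hy : 0 ≤ y) : 0 ≤ dev σ c lam y := by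
  unfold dev
  positivity

lemma dev_pos {lam y : ℝ} (hσ : 0 < σ) (hc : 0 ≤ c) (hl : 0 ≤ lam) (hy : 0 < y) :
    0 < dev σ c lam y := by
  unfold dev
  positivity

lemma dev_mono {lam y z : ℝ} (hc : 0 ≤ c) (hl : 0 ≤ lam) (hyz : y ≤ z) :
    dev σ c lam y ≤ dev σ c lam z := by
  unfold dev
  gcongr

/-- Sub-linear growth of `dev`. -/
lemma dev_le_mul {lam y r : ℝ} (hr : 1 ≤ r) :
    dev σ c lam (r * y) ≤ r * dev σ c lam y := by
  unfold dev
  rw [mul_add]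
  refine add_le_add ?_ (by ring_nf; rfl)
  rw [show 2 * σ ^ 2 * (r * y) = r * (2 * σ ^ 2 * y) by ring, Real.sqrt_mul (by linarith)]
  refine mul_le_mul_of_nonneg_right ?_ (Real.sqrt_nonneg _)
  rw [Real.sqrt_le_left (by linarith)]
  nlinarith

namespace IsBernsteinNoise

variable [IsProbabilityMeasure μ] (h : IsBernsteinNoise μ ξ σ c)
include h

lemma tail (t : Vec n) {ρ lam y : ℝ} (hσ : 0 < σ) (hρ : 0 < ρ) (ht : ‖t‖ ≤ ρ) (hl : 0 ≤ lam)
    (htl : ∀ i, |t i| ≤ lam * ρ) (hy : 0 ≤ y) :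
    μ.real {ω | ρ * dev σ c lam y ≤ inner ℝ t (noise ξ ω)} ≤ Real.exp (-y) := by
  have hv : σ ^ 2 * ‖t‖ ^ 2 ≤ σ ^ 2 * ρ ^ 2 := by gcongr
  -- With v = σ² ρ², this value of s gives v s² / 2 = y.
  have := h.tail_aux t htl (by positivity) hv (s := √(2 * y) / (σ * ρ)) (by positivity)
  have e1 : σ ^ 2 * ρ ^ 2 * (√(2 * y) / (σ * ρ)) ^ 2 / 2 = y := by
    rw [div_pow, Real.sq_sqrt (by positivity)]
    field_simp
  have e2 : σ ^ 2 * ρ ^ 2 * (√(2 * y) / (σ * ρ)) = ρ * √(2 * σ ^ 2 * y) := by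
    rw [show 2 * σ ^ 2 * y = σ ^ 2 * (2 * y) by ring, Real.sqrt_mul (sq_nonneg σ),
      Real.sqrt_sq hσ.le]
    field_simp
  rw [e1, e2] at this
  rw [dev, mul_add, show ρ * (c * lam * y) = c * (lam * ρ) * y by ring]
  exact this

lemma tail_abs (t : Vec n) {ρ lam y : ℝ} (hσ : 0 < σ) (hρ : 0 < ρ) (ht : ‖t‖ ≤ ρ) (hl : 0 ≤ lam)
    (htl : ∀ i, |t i| ≤ lam * ρ) (hy : 0 ≤ y) :
    μ.real {ω | ρ * dev σ c lam y ≤ |inner ℝ t (noise ξ ω)|} ≤ 2 * Real.exp (-y) := by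
  have h1 := h.tail t hσ hρ ht hl htl hy
  have h2 := h.tail (-t) hσ hρ (by simpa using ht) hl (by simpa using htl) hy
  have hsub : {ω | ρ * dev σ c lam y ≤ |inner ℝ t (noise ξ ω)|} ⊆
      {ω | ρ * dev σ c lam y ≤ inner ℝ t (noise ξ ω)} ∪
        {ω | ρ * dev σ c lam y ≤ inner ℝ (-t) (noise ξ ω)} := by
    intro ω hω
    simp only [Set.mem_ofPred_eq, Set.mem_union, inner_neg_left] at *
    exact le_abs.1 hω
  refine (measureReal_mono hsub).trans ((measureReal_union_le _ _).trans ?_)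
  linarith

lemma integrable_inner_pow (t : Vec n) (k : ℕ) :
    Integrable (fun ω => |inner ℝ t (noise ξ ω)| ^ k) μ := by
  have hc := h.c_nonneg
  set β := ‖t‖
  set r := (1 + c * β)⁻¹
  have hr : 0 < r := by positivity
  have hl : r * (c * β) < 1 := by
    rw [inv_mul_lt_iff₀ (by positivity)]
    linarith
  have h1 := (h.exp_inner t (abs_apply_le_norm t) (l := r) (by rwa [abs_of_pos hr])).1
  have h2 := (h.exp_inner t (abs_apply_le_norm t) (l := -r) (by rwa [abs_neg, abs_of_pos hr])).1
  refine Integrable.mono' ((h1.add h2).const_mul ((k.factorial : ℝ) / r ^ k))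
    ((measurable_inner_noise h.measurable t).abs.pow_const k).aestronglyMeasurable ?_
  refine Filter.Eventually.of_forall fun ω => ?_
  set x := inner ℝ t (noise ξ ω)
  have h3 := Real.pow_div_factorial_le_exp (r * |x|) (by positivity) k
  have h4 : Real.exp (r * |x|) ≤ Real.exp (r * x) + Real.exp (-r * x) := by
    rcases abs_cases x with ⟨hx, _⟩ | ⟨hx, _⟩ <;> rw [hx]
    · linarith [Real.exp_pos (-r * x)]
    · rw [mul_neg, ← neg_mul]
      linarith [Real.exp_pos (r * x)]
  rw [Real.norm_of_nonneg (by positivity)]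
  rw [mul_pow] at h3
  simp only [Pi.add_apply]
  have h5 : r ^ k * |x| ^ k ≤ k.factorial * (Real.exp (r * x) + Real.exp (-r * x)) := by
    rw [div_le_iff₀ (by positivity)] at h3
    calc r ^ k * |x| ^ k ≤ Real.exp (r * |x|) * k.factorial := h3
      _ ≤ _ := by rw [mul_comm]; gcongr
  rw [div_mul_eq_mul_div, le_div_iff₀ (by positivity)]
  linarith

lemma integrable_inner (t : Vec n) : Integrable (fun ω => inner ℝ t (noise ξ ω)) μ := by
  have := h.integrable_inner_pow t 1
  simp only [pow_one] at this
  exact (integrable_norm_iff (measurable_inner_noise h.measurable t).aestronglyMeasurable).1 this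

lemma integral_inner (t : Vec n) : ∫ ω, inner ℝ t (noise ξ ω) ∂μ = 0 := by
  have h1 : ∀ ω, inner ℝ t (noise ξ ω) = ∑ i, t i * ξ i ω := fun ω => vec_inner _ _
  have h2 : ∀ i, Integrable (ξ i) μ := fun i => by
    have := h.integrable_inner (EuclideanSpace.single i 1)
    simpa [vec_inner] using this
  simp_rw [h1]
  rw [integral_finsetSum _ fun i _ => (h2 i).const_mul _]
  simp_rw [integral_const_mul, h.centered]
  simp

/-- From x⁴ / 24 ≤ cosh x − 1 applied at scale 1 / (σ + c lam), where the Bernstein exponent is at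
most 1 / 2. -/
lemma integral_inner_pow_four_le (t : Vec n) {lam : ℝ} (hσ : 0 < σ) (ht : ‖t‖ ≤ 1) (hl : 0 ≤ lam)
    (htl : ∀ i, |t i| ≤ lam) :
    ∫ ω, inner ℝ t (noise ξ ω) ^ 4 ∂μ ≤ 24 * (Real.exp (1 / 2) - 1) * (σ + c * lam) ^ 4 := by
  have hc := h.c_nonneg
  set B := σ + c * lam with hB
  have hB0 : 0 < B := by positivity
  have hlt : B⁻¹ * (c * lam) < 1 := by
    rw [inv_mul_lt_iff₀ hB0]
    linarith
  have h1 := h.exp_inner t htl (l := B⁻¹) (by rwa [abs_of_pos (by positivity)])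
  have h2 := h.exp_inner t htl (l := -B⁻¹) (by rwa [abs_neg, abs_of_pos (by positivity)])
  rw [abs_neg, neg_sq] at h2
  rw [abs_of_pos (by positivity : 0 < B⁻¹)] at h1 h2
  have hbd : Real.exp (B⁻¹ ^ 2 * (σ ^ 2 * ‖t‖ ^ 2) / (2 * (1 - B⁻¹ * (c * lam)))) ≤
      Real.exp (1 / 2) := by
    rw [Real.exp_le_exp]
    have e1 : 1 - B⁻¹ * (c * lam) = σ / B := by
      field_simp
      rw [hB]
      ring
    rw [e1]
    have : ‖t‖ ^ 2 ≤ 1 := pow_le_one₀ (norm_nonneg _) ht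
    have h3 : B⁻¹ ^ 2 * (σ ^ 2 * ‖t‖ ^ 2) ≤ B⁻¹ ^ 2 * (σ ^ 2 * 1) := by gcongr
    refine (div_le_div_of_nonneg_right h3 (by positivity)).trans ?_
    have e2 : B⁻¹ ^ 2 * (σ ^ 2 * 1) / (2 * (σ / B)) = (σ / B) / 2 := by
      field_simp
    rw [e2]
    have : σ / B ≤ 1 := by
      rw [div_le_one hB0]
      have : 0 ≤ c * lam := by positivity
      linarith
    linarith
  have hpt : ∀ ω, inner ℝ t (noise ξ ω) ^ 4 ≤ 24 * B ^ 4 *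
      ((Real.exp (B⁻¹ * inner ℝ t (noise ξ ω)) + Real.exp (-B⁻¹ * inner ℝ t (noise ξ ω))) / 2
        - 1) := by
    intro ω
    set x := inner ℝ t (noise ξ ω)
    have h3 := sum_le_hasSum {0, 2} (fun i _ => by rw [pow_mul]; positivity) (Real.hasSum_cosh (B⁻¹ * x))
    simp [Real.cosh_eq, Nat.factorial] at h3
    rw [neg_mul]
    have e : x ^ 4 = 24 * B ^ 4 * ((B⁻¹ * x) ^ 4 / 24) := by
      field_simp
    rw [e]
    gcongr
    linarith
  have hint4 : Integrable (fun ω => inner ℝ t (noise ξ ω) ^ 4) μ := by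
    have := h.integrable_inner_pow t 4
    simpa only [Even.pow_abs (by decide : Even 4)] using this
  refine (integral_mono hint4 ?_ hpt).trans ?_
  · exact (((h1.1.add h2.1).div_const 2).sub (integrable_const 1)).const_mul _
  · have e3 : ∫ ω, ((Real.exp (B⁻¹ * inner ℝ t (noise ξ ω)) +
        Real.exp (-B⁻¹ * inner ℝ t (noise ξ ω))) / 2 - 1) ∂μ =
        (∫ ω, Real.exp (B⁻¹ * inner ℝ t (noise ξ ω)) ∂μ +
          ∫ ω, Real.exp (-B⁻¹ * inner ℝ t (noise ξ ω)) ∂μ) / 2 - 1 := by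
      rw [← integral_add h1.1 h2.1, ← integral_div, integral_sub _ (integrable_const 1)]
      · simp
      · exact (h1.1.add h2.1).div_const 2
    rw [integral_const_mul, e3]
    have h3 := h1.2.trans hbd
    have h4 := h2.2.trans hbd
    have h5 : 0 ≤ 24 * B ^ 4 := by positivity
    calc _ ≤ 24 * B ^ 4 * (Real.exp (1 / 2) - 1) := by
          gcongr
          linarith
      _ = _ := by ring

end IsBernsteinNoise

/-- From an exponential tail bound to a bound on the expectation. -/
lemma integral_le_of_exp_tail [IsProbabilityMeasure μ] {f : Ω → ℝ} (hf : Measurable f) (hf0 : ∀ ω, 0 ≤ f ω) {A r : ℝ}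
    (hr : 0 < r)
    (h : ∀ x : ℝ, 0 < x → μ.real {ω | x < f ω} ≤ A * Real.exp (-r * x)) :
    Integrable f μ ∧ ∫ ω, f ω ∂μ ≤ A / r := by
  have hA : 0 ≤ A := by
    have := (measureReal_nonneg.trans (h 1 one_pos))
    exact nonneg_of_mul_nonneg_left this (Real.exp_pos _)
  have hint : IntegrableOn (fun x => A * Real.exp (-r * x)) (Set.Ioi 0) :=
    (exp_neg_integrableOn_Ioi 0 hr).const_mul A
  have hval : ∫ x in Set.Ioi (0 : ℝ), A * Real.exp (-r * x) = A / r := by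
    rw [integral_const_mul, integral_exp_mul_Ioi (by linarith : -r < 0)]
    simp
    field_simp
  have hl : ∫⁻ ω, ENNReal.ofReal (f ω) ∂μ ≤ ENNReal.ofReal (A / r) := by
    rw [lintegral_eq_lintegral_meas_lt μ (Filter.Eventually.of_forall hf0) hf.aemeasurable,
      ← hval, ofReal_integral_eq_lintegral_ofReal hint
        (Filter.Eventually.of_forall fun x => by positivity)]
    refine setLIntegral_mono' measurableSet_Ioi fun x hx => ?_
    rw [← ofReal_measureReal]
    exact ENNReal.ofReal_le_ofReal (h x hx)
  have hi : Integrable f μ := by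
    refine ⟨hf.aestronglyMeasurable, ?_⟩
    rw [hasFiniteIntegral_iff_ofReal (Filter.Eventually.of_forall hf0)]
    exact hl.trans_lt ENNReal.ofReal_lt_top
  refine ⟨hi, ?_⟩
  rw [← ofReal_integral_eq_lintegral_ofReal hi (Filter.Eventually.of_forall hf0)] at hl
  exact (ENNReal.ofReal_le_ofReal_iff (by positivity)).1 hl

end

noncomputable section

variable {n d : ℕ}

/-! ### Residuals of local polynomial fits -/

section Hilbert

variable {E : Type*} [NormedAddCommGroup E] [InnerProductSpace ℝ E] [FiniteDimensional ℝ E]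

lemma starProjection_starProjection_of_le {U V : Submodule ℝ E} (h : U ≤ V) (x : E) :
    U.starProjection (V.starProjection x) = U.starProjection x := by
  have := Submodule.starProjection_comp_starProjection_of_le h
  exact congrArg (fun f : E →L[ℝ] E => f x) this

lemma inner_starProjection_self (U : Submodule ℝ E) (x : E) :
    inner ℝ x (U.starProjection x) = ‖U.starProjection x‖ ^ 2 := by
  rw [← real_inner_self_eq_norm_sq, Submodule.inner_starProjection_left_eq_right,
    Submodule.starProjection_eq_self_iff.2 (Submodule.starProjection_apply_mem U x)]

lemma inner_starProjection_of_le {U V : Submodule ℝ E} (h : U ≤ V) (x : E) :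
    inner ℝ (V.starProjection x) (U.starProjection x) = ‖U.starProjection x‖ ^ 2 := by
  rw [Submodule.inner_starProjection_left_eq_right,
    Submodule.starProjection_eq_self_iff.2 (h (Submodule.starProjection_apply_mem U x)),
    inner_starProjection_self]

lemma norm_sq_starProjection_sub {U V : Submodule ℝ E} (h : U ≤ V) (x : E) :
    ‖V.starProjection x - U.starProjection x‖ ^ 2 =
      ‖V.starProjection x‖ ^ 2 - ‖U.starProjection x‖ ^ 2 := by
  rw [norm_sub_sq_real, inner_starProjection_of_le h]
  ring

lemma norm_starProjection_mono {U V : Submodule ℝ E} (h : U ≤ V) (x : E) :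
    ‖U.starProjection x‖ ≤ ‖V.starProjection x‖ := by
  rw [← starProjection_starProjection_of_le h]
  exact Submodule.norm_starProjection_apply_le _ _

lemma norm_sq_starProjection_sub_sub {U U' V : Submodule ℝ E} (h : U ≤ V) (h' : U' ≤ V)
    (ho : U ⟂ U') (x : E) :
    ‖V.starProjection x - U.starProjection x - U'.starProjection x‖ ^ 2 =
      ‖V.starProjection x‖ ^ 2 - ‖U.starProjection x‖ ^ 2 - ‖U'.starProjection x‖ ^ 2 := by
  rw [norm_sub_sq_real, norm_sq_starProjection_sub h, inner_sub_left,
    inner_starProjection_of_le h',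
    Submodule.isOrtho_iff_inner_eq.1 ho _ (Submodule.starProjection_apply_mem _ _) _
      (Submodule.starProjection_apply_mem _ _)]
  ring

end Hilbert

/-- Vectors supported by `I` and orthogonal to polynomials on `I`. -/
def resSp (d : ℕ) (I : Finset (Fin n)) : Submodule ℝ (Vec n) :=
  LinearMap.ker (restr Iᶜ) ⊓ (locPoly d I)ᗮ

lemma restr_compl_eq_zero_iff {I : Finset (Fin n)} {v : Vec n} :
    restr Iᶜ v = 0 ↔ restr I v = v := by
  constructor
  · intro h
    ext i
    by_cases hi : i ∈ I
    · simp [hi]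
    · have := congrArg (fun v : Vec n => v i) h
      simp only [restr_apply, Finset.mem_compl, hi, not_false_eq_true, if_true] at this
      simp [hi, this]
  · intro h
    rw [← h, restr_restr, Finset.inter_comm, Finset.inter_compl, restr_empty]

lemma mem_resSp {I : Finset (Fin n)} {v : Vec n} :
    v ∈ resSp d I ↔ restr I v = v ∧ ∀ w ∈ locPoly d I, inner ℝ w v = 0 := by
  rw [resSp, Submodule.mem_inf, LinearMap.mem_ker, restr_compl_eq_zero_iff,
    Submodule.mem_orthogonal]

/-- A polynomial on J restricts to a polynomial on I, so orthogonality to the latter suffices.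
Residuals on nested intervals are thus nested projections, and the squared distance between them is
the difference of their squared norms. -/
lemma resSp_mono {I J : Finset (Fin n)} (h : I ⊆ J) : resSp d I ≤ resSp d J := by
  intro v hv
  rw [mem_resSp] at *
  obtain ⟨h1, h2⟩ := hv
  refine ⟨by rw [← h1, restr_restr_of_subset' h], fun w hw => ?_⟩
  rw [← h1, ← inner_restr]
  exact h2 _ (restr_mem_locPoly h hw)

lemma resSp_isOrtho {I J : Finset (Fin n)} (h : Disjoint I J) : resSp d I ⟂ resSp d J := by
  rw [Submodule.isOrtho_iff_inner_eq]
  intro u hu v hv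
  rw [← (mem_resSp.1 hu).1, ← (mem_resSp.1 hv).1, inner_restr_disjoint h]

/-- The residual of the polynomial fit of `v` on `I`. -/
def res (d : ℕ) (I : Finset (Fin n)) (v : Vec n) : Vec n := (resSp d I).starProjection v

lemma restr_locProj (I : Finset (Fin n)) (v : Vec n) :
    restr I ((locPoly d I).starProjection v) = (locPoly d I).starProjection v :=
  restr_of_mem_locPoly subset_rfl (Submodule.starProjection_apply_mem _ _)

lemma locProj_restr {I J : Finset (Fin n)} (h : I ⊆ J) (v : Vec n) :
    (locPoly d I).starProjection (restr J v) = (locPoly d I).starProjection v := by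
  apply Submodule.eq_starProjection_of_mem_of_inner_eq_zero
    (Submodule.starProjection_apply_mem _ _)
  intro w hw
  rw [inner_sub_left, inner_restr, restr_of_mem_locPoly h hw, ← inner_sub_left]
  exact Submodule.starProjection_inner_eq_zero _ _ hw

lemma res_eq (I : Finset (Fin n)) (v : Vec n) :
    res d I v = restr I v - (locPoly d I).starProjection v := by
  apply Submodule.eq_starProjection_of_mem_of_inner_eq_zero
  · rw [mem_resSp]
    refine ⟨?_, fun w hw => ?_⟩
    · rw [map_sub, restr_restr, Finset.inter_self, restr_locProj]
    · rw [real_inner_comm, ← locProj_restr subset_rfl]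
      exact Submodule.starProjection_inner_eq_zero _ _ hw
  · intro w hw
    obtain ⟨h1, h2⟩ := mem_resSp.1 hw
    rw [sub_sub_eq_add_sub, add_comm, inner_sub_left, inner_add_left,
      h2 _ (Submodule.starProjection_apply_mem _ _), inner_restr, h1]
    ring

lemma res_add (I : Finset (Fin n)) (u v : Vec n) : res d I (u + v) = res d I u + res d I v :=
  map_add _ _ _

lemma res_sub (I : Finset (Fin n)) (u v : Vec n) : res d I (u - v) = res d I u - res d I v :=
  map_sub _ _ _

lemma res_mem (I : Finset (Fin n)) (v : Vec n) : res d I v ∈ resSp d I :=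
  Submodule.starProjection_apply_mem _ _

lemma res_restr {I J : Finset (Fin n)} (h : I ⊆ J) (v : Vec n) :
    res d I (restr J v) = res d I v := by
  rw [res_eq, res_eq, locProj_restr h, restr_restr_of_subset h]

lemma res_of_disjoint {I J : Finset (Fin n)} (h : Disjoint I J) (v : Vec n) :
    res d I (restr J v) = 0 := by
  have h0 : restr I (restr J v) = 0 := by
    rw [restr_restr, Finset.disjoint_iff_inter_eq_empty.1 h, restr_empty]
  rw [← res_restr subset_rfl, h0]
  exact map_zero _

lemma res_polyVec {I J : Finset (Fin n)} (h : I ⊆ J) {p : ℝ[X]} (hp : p.natDegree ≤ d) :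
    res d I (restr J (polyVec n p)) = 0 := by
  rw [res_restr h, res_eq, ← locProj_restr subset_rfl,
    Submodule.starProjection_eq_self_iff.2 (restr_polyVec_mem I hp), sub_self]

lemma res_res {I J : Finset (Fin n)} (h : I ⊆ J) (v : Vec n) :
    res d I (res d J v) = res d I v :=
  starProjection_starProjection_of_le (resSp_mono h) v

lemma norm_res_le (I : Finset (Fin n)) (v : Vec n) : ‖res d I v‖ ≤ ‖v‖ :=
  Submodule.norm_starProjection_apply_le _ _

lemma norm_sq_res_sub {I J : Finset (Fin n)} (h : I ⊆ J) (v : Vec n) :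
    ‖res d J v - res d I v‖ ^ 2 = ‖res d J v‖ ^ 2 - ‖res d I v‖ ^ 2 :=
  norm_sq_starProjection_sub (resSp_mono h) v

lemma norm_res_mono {I J : Finset (Fin n)} (h : I ⊆ J) (v : Vec n) :
    ‖res d I v‖ ≤ ‖res d J v‖ := norm_starProjection_mono (resSp_mono h) v

/-- The residual of the best fit is smaller than that of any polynomial. -/
lemma norm_res_le_of_sub {I : Finset (Fin n)} (v : Vec n) {p : ℝ[X]} (hp : p.natDegree ≤ d) :
    ‖res d I v‖ ≤ ‖restr I v - restr I (polyVec n p)‖ := by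
  have : res d I v = res d I (restr I v - restr I (polyVec n p)) := by
    rw [res_sub, res_polyVec subset_rfl hp, sub_zero, res_restr subset_rfl]
  rw [this]
  exact norm_res_le _ _

lemma norm_sq_add_of_disjoint {I J : Finset (Fin n)} (h : Disjoint I J) (u v : Vec n) :
    ‖restr I u + restr J v‖ ^ 2 = ‖restr I u‖ ^ 2 + ‖restr J v‖ ^ 2 := by
  rw [norm_add_sq_real, inner_restr_disjoint h]
  ring

lemma restr_union_of_disjoint {I J : Finset (Fin n)} (h : Disjoint I J) (v : Vec n) :
    restr (I ∪ J) v = restr I v + restr J v := by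
  ext i
  by_cases hi : i ∈ I
  · have hj : i ∉ J := Finset.disjoint_left.1 h hi
    simp [hi, hj]
  · simp [hi]

/-- Stability of the residual when an interval is enlarged on one side. -/
lemma norm_res_union_sub_le {A A' B : Finset (Fin n)} (hA : A ⊆ A') (hB : Disjoint A' B)
    (φ : Vec n) {τ h : ℝ} (hτ : 0 ≤ τ)
    (h1 : ‖res d A' φ‖ ^ 2 - ‖res d A φ‖ ^ 2 ≤ τ * h) (h2 : ‖res d (A ∪ B) φ‖ ^ 2 ≤ h)
    (hcmp : ∀ r : ℝ[X], r.natDegree ≤ d → ‖res d (A' ∪ B) (restr A' (polyVec n r))‖ ^ 2 ≤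
      (1 + τ) * ‖res d (A ∪ B) (restr A' (polyVec n r))‖ ^ 2) :
    ‖res d (A' ∪ B) φ - res d (A ∪ B) φ‖ ≤ √τ * (2 + √τ) * √h := by
  have hAB : Disjoint A B := Finset.disjoint_of_subset_left hA hB
  have hAI : A ⊆ A ∪ B := Finset.subset_union_left
  have hBI : B ⊆ A ∪ B := Finset.subset_union_right
  have hAJ : A' ⊆ A' ∪ B := Finset.subset_union_left
  have hBJ : B ⊆ A' ∪ B := Finset.subset_union_right
  have hIJ : A ∪ B ⊆ A' ∪ B := Finset.union_subset_union_left hA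
  -- On A' ∪ B, φ is the sum of ε, made of the two local residuals, and of ψ, which is polynomial on
  -- A' and on B separately. The two contributions to the increment of the residual are bounded
  -- separately.
  obtain ⟨p, hp, hpe⟩ := mem_locPoly.1 (Submodule.starProjection_apply_mem (locPoly d A') φ)
  obtain ⟨q, hq, hqe⟩ := mem_locPoly.1 (Submodule.starProjection_apply_mem (locPoly d B) φ)
  set ψ := restr A' (polyVec n p) + restr B (polyVec n q) with hψ
  set ε := res d A' φ + res d B φ with hε
  have hφ : restr (A' ∪ B) φ = ε + ψ := by
    rw [restr_union_of_disjoint hB, hε, hψ, res_eq, res_eq, hpe, hqe]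
    abel
  have hJ : res d (A' ∪ B) φ = res d (A' ∪ B) ε + res d (A' ∪ B) ψ := by
    rw [← res_add, ← hφ, res_restr subset_rfl]
  have hI : res d (A ∪ B) φ = res d (A ∪ B) ε + res d (A ∪ B) ψ := by
    rw [← res_add, ← hφ, res_restr hIJ]
  have hJε : res d (A' ∪ B) ε = ε :=
    Submodule.starProjection_eq_self_iff.2 (Submodule.add_mem _
      (resSp_mono hAJ (res_mem _ _)) (resSp_mono hBJ (res_mem _ _)))
  have hrA : restr A' (res d A' φ) = res d A' φ := (mem_resSp.1 (res_mem A' φ)).1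
  have hrB : restr B (res d B φ) = res d B φ := (mem_resSp.1 (res_mem B φ)).1
  have hAε : res d A ε = res d A φ := by
    rw [hε, res_add, res_res hA, ← hrB, res_of_disjoint hAB, add_zero]
  have hBε : res d B ε = res d B φ := by
    rw [hε, res_add, res_res subset_rfl, ← hrA, res_of_disjoint hB.symm, zero_add]
  have hnε : ‖ε‖ ^ 2 = ‖res d A' φ‖ ^ 2 + ‖res d B φ‖ ^ 2 := by
    rw [hε, ← hrA, ← hrB, norm_sq_add_of_disjoint hB]
  have hsub := norm_sq_starProjection_sub_sub (resSp_mono (d := d) hAI) (resSp_mono hBI)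
    (resSp_isOrtho hAB) ε
  change ‖res d (A ∪ B) ε - res d A ε - res d B ε‖ ^ 2 =
    ‖res d (A ∪ B) ε‖ ^ 2 - ‖res d A ε‖ ^ 2 - ‖res d B ε‖ ^ 2 at hsub
  rw [hAε, hBε] at hsub
  have hIε : ‖res d (A ∪ B) ε‖ ^ 2 ≤ ‖ε‖ ^ 2 :=
    pow_le_pow_left₀ (norm_nonneg _) (norm_res_le _ _) 2
  -- ε is its own residual on A' ∪ B, and its residual on A ∪ B contains those on A and on B. What
  -- is lost is at most the part lost in passing from A' to A.
  have hε1 : ‖res d (A' ∪ B) ε - res d (A ∪ B) ε‖ ≤ √(τ * h) := by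
    apply Real.le_sqrt_of_sq_le
    rw [norm_sq_res_sub hIJ, hJε, hnε]
    nlinarith [sq_nonneg ‖res d (A ∪ B) ε - res d A φ - res d B φ‖]
  have hε2 : ‖res d (A ∪ B) ε - res d A φ - res d B φ‖ ≤ √(τ * h) := by
    apply Real.le_sqrt_of_sq_le
    rw [hsub]
    linarith
  -- u is orthogonal to the residuals of φ on A and on B, as ψ is polynomial on each piece. Hence
  -- ‖u‖² differs from ⟨u, res φ⟩ only by the small term of `hε2`.
  set u := res d (A ∪ B) ψ with hu
  have huA : inner ℝ u (res d A φ) = 0 := by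
    rw [res, ← Submodule.inner_starProjection_left_eq_right]
    change inner ℝ (res d A u) φ = 0
    rw [hu, res_res hAI, hψ, res_add, res_polyVec hA hp, res_of_disjoint hAB, add_zero,
      inner_zero_left]
  have huB : inner ℝ u (res d B φ) = 0 := by
    rw [res, ← Submodule.inner_starProjection_left_eq_right]
    change inner ℝ (res d B u) φ = 0
    rw [hu, res_res hBI, hψ, res_add, res_polyVec subset_rfl hq, res_of_disjoint hB.symm, add_zero,
      inner_zero_left]
  have hun : ‖u‖ ≤ (1 + √τ) * √h := by
    have e1 : ‖u‖ ^ 2 = inner ℝ u (res d (A ∪ B) φ) -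
        inner ℝ u (res d (A ∪ B) ε - res d A φ - res d B φ) := by
      rw [inner_sub_right, inner_sub_right, huA, huB, hI, inner_add_right,
        real_inner_self_eq_norm_sq]
      ring
    have e2 := real_inner_le_norm u (res d (A ∪ B) φ)
    have e3 := neg_le_of_abs_le
      (abs_real_inner_le_norm u (res d (A ∪ B) ε - res d A φ - res d B φ))
    have e4 : ‖res d (A ∪ B) φ‖ ≤ √h := Real.le_sqrt_of_sq_le h2
    have e5 : ‖u‖ ^ 2 ≤ ‖u‖ * (√h + √(τ * h)) := by
      nlinarith [norm_nonneg u, mul_le_mul_of_nonneg_left e4 (norm_nonneg u),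
        mul_le_mul_of_nonneg_left hε2 (norm_nonneg u)]
    rw [Real.sqrt_mul hτ] at e5
    rcases (norm_nonneg u).eq_or_lt with h0 | h0
    · rw [← h0]
      positivity
    · nlinarith
  -- Subtracting the global polynomial q, which has no residual, leaves p − q on A' and zero on B:
  -- the case covered by `hcmp`.
  have hψ' : ∀ K : Finset (Fin n), K ⊆ A' ∪ B →
      res d K ψ = res d K (restr A' (polyVec n (p - q))) := by
    intro K hK
    have : ψ = restr A' (polyVec n (p - q)) + restr (A' ∪ B) (polyVec n q) := by
      rw [hψ, restr_union_of_disjoint hB, map_sub, map_sub]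
      abel
    rw [this, res_add, res_polyVec hK hq, add_zero]
  have hpq : (p - q).natDegree ≤ d := (natDegree_sub_le _ _).trans (max_le hp hq)
  have hψ1 : ‖res d (A' ∪ B) ψ - res d (A ∪ B) ψ‖ ≤ √τ * ((1 + √τ) * √h) := by
    have := hcmp _ hpq
    rw [← hψ' _ subset_rfl, ← hψ' _ hIJ] at this
    refine le_of_sq_le_sq ?_ (by positivity)
    rw [norm_sq_res_sub hIJ, mul_pow, Real.sq_sqrt hτ]
    have h3 : ‖res d (A ∪ B) ψ‖ ^ 2 ≤ ((1 + √τ) * √h) ^ 2 :=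
      pow_le_pow_left₀ (norm_nonneg _) hun 2
    have h4 := mul_le_mul_of_nonneg_left h3 hτ
    linarith
  rw [hJ, hI, show res d (A' ∪ B) ε + res d (A' ∪ B) ψ - (res d (A ∪ B) ε + res d (A ∪ B) ψ) =
    (res d (A' ∪ B) ε - res d (A ∪ B) ε) + (res d (A' ∪ B) ψ - res d (A ∪ B) ψ) by abel]
  refine (norm_add_le _ _).trans ((add_le_add hε1 hψ1).trans_eq ?_)
  rw [Real.sqrt_mul hτ]
  ring

/-- Comparison of residuals when the added piece is relatively small. -/
lemma norm_sq_res_le_of_card_le {A A' B : Finset (Fin n)} (hA : A ⊆ A') (hB : Disjoint A' B)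
    (hc : (A' : Set (Fin n)).OrdConnected) {τ : ℝ} (hτ : 0 ≤ τ) (hτ1 : τ ≤ 1)
    (hcard : (A'.card : ℝ) ≤ (1 + τ / (2 * ((d : ℝ) + 1) ^ 2)) * A.card) {r : ℝ[X]}
    (hr : r.natDegree ≤ d) :
    ‖res d (A' ∪ B) (restr A' (polyVec n r))‖ ^ 2 ≤
      (1 + τ) * ‖res d (A ∪ B) (restr A' (polyVec n r))‖ ^ 2 := by
  have hAB : Disjoint A B := Finset.disjoint_of_subset_left hA hB
  have hIJ : A ∪ B ⊆ A' ∪ B := Finset.union_subset_union_left hA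
  set x := restr A' (polyVec n r) with hx
  -- The best fit s on A ∪ B serves as competitor on A' ∪ B. Only the energy of r − s on A' beyond A
  -- is added, and leverage makes it a small fraction of the energy on A'.
  obtain ⟨s, hs, hse⟩ := mem_locPoly.1
    (Submodule.starProjection_apply_mem (locPoly d (A ∪ B)) x)
  have hrs : (r - s).natDegree ≤ d := (natDegree_sub_le _ _).trans (max_le hr hs)
  have key : ∀ C : Finset (Fin n), C ⊆ A' → Disjoint C B →
      ‖restr (C ∪ B) x - restr (C ∪ B) (polyVec n s)‖ ^ 2 =
        ‖restr C (polyVec n (r - s))‖ ^ 2 + ‖restr B (polyVec n s)‖ ^ 2 := by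
    intro C hC hCB
    have : restr (C ∪ B) x - restr (C ∪ B) (polyVec n s) =
        restr C (polyVec n (r - s)) + restr B (-(polyVec n s)) := by
      rw [restr_union_of_disjoint hCB, restr_union_of_disjoint hCB, hx, restr_restr_of_subset hC,
        restr_restr, Finset.disjoint_iff_inter_eq_empty.1 hB.symm, restr_empty, map_sub, map_sub,
        map_neg]
      abel
    rw [this, norm_sq_add_of_disjoint hCB, map_neg, norm_neg]
  have e1 : ‖res d (A ∪ B) x‖ ^ 2 = ‖restr A (polyVec n (r - s))‖ ^ 2 +
      ‖restr B (polyVec n s)‖ ^ 2 := by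
    rw [res_eq, hse, key A hA hAB]
  have e2 : ‖res d (A' ∪ B) x‖ ^ 2 ≤ ‖restr A' (polyVec n (r - s))‖ ^ 2 +
      ‖restr B (polyVec n s)‖ ^ 2 := by
    rw [← key A' subset_rfl hB]
    exact pow_le_pow_left₀ (norm_nonneg _) (norm_res_le_of_sub x hs) 2
  have e3 : ‖restr A' (polyVec n (r - s))‖ ^ 2 ≤
      (1 + τ) * ‖restr A (polyVec n (r - s))‖ ^ 2 := by
    set w := polyVec n (r - s) with hw
    have f1 : ‖restr A' w‖ ^ 2 = ‖restr A w‖ ^ 2 + ‖restr (A' \ A) w‖ ^ 2 := by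
      rw [← norm_sq_add_of_disjoint Finset.disjoint_sdiff,
        ← restr_union_of_disjoint Finset.disjoint_sdiff, Finset.union_sdiff_of_subset hA]
    have f2 := locPoly_restr_le (J := A' \ A) hc (restr_polyVec_mem A' hrs)
    rw [restr_restr_of_subset Finset.sdiff_subset, ← hw, Finset.cast_card_sdiff hA] at f2
    have hD : (0 : ℝ) < ((d : ℝ) + 1) ^ 2 := by positivity
    have hle : (A.card : ℝ) ≤ A'.card := by exact_mod_cast Finset.card_le_card hA
    have f3 : ((d : ℝ) + 1) ^ 2 * ((A'.card : ℝ) - A.card) ≤ τ / 2 * A'.card := by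
      have : (A'.card : ℝ) - A.card ≤ τ / (2 * ((d : ℝ) + 1) ^ 2) * A'.card := by
        have : τ / (2 * ((d : ℝ) + 1) ^ 2) * A.card ≤ τ / (2 * ((d : ℝ) + 1) ^ 2) * A'.card := by
          gcongr
        linarith
      calc ((d : ℝ) + 1) ^ 2 * ((A'.card : ℝ) - A.card) ≤
          ((d : ℝ) + 1) ^ 2 * (τ / (2 * ((d : ℝ) + 1) ^ 2) * A'.card) := by gcongr
        _ = τ / 2 * A'.card := by field_simp
    have f4 : (A'.card : ℝ) * ‖restr (A' \ A) w‖ ^ 2 ≤ A'.card * (τ / 2 * ‖restr A' w‖ ^ 2) := by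
      refine f2.trans ?_
      calc _ ≤ τ / 2 * A'.card * ‖restr A' w‖ ^ 2 := by gcongr
        _ = _ := by ring
    rcases A'.eq_empty_or_nonempty with h0 | h0
    · rw [h0, restr_empty]
      simp only [norm_zero, ne_eq, OfNat.ofNat_ne_zero, not_false_eq_true, zero_pow]
      positivity
    · have hpos : (0 : ℝ) < A'.card := by exact_mod_cast Finset.card_pos.2 h0
      have f5 := le_of_mul_le_mul_left f4 hpos
      nlinarith [sq_nonneg ‖restr A' w‖, sq_nonneg ‖restr A w‖]
  rw [e1]
  nlinarith [sq_nonneg ‖restr B (polyVec n s)‖]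

/-- Comparison of residuals when the common piece is relatively small. -/
lemma norm_sq_res_le_of_small {A A' B : Finset (Fin n)} (hA : A ⊆ A') (hB : Disjoint A' B)
    (hc : ((A ∪ B : Finset (Fin n)) : Set (Fin n)).OrdConnected) {τ : ℝ} (hτ : 0 ≤ τ) (hτ1 : τ ≤ 1)
    (hcard : 2 * ((d : ℝ) + 1) ^ 2 * B.card ≤ τ * A.card) {r : ℝ[X]}
    (hr : r.natDegree ≤ d) :
    ‖res d (A' ∪ B) (restr A' (polyVec n r))‖ ^ 2 ≤
      (1 + τ) * ‖res d (A ∪ B) (restr A' (polyVec n r))‖ ^ 2 := by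
  have hAB : Disjoint A B := Finset.disjoint_of_subset_left hA hB
  have hIJ : A ∪ B ⊆ A' ∪ B := Finset.union_subset_union_left hA
  -- Modulo the global polynomial r, the vector equal to r on A' is −r on B. As B is tiny compared
  -- with A, polynomials on A ∪ B hardly correlate with it, and its residual keeps almost all of its
  -- norm.
  set y := restr B (polyVec n r) with hy
  have key : ∀ K : Finset (Fin n), K ⊆ A' ∪ B →
      ‖res d K (restr A' (polyVec n r))‖ = ‖res d K y‖ := by
    intro K hK
    have : restr A' (polyVec n r) = restr (A' ∪ B) (polyVec n r) - y := by
      rw [restr_union_of_disjoint hB, hy]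
      abel
    rw [this, res_sub, res_polyVec hK hr, zero_sub, norm_neg]
  rw [key _ subset_rfl, key _ hIJ]
  have e1 : ‖res d (A' ∪ B) y‖ ^ 2 ≤ ‖y‖ ^ 2 :=
    pow_le_pow_left₀ (norm_nonneg _) (norm_res_le _ _) 2
  set π := (locPoly d (A ∪ B)).starProjection y with hπ
  have hyI : restr (A ∪ B) y = y := by
    rw [hy, restr_restr_of_subset' Finset.subset_union_right]
  have e2 : ‖res d (A ∪ B) y‖ ^ 2 = ‖y‖ ^ 2 - ‖π‖ ^ 2 := by
    rw [res_eq, hyI, norm_sub_sq_real, ← hπ, hπ, inner_starProjection_self]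
    ring
  have e3 : ‖π‖ ^ 2 ≤ ‖y‖ * ‖restr B π‖ := by
    rw [hπ, ← inner_starProjection_self, ← hπ]
    have : inner ℝ y π = inner ℝ y (restr B π) := by
      rw [← inner_restr, hy, restr_restr, Finset.inter_self]
    rw [this]
    exact real_inner_le_norm _ _
  have e4 : ‖restr B π‖ ^ 2 ≤ τ / 2 * ‖π‖ ^ 2 := by
    have f1 := locPoly_restr_le (J := B) hc
      (Submodule.starProjection_apply_mem (locPoly d (A ∪ B)) y)
    rw [← hπ, Finset.card_union_of_disjoint hAB] at f1
    push_cast at f1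
    rcases B.eq_empty_or_nonempty with h0 | h0
    · rw [h0, restr_empty]
      simp only [norm_zero, ne_eq, OfNat.ofNat_ne_zero, not_false_eq_true, zero_pow]
      positivity
    · have hpos : (0 : ℝ) < B.card := by exact_mod_cast Finset.card_pos.2 h0
      have hpos' : (0 : ℝ) ≤ A.card := by positivity
      refine le_of_mul_le_mul_left ?_ (by linarith : (0 : ℝ) < (A.card : ℝ) + B.card)
      refine f1.trans ?_
      have : ((d : ℝ) + 1) ^ 2 * B.card ≤ (A.card + B.card) * (τ / 2) := by
        nlinarith [mul_nonneg hτ hpos.le]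
      nlinarith [sq_nonneg ‖π‖]
  have e5 : ‖π‖ ^ 2 ≤ τ / 2 * ‖y‖ ^ 2 := by
    have f1 : (‖π‖ ^ 2) ^ 2 ≤ ‖y‖ ^ 2 * (τ / 2 * ‖π‖ ^ 2) := by
      calc (‖π‖ ^ 2) ^ 2 ≤ (‖y‖ * ‖restr B π‖) ^ 2 := pow_le_pow_left₀ (by positivity) e3 2
        _ = ‖y‖ ^ 2 * ‖restr B π‖ ^ 2 := by ring
        _ ≤ _ := by gcongr
    rcases (sq_nonneg ‖π‖).eq_or_lt with h0 | h0
    · rw [← h0]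
      positivity
    · refine le_of_mul_le_mul_left ?_ h0
      linarith
  rw [e2]
  nlinarith [sq_nonneg ‖y‖, mul_nonneg hτ (sq_nonneg ‖y‖)]

end

noncomputable section

variable {n d : ℕ}

/-! ### Covering of the residuals attached to the intervals containing a given gap -/

/-- The interval of the `s` indices on the left and the `t` indices on the right of the gap `y`. -/
def gapBlk (n y : ℕ) (st : ℕ × ℕ) : Finset (Fin n) := blk n (y - st.1) y ∪ blk n y (y + st.2)

lemma gapBlk_eq {y : ℕ} (st : ℕ × ℕ) : gapBlk n y st = blk n (y - st.1) (y + st.2) := by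
  ext i
  simp only [gapBlk, Finset.mem_union, mem_blk]
  omega

lemma disjoint_blk_gap (l y r : ℕ) : Disjoint (blk n l y) (blk n y r) := by
  rw [Finset.disjoint_left]
  intro i h1 h2
  rw [mem_blk] at h1 h2
  omega

lemma blk_subset {l r l' r' : ℕ} (h : l' ≤ l) (h' : r ≤ r') : blk n l r ⊆ blk n l' r' := by
  intro i hi
  rw [mem_blk] at *
  omega

/-- Crossing intervals are compared through J containing both: if their residuals have close norms,
their squared distances to the residual on J are close by Pythagoras. -/
lemma norm_res_sub_le_of_join {I I' J : Finset (Fin n)} (hI : I ⊆ J) (hI' : I' ⊆ J) (φ : Vec n)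
    {τ h e : ℝ} (hτ : 0 ≤ τ) (hh : 0 ≤ h)
    (h1 : |‖res d I φ‖ ^ 2 - ‖res d I' φ‖ ^ 2| ≤ τ * h)
    (h2 : ‖res d J φ - res d I φ‖ ≤ e * √h) :
    ‖res d I φ - res d I' φ‖ ≤ (e + √(e ^ 2 + τ)) * √h := by
  have h3 : ‖res d J φ - res d I' φ‖ ≤ √(e ^ 2 + τ) * √h := by
    rw [← Real.sqrt_mul (by positivity)]
    apply Real.le_sqrt_of_sq_le
    have h4 := pow_le_pow_left₀ (norm_nonneg _) h2 2
    rw [mul_pow, Real.sq_sqrt hh, norm_sq_res_sub hI] at h4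
    rw [norm_sq_res_sub hI']
    linarith [le_abs_self (‖res d I φ‖ ^ 2 - ‖res d I' φ‖ ^ 2)]
  rw [show res d I φ - res d I' φ = (res d J φ - res d I' φ) - (res d J φ - res d I φ) by abel]
  refine (norm_sub_le _ _).trans ?_
  linarith

lemma cover_const {τ : ℝ} (hτ : 0 ≤ τ) (hτ1 : τ ≤ 1 / 1000) :
    √τ * (2 + √τ) + √((√τ * (2 + √τ)) ^ 2 + τ) ≤ 4.4 * √τ := by
  have h0 := Real.sqrt_nonneg τ
  have h1 := Real.sq_sqrt hτ
  have h2 : √τ ≤ 0.032 := by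
    rw [Real.sqrt_le_left (by norm_num)]
    norm_num
    linarith
  have h3 : √((√τ * (2 + √τ)) ^ 2 + τ) ≤ 2.3 * √τ := by
    rw [Real.sqrt_le_left (by positivity)]
    have : (2 + √τ) ^ 2 ≤ 2.032 ^ 2 := by gcongr; linarith
    rw [mul_pow, mul_pow, h1]
    nlinarith
  nlinarith

variable {y : ℕ} {s t s' t' : ℕ} {φ : Vec n} {τ h : ℝ}

lemma card_gap_left (hs : s ≤ y) (hy : y ≤ n) : (blk n (y - s) y).card = s := by
  rw [card_blk hy]
  omega

lemma card_gap_right (ht : y + t ≤ n) : (blk n y (y + t)).card = t := by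
  rw [card_blk ht]
  omega

lemma res_close_left (hτ : 0 ≤ τ) (hτ1 : τ ≤ 1 / 1000) (hh : 0 ≤ h) (hss : s ≤ s') (hs' : s' ≤ y)
    (htt : t' ≤ t) (ht : y + t ≤ n)
    (hI : ‖res d (gapBlk n y (s, t)) φ‖ ^ 2 ≤ h)
    (hII : |‖res d (gapBlk n y (s, t)) φ‖ ^ 2 - ‖res d (gapBlk n y (s', t')) φ‖ ^ 2| ≤ τ * h)
    (hL : |‖res d (blk n (y - s) y) φ‖ ^ 2 - ‖res d (blk n (y - s') y) φ‖ ^ 2| ≤ τ * h)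
    (hcase : 2 * ((d : ℝ) + 1) ^ 2 * t ≤ τ * s ∨
      (s' : ℝ) ≤ (1 + τ / (2 * ((d : ℝ) + 1) ^ 2)) * s) :
    ‖res d (gapBlk n y (s, t)) φ - res d (gapBlk n y (s', t')) φ‖ ≤ 4.4 * √τ * √h := by
  have hA : blk n (y - s) y ⊆ blk n (y - s') y := blk_subset (by omega) le_rfl
  have hB : Disjoint (blk n (y - s') y) (blk n y (y + t)) := disjoint_blk_gap _ _ _
  have hJ := norm_res_union_sub_le (d := d) hA hB φ hτ
    (by linarith [neg_le_of_abs_le hL]) hI fun r hr => by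
      rcases hcase with hcase | hcase
      · refine norm_sq_res_le_of_small hA hB ?_ hτ (by linarith) ?_ hr
        · have := gapBlk_eq (n := n) (y := y) (s, t)
          rw [gapBlk] at this
          rw [this]
          exact blk_ordConnected _ _
        · rw [card_gap_right ht, card_gap_left (hss.trans hs') (by omega)]
          exact hcase
      · refine norm_sq_res_le_of_card_le hA hB (blk_ordConnected _ _) hτ (by linarith) ?_ hr
        rw [card_gap_left hs' (by omega), card_gap_left (hss.trans hs') (by omega)]
        exact hcase
  refine (norm_res_sub_le_of_join (d := d) (J := blk n (y - s') y ∪ blk n y (y + t))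
    (Finset.union_subset_union_left hA)
    (Finset.union_subset_union_right (blk_subset le_rfl (by omega))) φ hτ hh hII
    hJ).trans ?_
  exact mul_le_mul_of_nonneg_right (cover_const hτ hτ1) (Real.sqrt_nonneg _)

lemma res_close_right (hτ : 0 ≤ τ) (hτ1 : τ ≤ 1 / 1000) (hh : 0 ≤ h) (hss : s ≤ s') (hs' : s' ≤ y)
    (htt : t' ≤ t) (ht : y + t ≤ n)
    (hI : ‖res d (gapBlk n y (s', t')) φ‖ ^ 2 ≤ h)
    (hII : |‖res d (gapBlk n y (s', t')) φ‖ ^ 2 - ‖res d (gapBlk n y (s, t)) φ‖ ^ 2| ≤ τ * h)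
    (hR : |‖res d (blk n y (y + t)) φ‖ ^ 2 - ‖res d (blk n y (y + t')) φ‖ ^ 2| ≤ τ * h)
    (hcase : 2 * ((d : ℝ) + 1) ^ 2 * s' ≤ τ * t') :
    ‖res d (gapBlk n y (s', t')) φ - res d (gapBlk n y (s, t)) φ‖ ≤ 4.4 * √τ * √h := by
  have hA : blk n y (y + t') ⊆ blk n y (y + t) := blk_subset le_rfl (by omega)
  have hB : Disjoint (blk n y (y + t)) (blk n (y - s') y) := (disjoint_blk_gap _ _ _).symm
  have e1 : ∀ s t, blk n y (y + t) ∪ blk n (y - s) y = gapBlk n y (s, t) := fun s t => by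
    rw [gapBlk, Finset.union_comm]
  have hJ := norm_res_union_sub_le (d := d) (h := h) hA hB φ hτ
    (by linarith [le_of_abs_le hR]) (by rw [e1]; exact hI) fun r hr => by
      refine norm_sq_res_le_of_small hA hB ?_ hτ (by linarith) ?_ hr
      · rw [e1, gapBlk_eq]
        exact blk_ordConnected _ _
      · rw [card_gap_right (by omega), card_gap_left hs' (by omega)]
        exact hcase
  rw [e1, e1] at hJ
  refine (norm_res_sub_le_of_join (d := d) (J := gapBlk n y (s', t)) (Finset.union_subset_union_right hA)
    (Finset.union_subset_union_left (blk_subset (by omega) le_rfl)) φ hτ hh hII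
    hJ).trans ?_
  exact mul_le_mul_of_nonneg_right (cover_const hτ hτ1) (Real.sqrt_nonneg _)

lemma abs_sub_le_of_floor_eq {x x' τ : ℝ} (hτ : 0 < τ) (hx : 0 ≤ x) (hx' : 0 ≤ x')
    (h : ⌊x / τ⌋₊ = ⌊x' / τ⌋₊) : |x - x'| ≤ τ := by
  have h1 := Nat.floor_le (div_nonneg hx hτ.le)
  have h2 := Nat.floor_le (div_nonneg hx' hτ.le)
  have h3 := Nat.lt_floor_add_one (x / τ)
  have h4 := Nat.lt_floor_add_one (x' / τ)
  rw [h] at h1 h3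
  rw [le_div_iff₀ hτ] at h1 h2
  rw [div_lt_iff₀ hτ] at h3 h4
  rw [abs_le]
  constructor <;> nlinarith

/-- The pairs `(s, t)` such that the interval `gapBlk n y (s, t)` lies in `{0, …, n - 1}` and the
squared norm of the residual is at most `h`. -/
def gapSet (d : ℕ) (φ : Vec n) (y : ℕ) (h : ℝ) : Set (ℕ × ℕ) :=
  {st | 1 ≤ st.1 ∧ st.1 ≤ y ∧ 1 ≤ st.2 ∧ y + st.2 ≤ n ∧ ‖res d (gapBlk n y st) φ‖ ^ 2 ≤ h}

open Classical in
/-- The code of an interval in the covering. -/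
def gapCode (d : ℕ) (φ : Vec n) (y : ℕ) (h τ : ℝ) (st : ℕ × ℕ) : ℕ × ℕ × ℕ × ℤ :=
  (⌊‖res d (gapBlk n y st) φ‖ ^ 2 / (τ * h)⌋₊,
    if 2 * ((d : ℝ) + 1) ^ 2 * st.2 ≤ τ * st.1 then
      (0, ⌊‖res d (blk n (y - st.1) y) φ‖ ^ 2 / (τ * h)⌋₊, 0)
    else if 2 * ((d : ℝ) + 1) ^ 2 * st.1 ≤ τ * st.2 then
      (1, ⌊‖res d (blk n y (y + st.2)) φ‖ ^ 2 / (τ * h)⌋₊, 0)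
    else (2, ⌊‖res d (blk n (y - st.1) y) φ‖ ^ 2 / (τ * h)⌋₊,
      ⌊(Real.log st.1 - Real.log st.2) / (τ / (4 * ((d : ℝ) + 1) ^ 2))⌋))

lemma le_mul_of_log_sub_le {a b w : ℝ} (ha : 0 < a) (hb : 0 < b) (hw : 0 ≤ w) (hw1 : w ≤ 1 / 2)
    (h : Real.log a - Real.log b ≤ w) : a ≤ (1 + 2 * w) * b := by
  rw [← Real.log_div ha.ne' hb.ne', Real.log_le_iff_le_exp (by positivity), div_le_iff₀ hb] at h
  refine h.trans (mul_le_mul_of_nonneg_right ?_ hb.le)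
  refine (Real.exp_bound_div_one_sub_of_interval hw (by linarith)).trans ?_
  rw [div_le_iff₀ (by linarith)]
  nlinarith

/-- Equal codes mean close residual norms and the same shape. If the two intervals are nested, close
norms suffice. If they cross, they are compared through their join, obtained by extending one side
of one of them: the long side when the interval is very unbalanced, so that the other side is
negligible; otherwise the left side, whose lengths are then nearly equal by the logarithmic
component of the code. -/
lemma res_close_of_code (hτ : 0 < τ) (hτ1 : τ ≤ 1 / 1000) (hh : 0 < h) {p p' : ℕ × ℕ}
    (hp : p ∈ gapSet d φ y h) (hp' : p' ∈ gapSet d φ y h)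
    (hc : gapCode d φ y h τ p = gapCode d φ y h τ p') :
    ‖res d (gapBlk n y p) φ - res d (gapBlk n y p') φ‖ ≤ 4.4 * √τ * √h := by
  wlog hle : p.1 ≤ p'.1 generalizing p p' with H
  · rw [norm_sub_rev]
    exact H hp' hp hc.symm (by omega)
  obtain ⟨s, t⟩ := p
  obtain ⟨s', t'⟩ := p'
  obtain ⟨hs1, hsy, ht1, htn, hI⟩ := hp
  obtain ⟨hs1', hsy', ht1', htn', hI'⟩ := hp'
  simp only at hs1 hsy ht1 htn hs1' hsy' ht1' htn' hle
  simp only [gapCode, Prod.mk.injEq] at hc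
  obtain ⟨hc1, hc2⟩ := hc
  have hth : 0 < τ * h := by positivity
  have hII := abs_sub_le_of_floor_eq hth (sq_nonneg _) (sq_nonneg _) hc1
  rcases lt_or_ge t' t with htt | htt
  swap
  · rw [norm_sub_rev]
    have hsub : gapBlk n y (s, t) ⊆ gapBlk n y (s', t') := by
      rw [gapBlk_eq, gapBlk_eq]
      exact blk_subset (by simp only; omega) (by simp only; omega)
    refine le_of_sq_le_sq ?_ (by positivity)
    rw [norm_sq_res_sub hsub, mul_pow, mul_pow, Real.sq_sqrt hτ.le, Real.sq_sqrt hh.le]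
    have := neg_le_of_abs_le hII
    nlinarith
  · have hs0 : (0 : ℝ) < s := by exact_mod_cast hs1
    have ht0 : (0 : ℝ) < t := by exact_mod_cast ht1
    have hs0' : (0 : ℝ) < s' := by exact_mod_cast hs1'
    have ht0' : (0 : ℝ) < t' := by exact_mod_cast ht1'
    split_ifs at hc2 with h1 h2 h3 h4 h5 h6 <;> simp at hc2
    · exact res_close_left hτ.le hτ1 hh.le hle hsy' htt.le htn hI hII
        (abs_sub_le_of_floor_eq hth (sq_nonneg _) (sq_nonneg _) hc2) (Or.inl h1)
    · rw [norm_sub_rev]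
      refine res_close_right hτ.le hτ1 hh.le hle hsy' htt.le htn hI' ?_
        (abs_sub_le_of_floor_eq hth (sq_nonneg _) (sq_nonneg _) hc2) h6
      rwa [abs_sub_comm]
    · refine res_close_left hτ.le hτ1 hh.le hle hsy' htt.le htn hI hII
        (abs_sub_le_of_floor_eq hth (sq_nonneg _) (sq_nonneg _) hc2.1) (Or.inr ?_)
      set w := τ / (4 * ((d : ℝ) + 1) ^ 2) with hw
      have hw0 : 0 < w := by positivity
      have hw1 : w ≤ 1 / 2 := by
        rw [hw, div_le_iff₀ (by positivity)]
        nlinarith [sq_nonneg (d : ℝ), (by positivity : (0 : ℝ) ≤ d)]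
      have hfl := Int.abs_sub_lt_one_of_floor_eq_floor hc2.2
      -- The log-ratios differ by less than w and t' < t, hence log s' − log s ≤ w and s' ≤ (1 + 2w)
      -- s.
      rw [← sub_div, abs_div, abs_of_pos hw0, div_lt_one hw0] at hfl
      have hlt : Real.log t' ≤ Real.log t :=
        Real.log_le_log ht0' (by exact_mod_cast htt.le)
      have := neg_lt_of_abs_lt hfl
      have := le_mul_of_log_sub_le hs0' hs0 hw0.le hw1 (by linarith)
      rw [show τ / (2 * ((d : ℝ) + 1) ^ 2) = 2 * w by rw [hw]; field_simp; ring]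
      exact this

/-- The norms take at most 1/τ + 1 discretized values, there are three shapes, and in the balanced
shape the log-ratio lies in [−2D²/τ, 2D²/τ] with mesh τ/(4D²). The count does not involve n. -/
lemma exists_gap_cover (hτ : 0 < τ) (hτ1 : τ ≤ 1 / 1000) (hh : 0 < h) (φ : Vec n) :
    ∃ T : Finset (ℕ × ℕ × ℕ × ℤ), (T.card : ℝ) ≤ 50 * ((d : ℝ) + 1) ^ 4 / τ ^ 4 ∧
      ∀ p ∈ gapSet d φ y h, gapCode d φ y h τ p ∈ T := by
  set D : ℝ := (d : ℝ) + 1 with hD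
  have hD1 : 1 ≤ D := by rw [hD]; linarith [(by positivity : (0 : ℝ) ≤ d)]
  set w := τ / (4 * D ^ 2) with hw
  have hw0 : 0 < w := by positivity
  set G := 2 * D ^ 2 / τ with hG
  set Z := ⌈G / w⌉₊ with hZ
  set R := ⌊1 / τ⌋₊ with hR
  refine ⟨Finset.range (R + 1) ×ˢ Finset.range 3 ×ˢ Finset.range (R + 1) ×ˢ
    Finset.Icc (-(Z : ℤ)) Z, ?_, ?_⟩
  · rw [Finset.card_product, Finset.card_product, Finset.card_product, Finset.card_range,
      Finset.card_range, Int.card_Icc, show ((Z : ℤ) + 1 - -(Z : ℤ)).toNat = 2 * Z + 1 by omega]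
    push_cast
    have h1 : (R : ℝ) ≤ 1 / τ := Nat.floor_le (by positivity)
    have h2 : (Z : ℝ) ≤ G / w + 1 := (Nat.ceil_lt_add_one (by positivity)).le
    have h3 : G / w = 8 * D ^ 4 / τ ^ 2 := by
      rw [hG, hw]
      field_simp
      ring
    have h4 : (1000 : ℝ) ≤ 1 / τ := by
      rw [le_div_iff₀ hτ]
      linarith
    set T := 1 / τ with hT
    have h5 : 8 * D ^ 4 / τ ^ 2 = 8 * D ^ 4 * T ^ 2 := by rw [hT]; field_simp
    have h6 : 50 * D ^ 4 / τ ^ 4 = 50 * D ^ 4 * T ^ 4 := by rw [hT]; field_simp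
    rw [h3, h5] at h2
    rw [h6]
    have h7 : (R : ℝ) + 1 ≤ 1.001 * T := by linarith
    have hD4 : 1 ≤ D ^ 4 := one_le_pow₀ hD1
    have h8 : 2 * (Z : ℝ) + 1 ≤ 16.00001 * D ^ 4 * T ^ 2 := by
      have : 1000000 ≤ T ^ 2 := by nlinarith
      nlinarith [mul_nonneg (sub_nonneg.2 hD4) (sub_nonneg.2 this)]
    calc ((R : ℝ) + 1) * (3 * ((R + 1) * (2 * Z + 1))) ≤
        (1.001 * T) * (3 * ((1.001 * T) * (16.00001 * D ^ 4 * T ^ 2))) := by gcongr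
      _ = (1.001 ^ 2 * 3 * 16.00001) * (D ^ 4 * T ^ 4) := by ring
      _ ≤ 50 * (D ^ 4 * T ^ 4) := by
        apply mul_le_mul_of_nonneg_right (by norm_num) (by positivity)
      _ = _ := by ring
  · rintro ⟨s, t⟩ ⟨hs1, hsy, ht1, htn, hI⟩
    simp only at hs1 hsy ht1 htn
    have hs0 : (0 : ℝ) < s := by exact_mod_cast hs1
    have ht0 : (0 : ℝ) < t := by exact_mod_cast ht1
    have hfl : ∀ K : Finset (Fin n), K ⊆ gapBlk n y (s, t) →
        ⌊‖res d K φ‖ ^ 2 / (τ * h)⌋₊ < R + 1 := by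
      intro K hK
      rw [Nat.lt_succ_iff]
      refine Nat.floor_mono ?_
      have : ‖res d K φ‖ ^ 2 ≤ h :=
        (pow_le_pow_left₀ (norm_nonneg _) (norm_res_mono hK φ) 2).trans hI
      rw [div_le_div_iff₀ (by positivity) hτ]
      nlinarith
    have hlog : ∀ {a b : ℝ}, 0 < a → 0 < b → τ * a < 2 * D ^ 2 * b →
        Real.log a - Real.log b ≤ G := by
      intro a b ha hb hab
      rw [← Real.log_div ha.ne' hb.ne']
      refine (Real.log_le_self (by positivity)).trans ?_
      rw [hG, div_le_div_iff₀ hb hτ]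
      linarith
    have hL := hfl _ (Finset.subset_union_left (s₁ := blk n (y - s) y) (s₂ := blk n y (y + t)))
    have hRR := hfl _ (Finset.subset_union_right (s₁ := blk n (y - s) y) (s₂ := blk n y (y + t)))
    have hII := hfl _ subset_rfl
    simp only [gapCode, Finset.mem_product, Finset.mem_range]
    refine ⟨hII, ?_⟩
    split_ifs with h1 h2
    · exact ⟨by norm_num, hL, by simp⟩
    · exact ⟨by norm_num, hRR, by simp⟩
    · refine ⟨by norm_num, hL, ?_⟩
      have a1 := hlog hs0 ht0 (lt_of_not_ge h1)
      have a2 := hlog ht0 hs0 (lt_of_not_ge h2)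
      have hz : G / w ≤ Z := Nat.le_ceil _
      rw [Finset.mem_Icc]
      constructor
      · rw [Int.le_floor]
        push_cast
        rw [← hw, le_div_iff₀ hw0]
        rw [div_le_iff₀ hw0] at hz
        linarith
      · rw [← Int.lt_add_one_iff, Int.floor_lt]
        push_cast
        rw [← hw, div_lt_iff₀ hw0]
        rw [div_le_iff₀ hw0] at hz
        linarith

end

noncomputable section

variable {n d : ℕ} {Ω : Type*} [MeasurableSpace Ω] {μ : Measure Ω} [IsProbabilityMeasure μ]
  {ξ : Fin n → Ω → ℝ} {σ c : ℝ}

/-! ### Chaining -/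

/-- The subtracted term on the right is the exact tail correction that lets the induction close. -/
lemma chaining_sum_le (L : ℕ) :
    1 + ∑ l ∈ Finset.range L, (1 / 4 : ℝ) ^ l / 8 * (1 + ((l : ℝ) + 1) / 3) ≤
      1.25 - (1 / 4 : ℝ) ^ L / 8 * (2 + (L : ℝ) / 2) := by
  induction L with
  | zero => norm_num
  | succ L ih =>
    rw [Finset.sum_range_succ, ← add_assoc]
    refine (add_le_add_left ih _).trans ?_
    rw [pow_succ]
    push_cast
    have : 0 ≤ (1 / 4 : ℝ) ^ L := by positivity
    have hL : (0 : ℝ) ≤ L := by positivity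
    nlinarith [mul_nonneg this hL]

lemma sum_half_pow_le (L : ℕ) : ∑ l ∈ Finset.range L, (1 / 2 : ℝ) ^ (l + 1) ≤ 1 := by
  have : ∀ L : ℕ, ∑ l ∈ Finset.range L, (1 / 2 : ℝ) ^ (l + 1) = 1 - (1 / 2) ^ L := by
    intro L
    induction L with
    | zero => simp
    | succ L ih =>
      rw [Finset.sum_range_succ, ih, pow_succ]
      ring
  rw [this]
  have : 0 ≤ (1 / 2 : ℝ) ^ L := by positivity
  linarith

/-- Deterministic part of the chaining argument. -/
lemma chaining_deterministic {ι : Type*} {S : Set ι} {x : ι → Vec n} {h : ℝ}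
    {R : ℕ → ι → ι} {T : ℕ → Finset ι} (hT : ∀ l, ∀ q ∈ T l, q ∈ S)
    (hR : ∀ l, ∀ p ∈ S, R l p ∈ T l ∧ ‖x p - x (R l p)‖ ≤ (1 / 4) ^ l / 8 * √h)
    {z : Vec n} {w : ℝ} (hw : 0 ≤ w) (h0 : ∀ q ∈ T 0, |inner ℝ (x q) z| ≤ w)
    (h1 : ∀ l, ∀ q ∈ T (l + 1), |inner ℝ (x q - x (R l q)) z| ≤
      (1 / 4) ^ l / 8 * (1 + ((l : ℝ) + 1) / 3) * w) {p : ι} (hp : p ∈ S) :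
    |inner ℝ (x p) z| ≤ 1.25 * w := by
  have key : ∀ L : ℕ, ∀ q ∈ T L, |inner ℝ (x q) z| ≤
      (1 + ∑ l ∈ Finset.range L, (1 / 4 : ℝ) ^ l / 8 * (1 + ((l : ℝ) + 1) / 3)) * w := by
    intro L
    induction L with
    | zero => simpa using h0
    | succ L ih =>
      intro q hq
      have e : inner ℝ (x q) z = inner ℝ (x q - x (R L q)) z + inner ℝ (x (R L q)) z := by
        rw [← inner_add_left, sub_add_cancel]
      rw [e, Finset.sum_range_succ, ← add_assoc, add_mul]
      refine (abs_add_le _ _).trans ?_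
      rw [add_comm]
      exact add_le_add (ih _ (hR L q (hT _ q hq)).1) (h1 L q hq)
  have key2 : ∀ L : ℕ, |inner ℝ (x p) z| ≤ 1.25 * w + (1 / 4 : ℝ) ^ L * (√h * ‖z‖) := by
    intro L
    obtain ⟨ha, hb⟩ := hR L p hp
    have e : inner ℝ (x p) z = inner ℝ (x p - x (R L p)) z + inner ℝ (x (R L p)) z := by
      rw [← inner_add_left, sub_add_cancel]
    rw [e]
    refine (abs_add_le _ _).trans ?_
    rw [add_comm]
    refine add_le_add ((key L _ ha).trans ?_) ?_
    · refine mul_le_mul_of_nonneg_right ((chaining_sum_le L).trans ?_) hw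
      have : 0 ≤ (1 / 4 : ℝ) ^ L / 8 * (2 + (L : ℝ) / 2) := by positivity
      linarith
    · refine (abs_real_inner_le_norm _ _).trans ?_
      refine (mul_le_mul_of_nonneg_right hb (norm_nonneg z)).trans ?_
      have : 0 ≤ (1 / 4 : ℝ) ^ L * (√h * ‖z‖) := by positivity
      nlinarith
  have hlim : Filter.Tendsto (fun L : ℕ => 1.25 * w + (1 / 4 : ℝ) ^ L * (√h * ‖z‖)) Filter.atTop
      (nhds (1.25 * w + 0 * (√h * ‖z‖))) :=
    ((tendsto_pow_atTop_nhds_zero_of_lt_one (by norm_num) (by norm_num)).mul_const _).const_add _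
  rw [zero_mul, add_zero] at hlim
  exact ge_of_tendsto' hlim key2

/-- A maximal inequality for linear functionals of the noise, by chaining. -/
lemma IsBernsteinNoise.chaining (hn : IsBernsteinNoise μ ξ σ c) (hσ : 0 < σ) {ι : Type*} {S : Set ι}
    {x : ι → Vec n} {h lam A m Y v : ℝ} (hh : 0 < h) (hl : 0 ≤ lam)
    (hx : ∀ p ∈ S, ‖x p‖ ^ 2 ≤ h) (hx1 : ∀ p ∈ S, ∀ i, |x p i| ≤ lam * ‖x p‖)
    (hx2 : ∀ p ∈ S, ∀ q ∈ S, ∀ i, |(x p - x q) i| ≤ lam * ‖x p - x q‖)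
    (hcov : ∀ l : ℕ, ∃ (R : ι → ι) (T : Finset ι), (∀ q ∈ T, q ∈ S) ∧
      (T.card : ℝ) ≤ Real.exp (A + 12 * l) ∧
      ∀ p ∈ S, R p ∈ T ∧ ‖x p - x (R p)‖ ≤ (1 / 4) ^ l / 8 * √h)
    (hY : A + m + 1.4 ≤ Y) (hY39 : 39 ≤ Y) (hv : 0 ≤ v) :
    μ {ω | ∃ p ∈ S, 1.25 * (√h * ((1 + v / Y) * dev σ c lam Y)) < |inner ℝ (x p) (noise ξ ω)|} ≤
      ENNReal.ofReal (Real.exp (-m - v)) := by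
  have hc := hn.c_nonneg
  choose R T hT hTc hR using hcov
  have hY0 : 0 < Y := by linarith
  set w := √h * ((1 + v / Y) * dev σ c lam Y) with hw
  have hw0 : 0 ≤ w := by
    have := dev_nonneg (σ := σ) hc hl hY0.le
    positivity
  have hsh : 0 < √h := Real.sqrt_pos.2 hh
  set B0 : Set Ω := ⋃ q ∈ T 0, {ω | √h * dev σ c lam (Y + v) ≤ |inner ℝ (x q) (noise ξ ω)|}
    with hB0
  -- Link l is controlled at level Y + v + 13(l + 1), while its net has log-cardinality at most A +
  -- 12(l + 1). The remaining l + 1 makes the failure probabilities summable.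
  set B : ℕ → Set Ω := fun l => ⋃ q ∈ T (l + 1), {ω | ((1 / 4) ^ l / 8 * √h) *
    dev σ c lam (Y + v + 13 * (l + 1)) ≤ |inner ℝ (x q - x (R l q)) (noise ξ ω)|} with hB
  have e1 : Y + v = (1 + v / Y) * Y := by field_simp
  have hr1 : 1 ≤ 1 + v / Y := by
    have : 0 ≤ v / Y := by positivity
    linarith
  have hsub : {ω | ∃ p ∈ S, 1.25 * w < |inner ℝ (x p) (noise ξ ω)|} ⊆ B0 ∪ ⋃ l, B l := by
    rintro ω ⟨p, hp, hlt⟩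
    by_contra hcon
    simp only [hB0, hB, Set.mem_union, Set.mem_iUnion, Set.mem_ofPred_eq, not_or, not_exists,
      not_le] at hcon
    refine absurd (chaining_deterministic hT hR (z := noise ξ ω) hw0 ?_ ?_ hp) (not_le.2 hlt)
    · intro q hq
      refine (hcon.1 q hq).le.trans ?_
      rw [e1, hw]
      exact mul_le_mul_of_nonneg_left (dev_le_mul hr1) hsh.le
    · intro l q hq
      refine (hcon.2 l q hq).le.trans ?_
      have hl0 : (0 : ℝ) ≤ l := by positivity
      -- Since Y ≥ 39, each extra 13 is at most a third of Y + v.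
      have e2 : Y + v + 13 * ((l : ℝ) + 1) ≤ ((1 + ((l : ℝ) + 1) / 3) * (1 + v / Y)) * Y := by
        have : ((1 + ((l : ℝ) + 1) / 3) * (1 + v / Y)) * Y =
          (1 + ((l : ℝ) + 1) / 3) * (Y + v) := by rw [e1]; ring
        rw [this]
        nlinarith [mul_nonneg hl0 hv]
      have hr2 : 1 ≤ (1 + ((l : ℝ) + 1) / 3) * (1 + v / Y) := by
        have : 1 ≤ 1 + ((l : ℝ) + 1) / 3 := by
          have : 0 ≤ ((l : ℝ) + 1) / 3 := by positivity
          linarith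
        nlinarith
      have e3 := (dev_mono (σ := σ) hc hl e2).trans (dev_le_mul hr2)
      calc _ ≤ ((1 / 4) ^ l / 8 * √h) *
            (((1 + ((l : ℝ) + 1) / 3) * (1 + v / Y)) * dev σ c lam Y) := by gcongr
        _ = _ := by rw [hw]; ring
  -- The factor 4 pays for two-sided tails and for splitting the probability between the first net
  -- and the links. It is the origin of 1.4 in `hY`.
  have hfour : 4 ≤ Real.exp 1.4 := by
    have := Real.exp_one_gt_d9
    have h2 : Real.exp 1.4 = (Real.exp 0.2) ^ 7 := by rw [← Real.exp_nat_mul]; norm_num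
    have h3 : 1 + 0.2 + 0.2 ^ 2 / 2 ≤ Real.exp 0.2 := Real.quadratic_le_exp_of_nonneg (by norm_num)
    rw [h2]
    calc (4 : ℝ) ≤ (1 + 0.2 + 0.2 ^ 2 / 2) ^ 7 := by norm_num
      _ ≤ _ := by gcongr
  have hexpA : 4 * Real.exp (A - Y) ≤ Real.exp (-m) := by
    calc 4 * Real.exp (A - Y) ≤ Real.exp 1.4 * Real.exp (A - Y) := by gcongr
      _ = Real.exp (1.4 + (A - Y)) := by rw [Real.exp_add]
      _ ≤ _ := by rw [Real.exp_le_exp]; linarith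
  have hAv : 4 * Real.exp (A - Y - v) ≤ Real.exp (-m - v) := by
    rw [Real.exp_sub _ v, Real.exp_sub _ v, ← mul_div_assoc]
    gcongr
  have hp0 : μ B0 ≤ ENNReal.ofReal (Real.exp (-m - v) / 2) := by
    rw [← ofReal_measureReal (measure_ne_top μ _)]
    refine ENNReal.ofReal_le_ofReal ?_
    refine (measureReal_biUnion_finset_le _ _).trans ?_
    refine (Finset.sum_le_card_nsmul _ _ (2 * Real.exp (-(Y + v))) fun q hq => ?_).trans ?_
    · refine hn.tail_abs (x q) hσ hsh (Real.le_sqrt_of_sq_le (hx q (hT 0 q hq))) hl (fun i => ?_)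
        (by linarith)
      refine (hx1 q (hT 0 q hq) i).trans ?_
      exact mul_le_mul_of_nonneg_left (Real.le_sqrt_of_sq_le (hx q (hT 0 q hq))) hl
    · rw [nsmul_eq_mul]
      have hc0 := hTc 0
      simp only [CharP.cast_eq_zero, mul_zero, add_zero] at hc0
      calc ((T 0).card : ℝ) * (2 * Real.exp (-(Y + v))) ≤
            Real.exp A * (2 * Real.exp (-(Y + v))) := by gcongr
        _ = 2 * Real.exp (A - Y - v) := by
            rw [show A - Y - v = A + -(Y + v) by ring, Real.exp_add]
            ring
        _ ≤ _ := by linarith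
  have hpl : ∀ l, μ.real (B l) ≤ Real.exp (-m - v) / 2 * (1 / 2) ^ (l + 1) := by
    intro l
    have hθ : 0 < (1 / 4 : ℝ) ^ l / 8 * √h := by positivity
    refine (measureReal_biUnion_finset_le _ _).trans ?_
    refine (Finset.sum_le_card_nsmul _ _ (2 * Real.exp (-(Y + v + 13 * (l + 1)))) fun q hq =>
      ?_).trans ?_
    · have hqS := hT _ q hq
      have hd := (hR l q hqS).2
      refine hn.tail_abs _ hσ hθ hd hl (fun i => ?_) (by positivity)
      exact (hx2 q hqS _ (hT l _ (hR l q hqS).1) i).trans (mul_le_mul_of_nonneg_left hd hl)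
    · rw [nsmul_eq_mul]
      have hexp : Real.exp (-((l : ℝ) + 1)) ≤ (1 / 2) ^ (l + 1) := by
        have h2 : Real.exp (-1) ≤ 1 / 2 := by
          rw [Real.exp_neg, inv_le_comm₀ (Real.exp_pos _) (by norm_num)]
          linarith [Real.exp_one_gt_d9]
        rw [show -((l : ℝ) + 1) = ((l + 1 : ℕ) : ℝ) * (-1) by push_cast; ring, Real.exp_nat_mul]
        exact pow_le_pow_left₀ (Real.exp_pos _).le h2 _
      calc ((T (l + 1)).card : ℝ) * (2 * Real.exp (-(Y + v + 13 * (l + 1)))) ≤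
            Real.exp (A + 12 * ((l + 1 : ℕ) : ℝ)) * (2 * Real.exp (-(Y + v + 13 * (l + 1)))) := by
            gcongr
            exact hTc (l + 1)
        _ = 2 * Real.exp (A - Y - v) * Real.exp (-((l : ℝ) + 1)) := by
            rw [mul_left_comm, ← Real.exp_add, mul_assoc, ← Real.exp_add]
            congr 2
            push_cast
            ring
        _ ≤ Real.exp (-m - v) / 2 * (1 / 2) ^ (l + 1) := by
            gcongr
            linarith
  have hun : μ (⋃ l, B l) ≤ ENNReal.ofReal (Real.exp (-m - v) / 2) := by
    refine (measure_iUnion_le _).trans (ENNReal.tsum_le_of_sum_range_le fun L => ?_)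
    have : ∀ l, μ (B l) = ENNReal.ofReal (μ.real (B l)) := fun l =>
      (ofReal_measureReal (measure_ne_top μ _)).symm
    simp_rw [this]
    rw [← ENNReal.ofReal_sum_of_nonneg fun l _ => measureReal_nonneg]
    refine ENNReal.ofReal_le_ofReal ((Finset.sum_le_sum fun l _ => hpl l).trans ?_)
    rw [← Finset.mul_sum]
    have := sum_half_pow_le L
    have h0 : 0 ≤ Real.exp (-m - v) / 2 := by positivity
    nlinarith
  refine (measure_mono hsub).trans ((measure_union_le _ _).trans ((add_le_add hp0 hun).trans_eq ?_))
  rw [← ENNReal.ofReal_add (by positivity) (by positivity)]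
  congr 1
  ring

end

noncomputable section

variable {n d : ℕ} {Ω : Type*} [MeasurableSpace Ω] {μ : Measure Ω}
  {ξ : Fin n → Ω → ℝ} {σ c : ℝ}

/-! ### Maximal inequality for the intervals containing a given gap -/

/-- The representatives are chosen inside S, so that the leverage bounds remain available for the
links. -/
lemma exists_net_of_cover {ι κ E : Type*} [NormedAddCommGroup E] {S : Set ι} {x : ι → E} (code : ι → κ)
    (T : Finset κ) {δ : ℝ} (hT : ∀ p ∈ S, code p ∈ T)
    (hd : ∀ p ∈ S, ∀ q ∈ S, code p = code q → ‖x p - x q‖ ≤ δ) :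
    ∃ (R : ι → ι) (T' : Finset ι), (∀ q ∈ T', q ∈ S) ∧ T'.card ≤ T.card ∧
      ∀ p ∈ S, R p ∈ T' ∧ ‖x p - x (R p)‖ ≤ δ := by
  classical
  rcases S.eq_empty_or_nonempty with rfl | ⟨p₀, hp₀⟩
  · exact ⟨id, ∅, by simp, by simp, by simp⟩
  let f : κ → ι := fun k => if h : ∃ p ∈ S, code p = k then h.choose else p₀
  have hf : ∀ k, f k ∈ S := fun k => by
    by_cases h : ∃ p ∈ S, code p = k
    · simp only [f, h, dif_pos]
      exact h.choose_spec.1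
    · simp only [f, h, dif_neg, not_false_eq_true]
      exact hp₀
  have hfc : ∀ p ∈ S, code (f (code p)) = code p := fun p hp => by
    have h : ∃ q ∈ S, code q = code p := ⟨p, hp, rfl⟩
    simp only [f, h, dif_pos]
    exact h.choose_spec.2
  refine ⟨fun p => f (code p), T.image f, ?_, Finset.card_image_le, fun p hp => ⟨?_, ?_⟩⟩
  · intro q hq
    obtain ⟨k, _, rfl⟩ := Finset.mem_image.1 hq
    exact hf k
  · exact Finset.mem_image_of_mem f (hT p hp)
  · exact hd p hp _ (hf _) (hfc p hp).symm

/-- The covering radius 4^(−l)/8 uses τ equal to its square over 20. The power 65536^l is absorbed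
by exp(12 l), and the constant 8000000 · 8^8 together with D⁴ by exp(33 D). -/
lemma gap_card_le (D : ℝ) (hD : 1 ≤ D) (l : ℕ) :
    50 * D ^ 4 / (((1 / 4) ^ l / 8) ^ 2 / 20) ^ 4 ≤ Real.exp (33 * D + 12 * l) := by
  have h1 : D ^ 4 ≤ Real.exp (4 * D - 4) := by
    have := Real.add_one_le_exp (D - 1)
    rw [show 4 * D - 4 = (4 : ℕ) * (D - 1) by push_cast; ring, Real.exp_nat_mul]
    exact pow_le_pow_left₀ (by linarith) (by linarith) 4
  have h2 : (65536 : ℝ) ^ l ≤ Real.exp (12 * l) := by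
    rw [mul_comm, Real.exp_nat_mul]
    refine pow_le_pow_left₀ (by norm_num) ?_ l
    rw [show (12 : ℝ) = (12 : ℕ) * 1 by norm_num, Real.exp_nat_mul]
    calc (65536 : ℝ) ≤ 2.7 ^ 12 := by norm_num
      _ ≤ _ := by
        have := Real.exp_one_gt_d9
        gcongr
        linarith
  have h3 : (8000000 * 8 ^ 8 : ℝ) ≤ Real.exp 33 := by
    rw [show (33 : ℝ) = (33 : ℕ) * 1 by norm_num, Real.exp_nat_mul]
    calc (8000000 * 8 ^ 8 : ℝ) ≤ 2.7182 ^ 33 := by norm_num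
      _ ≤ _ := by
        have := Real.exp_one_gt_d9
        gcongr
        linarith
  have e : 50 * D ^ 4 / (((1 / 4) ^ l / 8) ^ 2 / 20) ^ 4 =
      (8000000 * 8 ^ 8) * D ^ 4 * 65536 ^ l := by
    have : (65536 : ℝ) ^ l = ((4 : ℝ) ^ l) ^ 8 := by
      rw [← pow_mul, mul_comm, pow_mul]
      norm_num
    rw [this, one_div, inv_pow]
    field_simp
    norm_num
  rw [e]
  calc _ ≤ Real.exp 33 * Real.exp (4 * D - 4) * Real.exp (12 * l) := by gcongr
    _ = Real.exp (29 + 4 * D + 12 * l) := by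
        rw [← Real.exp_add, ← Real.exp_add]
        ring_nf
    _ ≤ _ := by
        rw [Real.exp_le_exp]
        linarith

lemma Stable.res_mem {m₀ : BlockPartition n} {I : Finset (Fin n)} (h : Stable (pw d m₀) I)
    {φ : Vec n} (hφ : φ ∈ pw d m₀) : res d I φ ∈ pw d m₀ := by
  rw [res_eq]
  exact Submodule.sub_mem _ (h.2 _ hφ) (h.locPoly_le (Submodule.starProjection_apply_mem _ _))

/-- The vectors of `S` have coordinates bounded by `lam` times their norm. -/
def HasLeverage (S : Submodule ℝ (Vec n)) (lam : ℝ) : Prop :=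
  ∀ v ∈ S, ∀ i, |v i| ≤ lam * ‖v‖

lemma IsBernsteinNoise.gap_tail [IsProbabilityMeasure μ] (hn : IsBernsteinNoise μ ξ σ c)
    (hσ : 0 < σ) {m₀ : BlockPartition n} {φ : Vec n} (hφ : φ ∈ pw d m₀) {lam : ℝ} (hl : 0 ≤ lam)
    (hlev : HasLeverage (pw d m₀) lam) (y : ℕ) {h v : ℝ} (hh : 0 < h) (hv : 0 ≤ v) :
    μ {ω | ∃ p, (p ∈ gapSet d φ y h ∧ Stable (pw d m₀) (gapBlk n y p)) ∧
      1.25 * (√h * ((1 + v / (40 * ((d : ℝ) + 1))) * dev σ c lam (40 * ((d : ℝ) + 1)))) <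
        |inner ℝ (res d (gapBlk n y p) φ) (noise ξ ω)|} ≤
      ENNReal.ofReal (Real.exp (-(5 * ((d : ℝ) + 1)) - v)) := by
  set D : ℝ := (d : ℝ) + 1 with hD
  have hD1 : 1 ≤ D := by
    have : (0 : ℝ) ≤ d := by positivity
    linarith
  -- Entropy 33 D, probability margin 5 D and the constant 1.4 fit below the level 40 D because D ≥
  -- 1.
  refine hn.chaining hσ (S := {p | p ∈ gapSet d φ y h ∧ Stable (pw d m₀) (gapBlk n y p)})
    (x := fun p => res d (gapBlk n y p) φ) (A := 33 * D) hh hl ?_ ?_ ?_ ?_ (by linarith)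
    (by linarith) hv
  · rintro p ⟨hp, _⟩
    exact hp.2.2.2.2
  · rintro p ⟨_, hp⟩ i
    exact hlev _ (hp.res_mem hφ) i
  · rintro p ⟨_, hp⟩ q ⟨_, hq⟩ i
    exact hlev _ (Submodule.sub_mem _ (hp.res_mem hφ) (hq.res_mem hφ)) i
  · intro l
    set θ : ℝ := (1 / 4) ^ l / 8 with hθ
    have hθ0 : 0 < θ := by positivity
    have hθ1 : θ ≤ 1 / 8 := by
      rw [hθ]
      have : (1 / 4 : ℝ) ^ l ≤ 1 := pow_le_one₀ (by norm_num) (by norm_num)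
      linarith
    have hτ0 : 0 < θ ^ 2 / 20 := by positivity
    have hτ1 : θ ^ 2 / 20 ≤ 1 / 1000 := by nlinarith
    obtain ⟨T, hTc, hT⟩ := exists_gap_cover (d := d) (y := y) hτ0 hτ1 hh φ
    obtain ⟨R, T', h1, h2, h3⟩ := exists_net_of_cover
      (S := {p | p ∈ gapSet d φ y h ∧ Stable (pw d m₀) (gapBlk n y p)})
      (x := fun p => res d (gapBlk n y p) φ) (gapCode d φ y h (θ ^ 2 / 20)) T
      (δ := 4.4 * √(θ ^ 2 / 20) * √h) (fun p hp => hT p hp.1)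
      (fun p hp q hq hpq => res_close_of_code hτ0 hτ1 hh hp.1 hq.1 hpq)
    refine ⟨R, T', h1, ?_, fun p hp => ⟨(h3 p hp).1, (h3 p hp).2.trans ?_⟩⟩
    · have h4 : (T'.card : ℝ) ≤ T.card := by exact_mod_cast h2
      exact (h4.trans hTc).trans (gap_card_le D hD1 l)
    · refine mul_le_mul_of_nonneg_right ?_ (Real.sqrt_nonneg _)
      rw [Real.sqrt_div (sq_nonneg _), Real.sqrt_sq hθ0.le]
      -- The closeness 4.4 √τ with τ = θ² / 20 is at most θ.
      have h5 : 4.4 ≤ √20 := Real.le_sqrt_of_sq_le (by norm_num)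
      rw [← mul_div_assoc, div_le_iff₀ (by positivity)]
      nlinarith

end

noncomputable section

variable {n d : ℕ}

/-! ### Packing and piercing of intervals -/

/-- A finite family of intervals with at least two points contains a disjoint subfamily such that
two gaps for each of its members suffice to pierce the whole family. -/
lemma exists_packing_piercing (F : Finset (ℕ × ℕ)) (hF : ∀ p ∈ F, p.1 + 2 ≤ p.2) :
    ∃ W ⊆ F, (∀ p ∈ W, ∀ q ∈ W, p ≠ q → p.2 ≤ q.1 ∨ q.2 ≤ p.1) ∧
      ∃ Y : Finset ℕ, Y.card ≤ 2 * W.card ∧ ∀ p ∈ F, ∃ y ∈ Y, p.1 < y ∧ y < p.2 := by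
  induction F using Finset.strongInduction with
  | H F ih =>
    rcases F.eq_empty_or_nonempty with rfl | hne
    · exact ⟨∅, by simp, by simp, ∅, by simp, by simp⟩
    -- Greedy choice of the smallest right end. An interval not lying to the right of it contains
    -- one of the gaps p₀.2 − 1 and p₀.2; the second is needed only for intervals starting at p₀.2 −
    -- 1.
    · obtain ⟨p₀, hp₀, hmin⟩ := F.exists_min_image (fun p => p.2) hne
      have h2 := hF p₀ hp₀
      set F' := F.filter fun p => p₀.2 ≤ p.1 with hF'
      have hss : F' ⊂ F := by
        rw [Finset.ssubset_iff_of_subset (Finset.filter_subset _ _)]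
        refine ⟨p₀, hp₀, fun h => ?_⟩
        have := (Finset.mem_filter.1 h).2
        omega
      obtain ⟨W, hW, hd, Y, hY, hp⟩ := ih F' hss fun p hp => hF p (Finset.mem_filter.1 hp).1
      have hp₀W : p₀ ∉ W := fun h => by
        have := (Finset.mem_filter.1 (hW h)).2
        omega
      refine ⟨insert p₀ W, ?_, ?_, Y ∪ {p₀.2 - 1, p₀.2}, ?_, ?_⟩
      · intro p hp
        rcases Finset.mem_insert.1 hp with rfl | h
        · exact hp₀
        · exact (Finset.mem_filter.1 (hW h)).1
      · intro p hp q hq hpq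
        rcases Finset.mem_insert.1 hp with rfl | h <;> rcases Finset.mem_insert.1 hq with rfl | h'
        · exact absurd rfl hpq
        · exact Or.inl (Finset.mem_filter.1 (hW h')).2
        · exact Or.inr (Finset.mem_filter.1 (hW h)).2
        · exact hd p h q h' hpq
      · rw [Finset.card_insert_of_notMem hp₀W]
        have := Finset.card_le_two (a := p₀.2 - 1) (b := p₀.2)
        have := Finset.card_union_le Y {p₀.2 - 1, p₀.2}
        omega
      · intro p hpF
        by_cases h : p₀.2 ≤ p.1
        · obtain ⟨y, hy, hy'⟩ := hp p (Finset.mem_filter.2 ⟨hpF, h⟩)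
          exact ⟨y, Finset.mem_union_left _ hy, hy'⟩
        · have h3 := hmin p hpF
          have h4 := hF p hpF
          by_cases h5 : p.1 < p₀.2 - 1
          · exact ⟨p₀.2 - 1, by simp, h5, by omega⟩
          · exact ⟨p₀.2, by simp, by omega, by omega⟩

/-- The approximation error of `φ` on the partition `m`. -/
def apx (d : ℕ) (m : BlockPartition n) (φ : Vec n) : Vec n := φ - (pw d m).starProjection φ

lemma apx_eq_sum (m : BlockPartition n) (φ : Vec n) :
    apx d m φ = ∑ I ∈ m.parts, res d I φ := by
  rw [apx, starProjection_pw]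
  conv_lhs => rw [← sum_restr m φ]
  rw [← Finset.sum_sub_distrib]
  refine Finset.sum_congr rfl fun I hI => ?_
  rw [res_eq, sum_restr]

lemma restr_res (I : Finset (Fin n)) (φ : Vec n) : restr I (res d I φ) = res d I φ :=
  (mem_resSp.1 (res_mem I φ)).1

lemma restr_apx {m : BlockPartition n} {I : Finset (Fin n)} (hI : I ∈ m.parts) (φ : Vec n) :
    restr I (apx d m φ) = res d I φ := by
  rw [apx_eq_sum, map_sum, Finset.sum_eq_single I]
  · exact restr_res I φ
  · intro J hJ hne
    rw [← restr_res J, restr_restr, parts_inter_eq_empty hI hJ hne.symm, restr_empty]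
  · exact fun h => absurd hI h

lemma norm_sq_apx (m : BlockPartition n) (φ : Vec n) :
    ‖apx d m φ‖ ^ 2 = ∑ I ∈ m.parts, ‖res d I φ‖ ^ 2 := by
  rw [norm_sq_eq_sum_restr m]
  exact Finset.sum_congr rfl fun I hI => by rw [restr_apx hI]

lemma norm_res_le_restr {I J : Finset (Fin n)} (h : I ⊆ J) (φ : Vec n) :
    ‖res d I φ‖ ≤ ‖restr I (res d J φ)‖ := by
  rw [← res_res h, ← res_restr subset_rfl]
  exact norm_res_le _ _

lemma sum_norm_sq_restr_le (W : Finset (ℕ × ℕ))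
    (hd : ∀ p ∈ W, ∀ q ∈ W, p ≠ q → p.2 ≤ q.1 ∨ q.2 ≤ p.1) (u : Vec n) :
    ∑ p ∈ W, ‖restr (blk n p.1 p.2) u‖ ^ 2 ≤ ‖u‖ ^ 2 := by
  simp_rw [norm_sq_restr]
  rw [← Finset.sum_biUnion, vec_norm_sq]
  · exact Finset.sum_le_sum_of_subset_of_nonneg (Finset.subset_univ _) fun i _ _ => sq_nonneg _
  · intro p hp q hq hpq
    rw [Function.onFun, Finset.disjoint_left]
    intro i h1 h2
    rw [mem_blk] at h1 h2
    rcases hd p hp q hq hpq with h | h <;> omega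

/-- The size of a disjoint family of intervals on which `φ` is far from polynomials. -/
lemma card_packing_le {W : Finset (ℕ × ℕ)}
    (hd : ∀ p ∈ W, ∀ q ∈ W, p ≠ q → p.2 ≤ q.1 ∨ q.2 ≤ p.1)
    (hW : ∀ p ∈ W, p.1 < p.2 ∧ p.2 ≤ n) {φ : Vec n} {h : ℝ} (hh : 0 < h)
    (hWh : ∀ p ∈ W, h ≤ ‖res d (blk n p.1 p.2) φ‖ ^ 2) {m : BlockPartition n}
    (hm : ∀ I ∈ m.parts, (I : Set (Fin n)).OrdConnected) :
    (W.card : ℝ) ≤ m.parts.card + ‖apx d m φ‖ ^ 2 / h := by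
  classical
  -- Members inside a block of m are counted by the energy of the approximation error, which they
  -- share disjointly. The others are assigned injectively to the block containing their last point:
  -- if two had the same block, the one further right would be included in it.
  set W1 := W.filter fun p => ∃ I ∈ m.parts, blk n p.1 p.2 ⊆ I with hW1
  set W2 := W.filter fun p => ¬ ∃ I ∈ m.parts, blk n p.1 p.2 ⊆ I with hW2
  have hc : (W.card : ℝ) = W1.card + W2.card := by
    rw [hW1, hW2, ← Finset.card_filter_add_card_filter_not (s := W)
      (fun p => ∃ I ∈ m.parts, blk n p.1 p.2 ⊆ I)]
    push_cast
    rfl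
  have h1 : (W1.card : ℝ) ≤ ‖apx d m φ‖ ^ 2 / h := by
    rw [le_div_iff₀ hh]
    have hsub : W1 ⊆ W := Finset.filter_subset _ _
    refine le_trans ?_ (sum_norm_sq_restr_le W1
      (fun p hp q hq => hd p (hsub hp) q (hsub hq)) (apx d m φ))
    rw [← nsmul_eq_mul]
    refine Finset.card_nsmul_le_sum _ _ _ fun p hp => ?_
    obtain ⟨hpW, I, hI, hpI⟩ := Finset.mem_filter.1 hp
    refine (hWh p hpW).trans (pow_le_pow_left₀ (norm_nonneg _) ?_ 2)
    have := norm_res_le_restr (d := d) hpI φ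
    rwa [← restr_apx hI, restr_restr_of_subset hpI] at this
  have h2 : W2.card ≤ m.parts.card := by
    have hex : ∀ p ∈ W2, ∃ I ∈ m.parts, ∃ hp : p.2 - 1 < n, (⟨p.2 - 1, hp⟩ : Fin n) ∈ I := by
      intro p hp
      have := hW p (Finset.mem_filter.1 hp).1
      have hlt : p.2 - 1 < n := by omega
      obtain ⟨I, ⟨hI, hi⟩, -⟩ := m.existsUnique_mem (Finset.mem_univ (⟨p.2 - 1, hlt⟩ : Fin n))
      exact ⟨I, hI, hlt, hi⟩
    choose! f hf using hex
    refine Finset.card_le_card_of_injOn f (fun p hp => (hf p hp).1) ?_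
    have key : ∀ p ∈ W2, ∀ q ∈ W2, f p = f q → p.2 ≤ q.1 → False := by
      intro p hp q hq hpq hle
      obtain ⟨hI, hp1, hp2⟩ := hf p hp
      obtain ⟨hJ, hq1, hq2⟩ := hf q hq
      have hpW := hW p (Finset.mem_filter.1 hp).1
      refine (Finset.mem_filter.1 hq).2 ⟨f q, hJ, fun i hi => ?_⟩
      rw [mem_blk] at hi
      rw [hpq] at hp2
      have := (hm _ hJ).out (by exact_mod_cast hp2) (by exact_mod_cast hq2)
      have h3 := this (a := i) ⟨by rw [Fin.le_def]; simp only; omega,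
        by rw [Fin.le_def]; simp only; omega⟩
      exact_mod_cast h3
    intro p hp q hq hpq
    by_contra hne
    rcases hd p (Finset.mem_filter.1 hp).1 q (Finset.mem_filter.1 hq).1 hne with h | h
    · exact key p hp q hq hpq h
    · exact key q hq p hp hpq.symm h
  rw [hc]
  have h2' : (W2.card : ℝ) ≤ m.parts.card := by exact_mod_cast h2
  linarith

lemma res_eq_zero_of_card_le {I : Finset (Fin n)} (hI : I.card ≤ d + 1) (φ : Vec n) :
    res d I φ = 0 := by
  classical
  set v : Fin n → ℝ := fun i => (i : ℝ) with hv
  have hinj : Set.InjOn v I := fun i _ j _ h => by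
    simp only [hv, Nat.cast_inj] at h
    exact Fin.ext h
  set p := Lagrange.interpolate I v (fun i => φ i)
  have hdeg : p.natDegree ≤ d := by
    have := Lagrange.degree_interpolate_lt (fun i => φ i) hinj
    rw [← mem_degreeLT_succ, mem_degreeLT]
    exact this.trans_le (by exact_mod_cast hI)
  have : restr I φ = restr I (polyVec n p) := by
    ext i
    by_cases hi : i ∈ I
    · simp only [restr_apply, hi, if_true, polyVec_apply]
      exact (Lagrange.eval_interpolate_at_node (fun i => φ i) hinj hi).symm
    · simp [hi]
  rw [← res_restr subset_rfl, this, res_polyVec subset_rfl hdeg]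

end

noncomputable section

variable {n d : ℕ} {Ω : Type*} [MeasurableSpace Ω] {μ : Measure Ω}
  {ξ : Fin n → Ω → ℝ} {σ c : ℝ}

/-! ### Uniform control of the linear functionals attached to partitions -/

lemma exp_neg_le_inv_pow {Y r : ℝ} (hY : 3 ≤ Y) (hr : 1 ≤ r) :
    Real.exp (-(Y * (r - 1))) ≤ (r⁻¹) ^ 3 := by
  have h1 : Real.exp (-(Y * (r - 1))) ≤ Real.exp ((3 : ℕ) * (-(r - 1))) := by
    rw [Real.exp_le_exp]
    push_cast
    nlinarith
  refine h1.trans ?_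
  rw [Real.exp_nat_mul]
  refine pow_le_pow_left₀ (Real.exp_pos _).le ?_ 3
  rw [Real.exp_neg]
  have := Real.add_one_le_exp (r - 1)
  gcongr
  linarith

/-- Integrating the chained tail beyond x gives a / Y times an exponential in x / a, where a is
twice the chaining level and Y = 40 D. Trading the exponential for (a / x)³ provides just enough
decay for summation over dyadic h. -/
lemma exists_gap_excess [IsProbabilityMeasure μ] (hn : IsBernsteinNoise μ ξ σ c)
    (hσ : 0 < σ) {m₀ : BlockPartition n} {φ : Vec n} (hφ : φ ∈ pw d m₀) {lam : ℝ} (hl : 0 ≤ lam)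
    (hlev : HasLeverage (pw d m₀) lam) (y : ℕ) {h x : ℝ} (hh : 0 < h)
    (hx : 2.5 * (√h * dev σ c lam (40 * ((d : ℝ) + 1))) ≤ x) :
    ∃ f : Ω → ℝ, Integrable f μ ∧ (∀ ω, 0 ≤ f ω) ∧
      (∀ ω, ∀ p ∈ gapSet d φ y h, Stable (pw d m₀) (gapBlk n y p) →
        2 * |inner ℝ (res d (gapBlk n y p) φ) (noise ξ ω)| - x ≤ f ω) ∧
      ∫ ω, f ω ∂μ ≤ (2.5 * (√h * dev σ c lam (40 * ((d : ℝ) + 1)))) ^ 4 / x ^ 3 /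
        (40 * ((d : ℝ) + 1)) * Real.exp (-(5 * ((d : ℝ) + 1))) := by
  classical
  set D : ℝ := (d : ℝ) + 1 with hD
  have hD1 : 1 ≤ D := by
    have : (0 : ℝ) ≤ d := by positivity
    linarith
  set Y := 40 * D with hY
  have hY0 : 0 < Y := by positivity
  have hg := dev_pos hσ hn.c_nonneg hl hY0
  set g := dev σ c lam Y
  have hsh : 0 < √h := Real.sqrt_pos.2 hh
  set a := 2.5 * (√h * g) with ha
  have ha0 : 0 < a := by positivity
  have hx0 : 0 < x := ha0.trans_le hx
  set T : Finset (ℕ × ℕ) := (Finset.range (n + 1) ×ˢ Finset.range (n + 1)).filter fun p =>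
    p ∈ gapSet d φ y h ∧ Stable (pw d m₀) (gapBlk n y p) with hT
  set F : ℕ × ℕ → Ω → NNReal := fun p ω =>
    (2 * |inner ℝ (res d (gapBlk n y p) φ) (noise ξ ω)| - x).toNNReal with hF
  have hFm : ∀ p, Measurable (F p) := fun p =>
    (((measurable_inner_noise hn.measurable _).abs.const_mul 2).sub_const x).real_toNNReal
  have hmeas : Measurable fun ω => ((T.sup fun p => F p ω : NNReal) : ℝ) := by
    have h1 : Measurable (T.sup F) :=
      Finset.sup_induction measurable_const (fun _ h _ h' => h.sup h') fun p _ => hFm p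
    have h2 : (fun ω => (T.sup fun p => F p ω)) = T.sup F := by
      ext ω
      rw [Finset.sup_apply]
    exact (h2 ▸ h1).coe_nnreal_real
  have htail : ∀ u : ℝ, 0 < u → μ.real {ω | u < ((T.sup fun p => F p ω : NNReal) : ℝ)} ≤
      (Real.exp (-(5 * D)) * Real.exp (-(Y * (x / a - 1)))) * Real.exp (-(Y / a) * u) := by
    intro u hu
    have hv : 0 ≤ Y * ((x + u) / a - 1) := by
      have : 1 ≤ (x + u) / a := by
        rw [one_le_div ha0]
        linarith
      nlinarith
    have h1 := hn.gap_tail hσ hφ hl hlev y hh hv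
    have h2 : {ω | u < ((T.sup fun p => F p ω : NNReal) : ℝ)} ⊆
        {ω | ∃ p, (p ∈ gapSet d φ y h ∧ Stable (pw d m₀) (gapBlk n y p)) ∧
      1.25 * (√h * ((1 + Y * ((x + u) / a - 1) / Y) * dev σ c lam Y)) <
        |inner ℝ (res d (gapBlk n y p) φ) (noise ξ ω)|} := by
      intro ω hω
      have h3 : u.toNNReal < T.sup fun p => F p ω := by
        rw [← NNReal.coe_lt_coe, Real.coe_toNNReal u hu.le]
        exact hω
      obtain ⟨p, hp, hlt⟩ := Finset.lt_sup_iff.1 h3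
      refine ⟨p, (Finset.mem_filter.1 hp).2, ?_⟩
      rw [hF] at hlt
      have h4 := Real.toNNReal_lt_toNNReal_iff'.1 hlt
      have h5 : 1.25 * (√h * ((1 + Y * ((x + u) / a - 1) / Y) * dev σ c lam Y)) = (x + u) / 2 := by
        have : 1.25 * (√h * ((1 + Y * ((x + u) / a - 1) / Y) * dev σ c lam Y)) =
            (a / 2) * (1 + Y * ((x + u) / a - 1) / Y) := by
          rw [ha]
          ring
        rw [this]
        field_simp
        ring
      rw [h5]
      linarith [h4.1]
    have h3 : μ.real {ω | u < ((T.sup fun p => F p ω : NNReal) : ℝ)} ≤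
        Real.exp (-(5 * D) - Y * ((x + u) / a - 1)) := by
      refine ENNReal.toReal_le_of_le_ofReal (Real.exp_pos _).le ?_
      exact (measure_mono h2).trans h1
    refine h3.trans_eq ?_
    rw [← Real.exp_add, ← Real.exp_add]
    congr 1
    field_simp
    ring
  obtain ⟨hi, hb⟩ := integral_le_of_exp_tail hmeas (fun ω => NNReal.coe_nonneg _)
    (div_pos hY0 ha0) htail
  refine ⟨_, hi, fun ω => NNReal.coe_nonneg _, ?_, hb.trans ?_⟩
  · intro ω p hp hst
    have hpT : p ∈ T := by
      rw [hT, Finset.mem_filter, Finset.mem_product, Finset.mem_range, Finset.mem_range]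
      obtain ⟨h1, h2, h3, h4, h5⟩ := id hp
      exact ⟨⟨by omega, by omega⟩, hp, hst⟩
    have h1 : F p ω ≤ T.sup fun p => F p ω := Finset.le_sup (f := fun p => F p ω) hpT
    exact (Real.le_coe_toNNReal _).trans (NNReal.coe_le_coe.2 h1)
  · have h1 := exp_neg_le_inv_pow (Y := Y) (r := x / a) (by linarith) ((one_le_div ha0).2 hx)
    rw [inv_div] at h1
    calc Real.exp (-(5 * D)) * Real.exp (-(Y * (x / a - 1))) / (Y / a) ≤
          Real.exp (-(5 * D)) * (a / x) ^ 3 / (Y / a) := by gcongr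
      _ = _ := by
        field_simp

lemma sum_half_natAbs_le (s : Finset ℤ) : ∑ k ∈ s, (1 / 2 : ℝ) ^ k.natAbs ≤ 3 := by
  have hg : Summable fun j : ℕ => (1 / 2 : ℝ) ^ j := summable_geometric_two
  rw [← Finset.sum_filter_add_sum_filter_not s (fun k => 0 ≤ k)]
  have h1 : ∑ k ∈ s.filter (fun k => 0 ≤ k), (1 / 2 : ℝ) ^ k.natAbs ≤ 2 := by
    rw [← Finset.sum_image (f := fun j : ℕ => (1 / 2 : ℝ) ^ j) (g := Int.natAbs)]
    · exact (hg.sum_le_tsum _ fun _ _ => by positivity).trans_eq tsum_geometric_two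
    · intro a ha b hb hab
      have := (Finset.mem_filter.1 ha).2
      have := (Finset.mem_filter.1 hb).2
      omega
  have h2 : ∑ k ∈ s.filter (fun k => ¬ 0 ≤ k), (1 / 2 : ℝ) ^ k.natAbs ≤ 1 := by
    have : ∀ k ∈ s.filter (fun k => ¬ 0 ≤ k), (1 / 2 : ℝ) ^ k.natAbs =
        (1 / 2) * (1 / 2) ^ (k.natAbs - 1) := by
      intro k hk
      have := (Finset.mem_filter.1 hk).2
      rw [← pow_succ']
      congr 1
      omega
    rw [Finset.sum_congr rfl this, ← Finset.mul_sum,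
      ← Finset.sum_image (f := fun j : ℕ => (1 / 2 : ℝ) ^ j) (g := fun k : ℤ => k.natAbs - 1)]
    · have := hg.sum_le_tsum
        ((s.filter (fun k => ¬ 0 ≤ k)).image fun k : ℤ => k.natAbs - 1) fun _ _ => by positivity
      rw [tsum_geometric_two] at this
      linarith
    · intro a ha b hb hab
      have := (Finset.mem_filter.1 ha).2
      have := (Finset.mem_filter.1 hb).2
      simp only at hab
      omega
  linarith

/-- These two profiles appear at level h proportional to q = 2^k: the first multiplies the number of
blocks, the second the approximation error. Both decay geometrically on either side of k = 0. -/
lemma min_bound_aux {q : ℝ} (hq : 0 < q) {k : ℤ} (hk : q = 2 ^ k) :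
    q ^ 2 / (1 + q) ^ 3 ≤ (1 / 2) ^ k.natAbs ∧ q / (1 + q) ^ 3 ≤ (1 / 2) ^ k.natAbs := by
  have h1 : 1 ≤ (1 + q) ^ 3 := one_le_pow₀ (by linarith)
  rcases le_total 0 k with h | h
  · have e : ((1 : ℝ) / 2) ^ k.natAbs = 1 / q := by
      rw [hk, ← zpow_natCast, Int.natAbs_of_nonneg h, one_div, inv_zpow, one_div]
    rw [e]
    constructor <;> rw [div_le_div_iff₀ (by positivity) hq] <;> nlinarith [pow_pos hq 2, pow_pos hq 3]
  · have e : ((1 : ℝ) / 2) ^ k.natAbs = q := by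
      rw [hk, ← zpow_natCast, Int.ofNat_natAbs_of_nonpos h, one_div, inv_zpow, zpow_neg, inv_inv]
    rw [e]
    constructor <;> rw [div_le_iff₀ (by positivity)] <;> nlinarith [pow_pos hq 2, pow_pos hq 3, pow_pos hq 4]

/-- The conclusion of both regimes: an integrable envelope of the penalized linear functionals. -/
def HasEnvelope (μ : Measure Ω) (ξ : Fin n → Ω → ℝ) (d : ℕ) (m₀ : BlockPartition n) (φ : Vec n)
    (α B : ℝ) : Prop :=
  ∃ W : Ω → ℝ, Integrable W μ ∧
    (∀ m : BlockPartition n, (∀ I ∈ m.parts, Stable (pw d m₀) I) → ∀ ω,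
      ∑ I ∈ m.parts, (2 * |inner ℝ (res d I φ) (noise ξ ω)| - α * ‖res d I φ‖ ^ 2 - B) ≤ W ω) ∧
    ∀ m : BlockPartition n, (∀ I ∈ m.parts, Stable (pw d m₀) I) →
      ∫ ω, W ω ∂μ ≤ 0.03 * (B * m.parts.card + α * ‖apx d m φ‖ ^ 2)

lemma exists_level_set {b : ℝ} (hb : 0 < b) (φ : Vec n) : ∃ K : Finset ℤ, ∀ I : Finset (Fin n),
    res d I φ ≠ 0 → ∃ k ∈ K, b * 2 ^ k / 2 < ‖res d I φ‖ ^ 2 ∧ ‖res d I φ‖ ^ 2 ≤ b * 2 ^ k := by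
  classical
  have hex : ∀ I : Finset (Fin n), res d I φ ≠ 0 →
      ∃ k : ℤ, b * 2 ^ k / 2 < ‖res d I φ‖ ^ 2 ∧ ‖res d I φ‖ ^ 2 ≤ b * 2 ^ k := by
    intro I hI
    have hpos : 0 < ‖res d I φ‖ ^ 2 / b := by
      have := norm_pos_iff.2 hI
      positivity
    obtain ⟨j, h1, h2⟩ := exists_mem_Ioc_zpow hpos (by norm_num : (1 : ℝ) < 2)
    refine ⟨j + 1, ?_, ?_⟩
    · rw [lt_div_iff₀ hb] at h1
      rw [zpow_add_one₀ (by norm_num)]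
      linarith
    · rw [div_le_iff₀ hb] at h2
      linarith
  choose! f hf using hex
  exact ⟨Finset.univ.image f, fun I hI => ⟨f I, Finset.mem_image_of_mem f (Finset.mem_univ I), hf I hI⟩⟩

/-- Each block with nonzero residual is charged to its dyadic level and to a gap inside it that
pierces that level. The gaps are chosen once, independently of m, while their number is bounded
through every m; so a single envelope serves all partitions. -/
lemma hasEnvelope_of_gap [IsProbabilityMeasure μ] (hn : IsBernsteinNoise μ ξ σ c)
    (hσ : 0 < σ) {m₀ : BlockPartition n} {φ : Vec n} (hφ : φ ∈ pw d m₀) {lam : ℝ} (hl : 0 ≤ lam)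
    (hlev : HasLeverage (pw d m₀) lam) {α B : ℝ} (hα : 0 < α) (hB : 0 < B)
    (hg : (1.25 * dev σ c lam (40 * ((d : ℝ) + 1))) ^ 2 ≤ α * B / 2) :
    HasEnvelope μ ξ d m₀ φ α B := by
  classical
  set D : ℝ := (d : ℝ) + 1 with hD
  have hD1 : 1 ≤ D := by
    have : (0 : ℝ) ≤ d := by positivity
    linarith
  set g := dev σ c lam (40 * D)
  have hg0 : 0 ≤ g := dev_nonneg hn.c_nonneg hl (by positivity)
  -- With h = b 2^k and q = 2^k, the discount available to a block at level h, α h / 2 + B, becomes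
  -- B (1 + q).
  set b : ℝ := 2 * B / α with hb
  have hb0 : 0 < b := by positivity
  have hbα : α * b = 2 * B := by rw [hb]; field_simp
  obtain ⟨K, hK⟩ := exists_level_set (d := d) hb0 φ
  have hh : ∀ k : ℤ, 0 < b * 2 ^ k := fun k => by positivity
  set F : ℤ → Finset (ℕ × ℕ) := fun k => (Finset.range (n + 1) ×ˢ Finset.range (n + 1)).filter
    fun p => p.1 + 2 ≤ p.2 ∧ b * 2 ^ k / 2 < ‖res d (blk n p.1 p.2) φ‖ ^ 2 with hF
  have hpack : ∀ k : ℤ, ∃ Y : Finset ℕ, (∀ m : BlockPartition n,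
      (∀ I ∈ m.parts, (I : Set (Fin n)).OrdConnected) →
      (Y.card : ℝ) ≤ 2 * (m.parts.card + ‖apx d m φ‖ ^ 2 / (b * 2 ^ k / 2))) ∧
      ∀ p ∈ F k, ∃ y ∈ Y, p.1 < y ∧ y < p.2 := by
    intro k
    obtain ⟨W, hWF, hd, Y, hY, hp⟩ := exists_packing_piercing (F k)
      fun p hp => (Finset.mem_filter.1 hp).2.1
    refine ⟨Y, fun m hm => ?_, hp⟩
    have h1 : (Y.card : ℝ) ≤ 2 * W.card := by exact_mod_cast hY
    refine h1.trans (mul_le_mul_of_nonneg_left ?_ (by norm_num))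
    have := hh k
    refine card_packing_le hd (fun p hp => ?_) (by positivity) (fun p hp => ?_) hm
    · obtain ⟨h2, h3, h4⟩ := Finset.mem_filter.1 (hWF hp)
      rw [Finset.mem_product, Finset.mem_range, Finset.mem_range] at h2
      omega
    · exact (Finset.mem_filter.1 (hWF hp)).2.2.le
  choose Y hYc hYp using hpack
  have hxa : ∀ k : ℤ, 2.5 * (√(b * 2 ^ k) * g) ≤ α * (b * 2 ^ k / 2) + B := by
    intro k
    refine abs_le_of_sq_le_sq' ?_ (by have := hh k; positivity) |>.2
    rw [mul_pow, mul_pow, Real.sq_sqrt (hh k).le]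
    have h1 : 2.5 ^ 2 * (b * 2 ^ k * g ^ 2) ≤ 4 * (b * 2 ^ k) * (α * B / 2) := by
      have := mul_le_mul_of_nonneg_left hg (by have := hh k; positivity : 0 ≤ 4 * (b * 2 ^ k))
      nlinarith
    refine h1.trans ?_
    nlinarith [sq_nonneg (α * (b * 2 ^ k / 2) - B)]
  choose f hfi hf0 hfp hfE using fun k y =>
    exists_gap_excess hn hσ hφ hl hlev y (hh k) (hxa k)
  refine ⟨fun ω => ∑ k ∈ K, ∑ y ∈ Y k, f k y ω, ?_, ?_, ?_⟩
  · exact integrable_finsetSum _ fun k _ => integrable_finsetSum _ fun y _ => hfi k y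
  · intro m hm ω
    set P := m.parts.filter fun I => res d I φ ≠ 0 with hP
    have hex : ∀ I ∈ P, ∃ ky : Σ _ : ℤ, ℕ, ky ∈ K.sigma Y ∧
        (∃ i ∈ I, ∃ j ∈ I, (i : ℕ) + 1 = ky.2 ∧ (j : ℕ) = ky.2) ∧
        2 * |inner ℝ (res d I φ) (noise ξ ω)| - α * ‖res d I φ‖ ^ 2 - B ≤ f ky.1 ky.2 ω := by
      intro I hI
      obtain ⟨hIm, hI0⟩ := Finset.mem_filter.1 hI
      obtain ⟨k, hk, hk1, hk2⟩ := hK I hI0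
      obtain ⟨l, r, hlr, hr, hIe⟩ := exists_eq_blk (m.nonempty_of_mem_parts hIm) (hm I hIm).1
      have hcard : l + 2 ≤ r := by
        by_contra hcon
        refine hI0 (res_eq_zero_of_card_le ?_ φ)
        rw [hIe, card_blk hr]
        omega
      have hpF : (l, r) ∈ F k := by
        rw [hF, Finset.mem_filter, Finset.mem_product, Finset.mem_range, Finset.mem_range]
        exact ⟨⟨by simp only; omega, by simp only; omega⟩, hcard, hIe ▸ hk1⟩
      obtain ⟨y, hy, hy1, hy2⟩ := hYp k _ hpF
      simp only at hy1 hy2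
      have hgap : gapBlk n y (y - l, r - y) = I := by
        rw [gapBlk_eq, hIe]
        congr 1 <;> simp only <;> omega
      refine ⟨⟨k, y⟩, Finset.mem_sigma.2 ⟨hk, hy⟩, ?_, ?_⟩
      · refine ⟨⟨y - 1, by omega⟩, ?_, ⟨y, by omega⟩, ?_, ?_, rfl⟩
        · rw [hIe, mem_blk]
          simp only
          omega
        · rw [hIe, mem_blk]
          simp only
          omega
        · simp only
          omega
      · have h1 := hfp k y ω (y - l, r - y) ⟨by simp only; omega, by simp only; omega,
          by simp only; omega, by simp only; omega, by rw [hgap]; exact hk2⟩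
          (by rw [hgap]; exact hm I hIm)
        rw [hgap] at h1
        have h2 : α * (b * 2 ^ k / 2) ≤ α * ‖res d I φ‖ ^ 2 :=
          mul_le_mul_of_nonneg_left hk1.le hα.le
        linarith
    choose! κ hκ1 hκ2 hκ3 using hex
    -- The gap attached to a block lies inside it, so disjoint blocks receive different gaps.
    have hinj : Set.InjOn κ P := by
      intro I hI J hJ hIJ
      by_contra hne
      obtain ⟨_, _, j, hj, _, hj2⟩ := hκ2 I hI
      obtain ⟨_, _, j', hj', _, hj2'⟩ := hκ2 J hJ
      rw [hIJ] at hj2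
      have hjj : j = j' := Fin.ext (hj2.trans hj2'.symm)
      have h1 := parts_inter_eq_empty (Finset.mem_filter.1 hI).1 (Finset.mem_filter.1 hJ).1 hne
      have h2 : j ∈ I ∩ J := Finset.mem_inter.2 ⟨hj, hjj ▸ hj'⟩
      rw [h1] at h2
      simp at h2
    rw [← Finset.sum_filter_add_sum_filter_not m.parts (fun I => res d I φ ≠ 0), ← hP]
    have h1 : ∑ I ∈ m.parts.filter (fun I => ¬ res d I φ ≠ 0),
        (2 * |inner ℝ (res d I φ) (noise ξ ω)| - α * ‖res d I φ‖ ^ 2 - B) ≤ 0 := by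
      refine Finset.sum_nonpos fun I hI => ?_
      have h0 := not_not.1 (Finset.mem_filter.1 hI).2
      rw [h0]
      simp only [inner_zero_left, abs_zero, norm_zero]
      linarith
    have h2 : ∑ I ∈ P, (2 * |inner ℝ (res d I φ) (noise ξ ω)| - α * ‖res d I φ‖ ^ 2 - B) ≤
        ∑ k ∈ K, ∑ y ∈ Y k, f k y ω := by
      rw [← Finset.sum_sigma (f := fun ky : Σ _ : ℤ, ℕ => f ky.1 ky.2 ω)]
      refine (Finset.sum_le_sum fun I hI => hκ3 I hI).trans ?_
      rw [← Finset.sum_image (f := fun ky : Σ _ : ℤ, ℕ => f ky.1 ky.2 ω) hinj]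
      refine Finset.sum_le_sum_of_subset_of_nonneg ?_ fun ky _ _ => hf0 _ _ _
      intro ky hky
      obtain ⟨I, hI, rfl⟩ := Finset.mem_image.1 hky
      exact hκ1 I hI
    linarith
  · intro m hm
    have hmc : ∀ I ∈ m.parts, (I : Set (Fin n)).OrdConnected := fun I hI => (hm I hI).1
    set G := B * m.parts.card + α * ‖apx d m φ‖ ^ 2 with hG
    have hGpos : 0 ≤ G := by positivity
    rw [integral_finsetSum _ fun k _ => integrable_finsetSum _ fun y _ => hfi k y]
    have hk : ∀ k ∈ K, ∫ ω, ∑ y ∈ Y k, f k y ω ∂μ ≤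
        (32 * G / (40 * D) * Real.exp (-(5 * D))) * (1 / 2) ^ k.natAbs := by
      intro k _
      rw [integral_finsetSum _ fun y _ => hfi k y]
      obtain ⟨q, hq⟩ : ∃ q : ℝ, q = 2 ^ k := ⟨_, rfl⟩
      have hq0 : 0 < q := by rw [hq]; positivity
      refine (Finset.sum_le_card_nsmul _ _ _ fun y _ => hfE k y).trans ?_
      rw [nsmul_eq_mul]
      have e1 : (2.5 * (√(b * 2 ^ k) * g)) ^ 4 ≤ 16 * B ^ 4 * q ^ 2 := by
        have h1 : (2.5 * (√(b * 2 ^ k) * g)) ^ 2 ≤ 4 * B ^ 2 * q := by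
          rw [mul_pow, mul_pow, Real.sq_sqrt (hh k).le, ← hq]
          have h2 := mul_le_mul_of_nonneg_left hg (by positivity : 0 ≤ 4 * (b * q))
          have h3 : 4 * (b * q) * (α * B / 2) = 4 * B ^ 2 * q := by
            rw [show 4 * (b * q) * (α * B / 2) = 2 * q * B * (α * b) by ring, hbα]
            ring
          nlinarith
        calc (2.5 * (√(b * 2 ^ k) * g)) ^ 4 = ((2.5 * (√(b * 2 ^ k) * g)) ^ 2) ^ 2 := by ring
          _ ≤ (4 * B ^ 2 * q) ^ 2 := pow_le_pow_left₀ (by positivity) h1 2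
          _ = _ := by ring
      have e2 : α * (b * 2 ^ k / 2) + B = B * (1 + q) := by
        rw [← hq, show α * (b * q / 2) = (α * b) * q / 2 by ring, hbα]
        ring
      have e3 : ‖apx d m φ‖ ^ 2 / (b * 2 ^ k / 2) = α * ‖apx d m φ‖ ^ 2 / (B * q) := by
        rw [← hq, hb]
        field_simp
      have hc := hYc k m hmc
      rw [e3] at hc
      rw [e2]
      obtain ⟨hm1, hm2⟩ := min_bound_aux hq0 hq
      set R := ‖apx d m φ‖ ^ 2
      set N : ℝ := (m.parts.card : ℝ)
      calc ((Y k).card : ℝ) * ((2.5 * (√(b * 2 ^ k) * g)) ^ 4 / (B * (1 + q)) ^ 3 / (40 * D) *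
              Real.exp (-(5 * D))) ≤
            (2 * (N + α * R / (B * q))) * (16 * B ^ 4 * q ^ 2 / (B * (1 + q)) ^ 3 / (40 * D) *
              Real.exp (-(5 * D))) := by gcongr
        _ = (32 / (40 * D) * Real.exp (-(5 * D))) *
            (B * N * (q ^ 2 / (1 + q) ^ 3) + α * R * (q / (1 + q) ^ 3)) := by
            field_simp
            ring
        _ ≤ (32 / (40 * D) * Real.exp (-(5 * D))) *
            (B * N * (1 / 2) ^ k.natAbs + α * R * (1 / 2) ^ k.natAbs) := by gcongr
        _ = _ := by
            rw [hG]
            ring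
    refine (Finset.sum_le_sum hk).trans ?_
    rw [← Finset.mul_sum]
    have h3 := sum_half_natAbs_le K
    have h5 : Real.exp (-(5 * D)) ≤ 1 / 100 := by
      have : Real.exp (-(5 * D)) ≤ Real.exp (-5) := by
        rw [Real.exp_le_exp]
        linarith
      refine this.trans ?_
      rw [Real.exp_neg, inv_le_comm₀ (Real.exp_pos _) (by norm_num),
        show (5 : ℝ) = (5 : ℕ) * 1 by norm_num, Real.exp_nat_mul]
      calc (1 / 100 : ℝ)⁻¹ ≤ 2.7 ^ 5 := by norm_num
        _ ≤ _ := by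
          have := Real.exp_one_gt_d9
          gcongr
          linarith
    calc (32 * G / (40 * D) * Real.exp (-(5 * D))) * ∑ k ∈ K, (1 / 2 : ℝ) ^ k.natAbs ≤
          (32 * G / (40 * 1) * (1 / 100)) * 3 := by gcongr
      _ = 0.024 * G := by ring
      _ ≤ 0.03 * G := by gcongr; norm_num

end

noncomputable section

variable {n d : ℕ} {Ω : Type*} [MeasurableSpace Ω] {μ : Measure Ω}
  {ξ : Fin n → Ω → ℝ} {σ c : ℝ}

/-! ### Numerical bounds in terms of the penalty factor -/

/-- The bound on the coordinates of the unit vectors of the reference model. -/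
def lev (n d : ℕ) (a : ℝ) : ℝ := √((d : ℝ) + 1) / (a * Real.log n)

lemma log_pos_of_two_le (hn : 2 ≤ n) : 0.69 < Real.log n := by
  have h1 := Real.log_two_gt_d9
  have h2 : Real.log 2 ≤ Real.log n := Real.log_le_log (by norm_num) (by exact_mod_cast hn)
  linarith

lemma lev_pos (hn : 2 ≤ n) {a : ℝ} (ha : 0 < a) : 0 < lev n d a := by
  have := log_pos_of_two_le hn
  have : 0 < Real.log n := by linarith
  unfold lev
  positivity

lemma penFactor_eq (a b : ℝ) : penFactor d a b σ c =
    324 * σ ^ 2 + 72 * √2 * (c * (σ + c) * ((d : ℝ) + 1) / a) * (b + 2) := by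
  unfold penFactor kappa
  ring

lemma penFactor_ge {a b : ℝ} (hσ : 0 ≤ σ) (hc : 0 ≤ c) (ha : 0 < a) (hb : 0 < b) :
    324 * σ ^ 2 + 203.6 * (c * (σ + c) * ((d : ℝ) + 1) / a) ≤ penFactor d a b σ c := by
  rw [penFactor_eq]
  have h2 : 1.4142 ≤ √2 := Real.le_sqrt_of_sq_le (by norm_num)
  set x := c * (σ + c) * ((d : ℝ) + 1) / a
  have hx : 0 ≤ x := by positivity
  have h3 : 203.6 ≤ 72 * √2 * (b + 2) := by nlinarith
  nlinarith

lemma penFactor_pos {a b : ℝ} (hσ : 0 < σ) (hc : 0 ≤ c) (ha : 0 < a) (hb : 0 < b) :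
    0 < penFactor d a b σ c := by
  refine lt_of_lt_of_le ?_ (penFactor_ge hσ.le hc ha hb)
  positivity

/-- Weighted Cauchy–Schwarz. It splits Q between the σ² part and the c part of the deviations. -/
lemma add_sq_le_aux {A B p q x y Q : ℝ} (hp : 0 ≤ p) (hq : 0 ≤ q)
    (hx : 0 ≤ x) (hy : 0 ≤ y) (h1 : A ^ 2 ≤ p * x) (h2 : B ^ 2 ≤ q * y) (h3 : p + q ≤ Q) :
    (A + B) ^ 2 ≤ Q * (x + y) := by
  have h4 : 2 * (A * B) ≤ p * y + q * x := by
    refine (abs_le_of_sq_le_sq' ?_ (by positivity)).2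
    have : (2 * (A * B)) ^ 2 ≤ 4 * ((p * x) * (q * y)) := by
      rw [show (2 * (A * B)) ^ 2 = 4 * (A ^ 2 * B ^ 2) by ring]
      gcongr
    nlinarith [sq_nonneg (p * y - q * x)]
  have h5 : (p + q) * (x + y) ≤ Q * (x + y) := by gcongr
  nlinarith

/-- The squared coordinate bound contains 1 / (a log n)²; since a log n ≥ 1, one factor may be
dropped, leaving the 1 / a present in Q. -/
lemma noise_scale_aux {a b : ℝ} (hσ : 0 ≤ σ) (hc : 0 ≤ c) (ha : 0 < a) (hb : 0 < b)
    (hn : 2 ≤ n) (haL : 1 ≤ a * Real.log n) :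
    324 * σ ^ 2 + 203.6 * (c ^ 2 * ((d : ℝ) + 1) / a) ≤ penFactor d a b σ c ∧
      (c * lev n d a) ^ 2 ≤ (203.6 * (c ^ 2 * ((d : ℝ) + 1) / a)) * (1 / (203.6 * Real.log n)) := by
  have hL := log_pos_of_two_le hn
  have hL0 : 0 < Real.log n := by linarith
  constructor
  · refine le_trans ?_ (penFactor_ge hσ hc ha hb)
    gcongr
    nlinarith
  · rw [lev, mul_pow, div_pow, Real.sq_sqrt (by positivity)]
    have : (203.6 * (c ^ 2 * ((d : ℝ) + 1) / a)) * (1 / (203.6 * Real.log n)) =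
        c ^ 2 * (((d : ℝ) + 1) / (a * Real.log n)) := by
      field_simp
    rw [this]
    gcongr
    nlinarith

lemma dev_sq_le {a b : ℝ} (hσ : 0 ≤ σ) (hc : 0 ≤ c) (ha : 0 < a) (hb : 0 < b)
    (hn : 2 ≤ n) (haL : 1 ≤ a * Real.log n) {y : ℝ} (hy : 0 ≤ y) :
    dev σ c (lev n d a) y ^ 2 ≤
      penFactor d a b σ c * (y / 162 + y ^ 2 * (1 / (203.6 * Real.log n))) := by
  have hL := log_pos_of_two_le hn
  have hL0 : 0 < Real.log n := by linarith
  obtain ⟨h1, h2⟩ := noise_scale_aux (d := d) (b := b) hσ hc ha hb hn haL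
  refine add_sq_le_aux (p := 324 * σ ^ 2) (by positivity) (by positivity) (by positivity)
    (by positivity) ?_ ?_ h1
  · rw [Real.sq_sqrt (by positivity)]
    linarith
  · rw [mul_pow _ y]
    nlinarith [mul_le_mul_of_nonneg_left h2 (sq_nonneg y)]

lemma noise_scale_sq_le {a b : ℝ} (hσ : 0 ≤ σ) (hc : 0 ≤ c) (ha : 0 < a) (hb : 0 < b)
    (hn : 2 ≤ n) (haL : 1 ≤ a * Real.log n) :
    (σ + c * lev n d a) ^ 2 ≤ 0.0103 * penFactor d a b σ c := by
  have hL := log_pos_of_two_le hn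
  have hL0 : 0 < Real.log n := by linarith
  obtain ⟨h1, h2⟩ := noise_scale_aux (d := d) (b := b) hσ hc ha hb hn haL
  refine (add_sq_le_aux (p := 324 * σ ^ 2) (x := 1 / 324) (by positivity) (by positivity)
    (by positivity) (by positivity) (by linarith) h2 h1).trans ?_
  have hQ : 0 ≤ penFactor d a b σ c := le_trans (by positivity) h1
  rw [mul_comm]
  gcongr
  have : 1 / (203.6 * Real.log n) ≤ 1 / (203.6 * 0.69) := by gcongr
  norm_num at this ⊢
  linarith

/-! ### The envelope when the degree is large -/

/-- After scaling ‖t‖ to q by α‖t‖² = B q², the threshold is at least (1 + q²) / (2q) times the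
deviation at level y. This ratio is at least 1 and grows with q for q ≥ 1, which offsets the factor
q produced by integrating the tail. -/
lemma envelope_term [IsProbabilityMeasure μ] (hn : IsBernsteinNoise μ ξ σ c)
    (hσ : 0 < σ) {S : Submodule ℝ (Vec n)} {lam : ℝ} (hl : 0 ≤ lam) (hlev : HasLeverage S lam)
    {α B y : ℝ} (hα : 0 < α) (hB : 0 < B) (hy : 2 ≤ y) (hg : dev σ c lam y ^ 2 ≤ α * B)
    {t : Vec n} (ht : t ∈ S) :
    Integrable (fun ω => max 0 (2 * |inner ℝ t (noise ξ ω)| - α * ‖t‖ ^ 2 - B)) μ ∧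
      ∫ ω, max 0 (2 * |inner ℝ t (noise ξ ω)| - α * ‖t‖ ^ 2 - B) ∂μ ≤
        8 * B / y * Real.exp (-y) := by
  rcases eq_or_ne t 0 with rfl | h0
  · have : ∀ ω, max 0 (2 * |inner ℝ (0 : Vec n) (noise ξ ω)| - α * ‖(0 : Vec n)‖ ^ 2 - B) = 0 := by
      intro ω
      rw [max_eq_left]
      simp only [inner_zero_left, abs_zero, norm_zero]
      linarith
    simp_rw [this]
    refine ⟨integrable_const _, ?_⟩
    rw [integral_zero]
    positivity
  have hc := hn.c_nonneg
  have hh : 0 < ‖t‖ := norm_pos_iff.2 h0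
  set h := ‖t‖
  obtain ⟨q, hq⟩ : ∃ q, q = h * √(α / B) := ⟨_, rfl⟩
  have hq0 : 0 < q := by rw [hq]; positivity
  have hq2 : α * h ^ 2 = B * q ^ 2 := by
    rw [hq, mul_pow, Real.sq_sqrt (by positivity)]
    field_simp
  have hgq : h * dev σ c lam y ≤ q * B := by
    refine (abs_le_of_sq_le_sq' ?_ (by positivity)).2
    calc (h * dev σ c lam y) ^ 2 = h ^ 2 * dev σ c lam y ^ 2 := by ring
      _ ≤ h ^ 2 * (α * B) := by gcongr
      _ = (α * h ^ 2) * B := by ring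
      _ = _ := by rw [hq2]; ring
  have hs : 1 ≤ (1 + q ^ 2) / (2 * q) := by
    rw [one_le_div (by positivity)]
    nlinarith [sq_nonneg (q - 1)]
  have htail : ∀ x : ℝ, 0 < x →
      μ.real {ω | x < max 0 (2 * |inner ℝ t (noise ξ ω)| - α * h ^ 2 - B)} ≤
      (2 * Real.exp (-(y * ((1 + q ^ 2) / (2 * q))))) * Real.exp (-(y / (2 * q * B)) * x) := by
    intro x hx
    have hr : 1 ≤ (1 + q ^ 2) / (2 * q) + x / (2 * q * B) := by
      have : 0 < x / (2 * q * B) := by positivity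
      linarith
    have h1 := hn.tail_abs t hσ hh le_rfl hl (hlev t ht)
      (y := ((1 + q ^ 2) / (2 * q) + x / (2 * q * B)) * y) (by positivity)
    have h2 : {ω | x < max 0 (2 * |inner ℝ t (noise ξ ω)| - α * h ^ 2 - B)} ⊆
        {ω | h * dev σ c lam (((1 + q ^ 2) / (2 * q) + x / (2 * q * B)) * y) ≤
          |inner ℝ t (noise ξ ω)|} := by
      intro ω hω
      rw [Set.mem_ofPred_eq] at hω ⊢
      have h3 := (lt_max_iff.1 hω).resolve_left (not_lt.2 hx.le)
      calc h * dev σ c lam (((1 + q ^ 2) / (2 * q) + x / (2 * q * B)) * y) ≤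
            h * (((1 + q ^ 2) / (2 * q) + x / (2 * q * B)) * dev σ c lam y) :=
            mul_le_mul_of_nonneg_left (dev_le_mul hr) hh.le
        _ = ((1 + q ^ 2) / (2 * q) + x / (2 * q * B)) * (h * dev σ c lam y) := by ring
        _ ≤ ((1 + q ^ 2) / (2 * q) + x / (2 * q * B)) * (q * B) := by gcongr
        _ = (B + B * q ^ 2 + x) / 2 := by field_simp
        _ ≤ _ := by linarith
    refine ((measureReal_mono h2).trans h1).trans_eq ?_
    rw [mul_assoc 2 (Real.exp _), ← Real.exp_add]
    congr 2
    ring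
  obtain ⟨hi, hb⟩ := integral_le_of_exp_tail
    (measurable_const.max ((((measurable_inner_noise hn.measurable t).abs.const_mul 2).sub_const
      _).sub_const _)) (fun ω => le_max_left _ _) (by positivity) htail
  refine ⟨hi, hb.trans ?_⟩
  have hkey : q * Real.exp (-(y * ((1 + q ^ 2) / (2 * q)))) ≤ 2 * Real.exp (-y) := by
    rcases le_total q 2 with h2 | h2
    · gcongr
      nlinarith
    · have h3 : q / 2 ≤ (1 + q ^ 2) / (2 * q) := by
        rw [le_div_iff₀ (by positivity)]
        nlinarith
      have h4 : -(y * ((1 + q ^ 2) / (2 * q))) ≤ -y + -(q - 2) := by nlinarith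
      have h5 : q * Real.exp (-(q - 2)) ≤ 2 := by
        rw [Real.exp_neg, ← div_eq_mul_inv, div_le_iff₀ (Real.exp_pos _)]
        have := Real.add_one_le_exp (q - 2)
        linarith
      calc q * Real.exp (-(y * ((1 + q ^ 2) / (2 * q)))) ≤ q * Real.exp (-y + -(q - 2)) := by gcongr
        _ = (q * Real.exp (-(q - 2))) * Real.exp (-y) := by rw [Real.exp_add]; ring
        _ ≤ _ := by gcongr
  calc 2 * Real.exp (-(y * ((1 + q ^ 2) / (2 * q)))) / (y / (2 * q * B)) =
        4 * B / y * (q * Real.exp (-(y * ((1 + q ^ 2) / (2 * q))))) := by field_simp; ring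
    _ ≤ 4 * B / y * (2 * Real.exp (-y)) := by gcongr
    _ = _ := by ring

open Classical in
/-- The nonempty intervals compatible with `S`. -/
def stableSets (S : Submodule ℝ (Vec n)) : Finset (Finset (Fin n)) :=
  Finset.univ.filter fun I => I.Nonempty ∧ Stable S I

lemma mem_stableSets {S : Submodule ℝ (Vec n)} {I : Finset (Fin n)} :
    I ∈ stableSets S ↔ I.Nonempty ∧ Stable S I := by
  simp [stableSets]

lemma card_stableSets_le (S : Submodule ℝ (Vec n)) : (stableSets S).card ≤ n ^ 2 := by
  classical
  have hsub : stableSets S ⊆ (Finset.range n ×ˢ Finset.range n).image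
      fun p => blk n p.1 (p.2 + 1) := by
    intro I hI
    obtain ⟨h1, h2⟩ := mem_stableSets.1 hI
    obtain ⟨l, r, hlr, hr, rfl⟩ := exists_eq_blk h1 h2.1
    refine Finset.mem_image.2 ⟨(l, r - 1), ?_, ?_⟩
    · rw [Finset.mem_product, Finset.mem_range, Finset.mem_range]
      exact ⟨by simp only; omega, by simp only; omega⟩
    · congr 1
      simp only
      omega
  refine (Finset.card_le_card hsub).trans (Finset.card_image_le.trans_eq ?_)
  rw [Finset.card_product, Finset.card_range, sq]

lemma one_le_card_parts (hn : 2 ≤ n) (m : BlockPartition n) : 1 ≤ (m.parts.card : ℝ) := by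
  have : m.parts.Nonempty := by
    rw [Finset.nonempty_iff_ne_empty]
    intro h
    have h5 := m.sup_parts
    rw [h, Finset.sup_empty] at h5
    have : (⟨0, by omega⟩ : Fin n) ∈ (⊥ : Finset (Fin n)) := by
      rw [h5]
      exact Finset.mem_univ _
    simp at this
  exact_mod_cast this.card_pos

/-- Plain union bound: at level 2 log n + 4 the tail factor exp(−y) times the at most n² stable
intervals is exp(−4). The result is charged to B alone, each partition having at least one block. -/
lemma hasEnvelope_of_dev [IsProbabilityMeasure μ] (hn : IsBernsteinNoise μ ξ σ c)
    (hσ : 0 < σ) (hn2 : 2 ≤ n) {m₀ : BlockPartition n} {φ : Vec n} (hφ : φ ∈ pw d m₀) {lam : ℝ}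
    (hl : 0 ≤ lam) (hlev : HasLeverage (pw d m₀) lam) {α B : ℝ} (hα : 0 < α) (hB : 0 < B)
    (hg : dev σ c lam (2 * Real.log n + 4) ^ 2 ≤ α * B) :
    HasEnvelope μ ξ d m₀ φ α B := by
  have hL := log_pos_of_two_le hn2
  have hL0 : 0 < Real.log n := by linarith
  set y := 2 * Real.log n + 4 with hy
  have ht := fun (I : Finset (Fin n)) (hI : I ∈ stableSets (pw d m₀)) =>
    envelope_term hn hσ hl hlev hα hB (by linarith : 2 ≤ y) hg
      ((mem_stableSets.1 hI).2.res_mem hφ)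
  refine ⟨fun ω => ∑ I ∈ stableSets (pw d m₀),
    max 0 (2 * |inner ℝ (res d I φ) (noise ξ ω)| - α * ‖res d I φ‖ ^ 2 - B),
    integrable_finsetSum _ fun I hI => (ht I hI).1, fun m hm ω => ?_, fun m _ => ?_⟩
  · refine (Finset.sum_le_sum fun I _ => le_max_right 0 _).trans ?_
    refine Finset.sum_le_sum_of_subset_of_nonneg (fun I hI => ?_) fun _ _ _ => le_max_left _ _
    exact mem_stableSets.2 ⟨m.nonempty_of_mem_parts hI, hm I hI⟩
  · rw [integral_finsetSum _ fun I hI => (ht I hI).1]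
    refine (Finset.sum_le_card_nsmul _ _ _ fun I hI => (ht I hI).2).trans ?_
    rw [nsmul_eq_mul]
    have hnn : (0 : ℝ) < n := by positivity
    have h1 : ((stableSets (pw d m₀)).card : ℝ) ≤ (n : ℝ) ^ 2 := by
      exact_mod_cast card_stableSets_le _
    have h2 : (n : ℝ) ^ 2 * Real.exp (-y) = Real.exp (-4) := by
      have : (n : ℝ) ^ 2 = Real.exp (2 * Real.log n) := by
        rw [show 2 * Real.log n = (2 : ℕ) * Real.log n by norm_num, Real.exp_nat_mul,
          Real.exp_log hnn]
      rw [this, ← Real.exp_add, hy]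
      ring_nf
    have h3 : Real.exp (-4) ≤ 0.01832 := by
      rw [Real.exp_neg, inv_le_comm₀ (Real.exp_pos _) (by norm_num),
        show (4 : ℝ) = (4 : ℕ) * 1 by norm_num, Real.exp_nat_mul]
      calc (0.01832 : ℝ)⁻¹ ≤ 2.7182 ^ 4 := by norm_num
        _ ≤ _ := by
          have := Real.exp_one_gt_d9
          gcongr
          linarith
    have h4 := one_le_card_parts hn2 m
    have h5 : 5.38 ≤ y := by linarith
    have h6 : 0 ≤ α * ‖apx d m φ‖ ^ 2 := by positivity
    calc ((stableSets (pw d m₀)).card : ℝ) * (8 * B / y * Real.exp (-y)) ≤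
          (n : ℝ) ^ 2 * (8 * B / y * Real.exp (-y)) := by gcongr
      _ = 8 * B / y * ((n : ℝ) ^ 2 * Real.exp (-y)) := by ring
      _ = 8 * B / y * Real.exp (-4) := by rw [h2]
      _ ≤ 8 * B / 5.38 * 0.01832 := by gcongr
      _ ≤ 0.03 * (B * 1) := by
          rw [div_mul_eq_mul_div, div_le_iff₀ (by norm_num)]
          linarith
      _ ≤ 0.03 * (B * m.parts.card) := by gcongr
      _ ≤ _ := by linarith

lemma hasEnvelope [IsProbabilityMeasure μ] (hn : IsBernsteinNoise μ ξ σ c)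
    (hσ : 0 < σ) (hn2 : 2 ≤ n) {a b : ℝ} (ha : 0 < a) (hb : 0 < b) (haL : 1 ≤ a * Real.log n)
    {m₀ : BlockPartition n} {φ : Vec n} (hφ : φ ∈ pw d m₀)
    (hlev : HasLeverage (pw d m₀) (lev n d a)) {α B : ℝ} (hα : 0 < α) (hB : 0 < B)
    (hαB : 2.67 * (penFactor d a b σ c * ((d : ℝ) + 1)) ≤ α * B) :
    HasEnvelope μ ξ d m₀ φ α B := by
  have hc := hn.c_nonneg
  have hL := log_pos_of_two_le hn2
  have hL0 : 0 < Real.log n := by linarith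
  have hl := (lev_pos (d := d) hn2 ha).le
  have hQ := penFactor_pos (d := d) hσ hc ha hb
  set D : ℝ := (d : ℝ) + 1 with hD
  have hD1 : 1 ≤ D := by
    have : (0 : ℝ) ≤ d := by positivity
    linarith
  set Q := penFactor d a b σ c
  -- Below the threshold log n is comparable to D and the union bound is affordable. Above it, the
  -- Bernstein linear part of the chaining level 40 D is damped by 1 / log n.
  rcases le_total (Real.log n) (36 * D) with h | h
  · refine hasEnvelope_of_dev hn hσ hn2 hφ hl hlev hα hB (le_trans ?_ hαB)
    refine (dev_sq_le hσ.le hc ha hb hn2 haL (by positivity)).trans ?_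
    rw [show 2.67 * (Q * D) = Q * (2.67 * D) by ring]
    refine mul_le_mul_of_nonneg_left ?_ hQ.le
    set L := Real.log n
    have h1 : (2 * L + 4) ^ 2 * (1 / (203.6 * L)) = (4 * L + 16 + 16 / L) / 203.6 := by
      field_simp
      ring
    have h2 : 16 / L ≤ 16 / 0.69 := by gcongr
    rw [h1]
    norm_num at h2 ⊢
    linarith
  · refine hasEnvelope_of_gap hn hσ hφ hl hlev hα hB (le_trans ?_
      (div_le_div_of_nonneg_right hαB (by norm_num)))
    rw [mul_pow]
    have h1 := dev_sq_le (d := d) (b := b) hσ.le hc ha hb hn2 haL (y := 40 * D) (by positivity)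
    have h2 : 40 * D / 162 + (40 * D) ^ 2 * (1 / (203.6 * Real.log n)) ≤ 0.47 * D := by
      have : (40 * D) ^ 2 * (1 / (203.6 * Real.log n)) ≤ (40 * D) ^ 2 * (1 / (203.6 * (36 * D))) := by
        gcongr
      have e : (40 * D) ^ 2 * (1 / (203.6 * (36 * D))) = 1600 / (203.6 * 36) * D := by
        field_simp
        ring
      rw [e] at this
      norm_num at this ⊢
      linarith
    have h3 := h1.trans (mul_le_mul_of_nonneg_left h2 hQ.le)
    nlinarith

end

noncomputable section

variable {n d : ℕ} {Ω : Type*} [MeasurableSpace Ω] {μ : Measure Ω}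
  {ξ : Fin n → Ω → ℝ} {σ c : ℝ}

/-! ### Deviations of the norm of the projected noise -/

/-- A 1/2-separated subset of A of maximal cardinality is a net. Doubling it gives a 1-separated set
in the ball of radius 2, whence the power of 5. -/
lemma exists_half_net (S : Submodule ℝ (Vec n)) (A : Set (Vec n)) (hA : ∀ t ∈ A, t ∈ S ∧ ‖t‖ ≤ 1) :
    ∃ T : Finset (Vec n), (∀ t ∈ T, t ∈ A) ∧ T.card ≤ 5 ^ Module.finrank ℝ S ∧
      ∀ t ∈ A, ∃ t' ∈ T, ‖t - t'‖ ≤ 1 / 2 := by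
  classical
  let P : Finset (Vec n) → Prop := fun T => (∀ t ∈ T, t ∈ A) ∧
    ∀ t ∈ T, ∀ t' ∈ T, t ≠ t' → 1 / 2 ≤ ‖t - t'‖
  have hcard : ∀ T, P T → T.card ≤ 5 ^ Module.finrank ℝ S := by
    rintro T ⟨h1, h2⟩
    let f : {t // t ∈ T} → S := fun t => (2 : ℝ) • ⟨t, (hA t (h1 t t.2)).1⟩
    have hf : Function.Injective f := by
      intro t t' h
      have h3 := congrArg (fun v : S => (v : Vec n)) h
      simp only [f, Submodule.coe_smul] at h3
      exact Subtype.ext (smul_right_injective _ (two_ne_zero : (2 : ℝ) ≠ 0) h3)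
    have h4 : (T.attach.image f).card = T.card := by
      rw [Finset.card_image_of_injective _ hf, Finset.card_attach]
    rw [← h4]
    refine Besicovitch.card_le_of_separated _ ?_ ?_
    · intro v hv
      obtain ⟨t, _, rfl⟩ := Finset.mem_image.1 hv
      have := (hA t (h1 t t.2)).2
      rw [norm_smul, Real.norm_two, Submodule.coe_norm]
      simp only
      linarith
    · intro v hv w hw hvw
      obtain ⟨t, _, rfl⟩ := Finset.mem_image.1 hv
      obtain ⟨t', _, rfl⟩ := Finset.mem_image.1 hw
      have hne : (t : Vec n) ≠ t' := fun h => hvw (by rw [Subtype.ext h])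
      have := h2 t t.2 t' t'.2 hne
      rw [← smul_sub, norm_smul, Real.norm_two, Submodule.coe_norm]
      simp only [Submodule.coe_sub]
      linarith
  obtain ⟨T, hT, hmax⟩ : ∃ T, P T ∧ ∀ T', P T' → T'.card ≤ T.card := by
    have hne : ∃ k, ∃ T, P T ∧ T.card = k := ⟨0, ∅, ⟨by simp, by simp⟩, rfl⟩
    have hbd : ∀ k, (∃ T, P T ∧ T.card = k) → k ≤ 5 ^ Module.finrank ℝ S := by
      rintro k ⟨T, hT, rfl⟩
      exact hcard T hT
    obtain ⟨T, hT, hk⟩ := Nat.sSup_mem (s := {k | ∃ T, P T ∧ T.card = k}) hne ⟨_, hbd⟩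
    refine ⟨T, hT, fun T' hT' => ?_⟩
    rw [hk]
    exact le_csSup ⟨_, hbd⟩ ⟨T', hT', rfl⟩
  refine ⟨T, hT.1, hcard T hT, fun t ht => ?_⟩
  by_contra! hcon
  have htT : t ∉ T := fun h => by
    have := hcon t h
    rw [sub_self, norm_zero] at this
    linarith
  have h5 : P (insert t T) := by
    refine ⟨fun s hs => ?_, fun s hs s' hs' hne => ?_⟩
    · rcases Finset.mem_insert.1 hs with rfl | hs
      · exact ht
      · exact hT.1 s hs
    · rcases Finset.mem_insert.1 hs with h | h <;> rcases Finset.mem_insert.1 hs' with h' | h'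
      · exact absurd (h.trans h'.symm) hne
      · rw [h]
        exact (hcon s' h').le
      · rw [norm_sub_rev, h']
        exact (hcon s h).le
      · exact hT.2 s h s' h' hne
  have h6 := hmax _ h5
  rw [Finset.card_insert_of_notMem htT] at h6
  omega

/-- The net is taken among unit-ball vectors whose coordinates are at most u / z. The normalized
projection is such a vector on the event considered, so u / z replaces 1 in the Bernstein linear
term. -/
lemma IsBernsteinNoise.proj_tail [IsProbabilityMeasure μ] (hn : IsBernsteinNoise μ ξ σ c)
    (hσ : 0 < σ) (S : Submodule ℝ (Vec n)) {z u y : ℝ} (hz : 0 < z) (hu : 0 ≤ u) (hy : 0 ≤ y)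
    (hzy : 2 * dev σ c (u / z) y ≤ z) :
    μ.real {ω | z < ‖S.starProjection (noise ξ ω)‖ ∧ ∀ i, |S.starProjection (noise ξ ω) i| ≤ u} ≤
      5 ^ Module.finrank ℝ S * Real.exp (-y) := by
  obtain ⟨T, hT, hTc, hnet⟩ := exists_half_net S {t | t ∈ S ∧ ‖t‖ ≤ 1 ∧ ∀ i, |t i| ≤ u / z}
    fun t ht => ⟨ht.1, ht.2.1⟩
  have hsub : {ω | z < ‖S.starProjection (noise ξ ω)‖ ∧
      ∀ i, |S.starProjection (noise ξ ω) i| ≤ u} ⊆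
      ⋃ t ∈ T, {ω | 1 * dev σ c (u / z) y ≤ inner ℝ t (noise ξ ω)} := by
    rintro ω ⟨h1, h2⟩
    set v := S.starProjection (noise ξ ω)
    have hvS : v ∈ S := Submodule.starProjection_apply_mem _ _
    have hv0 : 0 < ‖v‖ := hz.trans h1
    obtain ⟨t, htT, ht⟩ := hnet (‖v‖⁻¹ • v) ⟨S.smul_mem _ hvS, by
      rw [norm_smul, norm_inv, norm_norm, inv_mul_cancel₀ hv0.ne'], fun i => by
      rw [PiLp.smul_apply, smul_eq_mul, abs_mul, abs_of_pos (inv_pos.2 hv0), inv_mul_eq_div]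
      exact div_le_div₀ hu (h2 i) hz h1.le⟩
    refine Set.mem_biUnion htT ?_
    rw [Set.mem_ofPred_eq]
    have htS : S.starProjection t = t := Submodule.starProjection_eq_self_iff.2 (hT t htT).1
    have h3 : inner ℝ t (noise ξ ω) = inner ℝ t v := by
      rw [← Submodule.inner_starProjection_left_eq_right, htS]
    have h4 : inner ℝ (‖v‖⁻¹ • v) v = ‖v‖ := by
      rw [real_inner_smul_left, real_inner_self_eq_norm_sq]
      field_simp
    have h5 : inner ℝ (‖v‖⁻¹ • v - t) v ≤ 1 / 2 * ‖v‖ :=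
      (real_inner_le_norm _ _).trans (mul_le_mul_of_nonneg_right ht hv0.le)
    rw [inner_sub_left, h4] at h5
    rw [h3]
    linarith
  refine (measureReal_mono hsub (measure_ne_top _ _)).trans
    ((measureReal_biUnion_finset_le _ _).trans ?_)
  have hl : 0 ≤ u / z := by positivity
  refine (Finset.sum_le_card_nsmul _ _ _ fun t ht => hn.tail t hσ one_pos (hT t ht).2.1 hl
    (by simpa using (hT t ht).2.2) hy).trans ?_
  rw [nsmul_eq_mul]
  have : (T.card : ℝ) ≤ 5 ^ Module.finrank ℝ S := by exact_mod_cast hTc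
  gcongr

lemma IsBernsteinNoise.proj_excess [IsProbabilityMeasure μ] (hn : IsBernsteinNoise μ ξ σ c)
    (hσ : 0 < σ) (S : Submodule ℝ (Vec n)) {u Q N Δ : ℝ} (hu : 0 ≤ u)
    (hQ : 324 * σ ^ 2 + 36 * (c * u) ≤ Q) (hN : (Module.finrank ℝ S : ℝ) ≤ N) (hΔ : 0 ≤ Δ)
    {G : Set Ω} (hGm : MeasurableSet G)
    (hG : ∀ ω ∈ G, ∀ i, |S.starProjection (noise ξ ω) i| ≤ u) :
    Integrable (G.indicator fun ω =>
      max 0 (‖S.starProjection (noise ξ ω)‖ ^ 2 - Q / 9 * (N + Δ))) μ ∧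
    ∫ ω, G.indicator (fun ω =>
      max 0 (‖S.starProjection (noise ξ ω)‖ ^ 2 - Q / 9 * (N + Δ))) ω ∂μ ≤
      Q / 9 * Real.exp (-Δ) := by
  have hc := hn.c_nonneg
  have hQ0 : 0 < Q := lt_of_lt_of_le (by positivity) hQ
  have hN0 : (0 : ℝ) ≤ Module.finrank ℝ S := by positivity
  have hmeas : Measurable fun ω => ‖S.starProjection (noise ξ ω)‖ :=
    (S.starProjection.continuous.measurable.comp (measurable_noise hn.measurable)).norm
  have htail : ∀ x : ℝ, 0 < x → μ.real {ω | x < G.indicator (fun ω =>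
      max 0 (‖S.starProjection (noise ξ ω)‖ ^ 2 - Q / 9 * (N + Δ))) ω} ≤
      Real.exp (-Δ) * Real.exp (-(9 / Q) * x) := by
    intro x hx
    set w := N + Δ + 9 / Q * x with hw
    have hw0 : 0 < w := by
      have : 0 < 9 / Q * x := by positivity
      linarith
    set z := √(Q / 9 * w) with hz
    have hz0 : 0 < z := Real.sqrt_pos.2 (by positivity)
    have hz2 : z ^ 2 = Q / 9 * w := Real.sq_sqrt (by positivity)
    -- The coefficient 1.61 pays for the net, since 5 ≤ exp 1.61. Both parts of the deviation are
    -- linearized in σ² / Q and c u / Q, by an arithmetic–geometric inequality for the square root,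
    -- with 0.0556 · 130.4 · 4 just above 28.98; then the lower bound on Q is used.
    have hdev : 2 * dev σ c (u / z) (1.61 * w) ≤ z := by
      rw [dev]
      have h1 : c * (u / z) * (1.61 * w) = 14.49 * (c * u) / Q * z := by
        have : w = 9 / Q * z ^ 2 := by
          rw [hz2]
          field_simp
        rw [this]
        field_simp
        ring
      have h2 : √(2 * σ ^ 2 * (1.61 * w)) ≤ (0.0556 + 130.4 * σ ^ 2 / Q) * z := by
        refine Real.sqrt_le_iff.2 ⟨by positivity, ?_⟩
        rw [mul_pow, hz2]
        have h3 : 28.98 * (σ ^ 2 / Q) ≤ (0.0556 + 130.4 * σ ^ 2 / Q) ^ 2 := by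
          rw [mul_div_assoc]
          nlinarith [sq_nonneg (0.0556 - 130.4 * (σ ^ 2 / Q)), div_nonneg (sq_nonneg σ) hQ0.le]
        calc 2 * σ ^ 2 * (1.61 * w) = 28.98 * (σ ^ 2 / Q) * (Q / 9 * w) := by
              field_simp
              ring
          _ ≤ _ := by gcongr
      have h4 : 2 * (0.0556 + 130.4 * σ ^ 2 / Q + 14.49 * (c * u) / Q) ≤ 1 := by
        have : (324 * σ ^ 2 + 36 * (c * u)) / Q ≤ 1 := (div_le_one hQ0).2 hQ
        have h5 : 2 * (130.4 * σ ^ 2 / Q + 14.49 * (c * u) / Q) =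
            0.805 * ((324 * σ ^ 2 + 36 * (c * u)) / Q) - 0.02 * σ ^ 2 / Q := by ring
        have h6 : 0 ≤ 0.02 * σ ^ 2 / Q := by positivity
        linarith
      rw [h1]
      nlinarith
    have h1 := hn.proj_tail hσ S hz0 hu (y := 1.61 * w) (by positivity) hdev
    have hsub : {ω | x < G.indicator (fun ω =>
        max 0 (‖S.starProjection (noise ξ ω)‖ ^ 2 - Q / 9 * (N + Δ))) ω} ⊆
        {ω | z < ‖S.starProjection (noise ξ ω)‖ ∧
          ∀ i, |S.starProjection (noise ξ ω) i| ≤ u} := by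
      intro ω hω
      rw [Set.mem_ofPred_eq] at hω
      by_cases hωG : ω ∈ G
      · rw [Set.indicator_of_mem hωG] at hω
        have h3 := (lt_max_iff.1 hω).resolve_left (not_lt.2 hx.le)
        refine ⟨?_, hG ω hωG⟩
        refine lt_of_pow_lt_pow_left₀ 2 (norm_nonneg _) ?_
        rw [hz2, hw]
        have : Q / 9 * (N + Δ + 9 / Q * x) = Q / 9 * (N + Δ) + x := by field_simp
        linarith
      · rw [Set.indicator_of_notMem hωG] at hω
        exact absurd hω (not_lt.2 hx.le)
    refine (measureReal_mono hsub).trans (h1.trans ?_)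
    have h5 : (5 : ℝ) ≤ Real.exp 1.61 := by
      have e1 : Real.exp 1.61 = Real.exp 1 * Real.exp 0.61 := by
        rw [← Real.exp_add]
        norm_num
      have e4 : (1.8396 : ℝ) ≤ Real.exp 0.61 := by
        have h := Real.sum_le_exp_of_nonneg (x := 0.61) (by norm_num) 5
        refine le_trans ?_ h
        norm_num [Finset.sum_range_succ, Nat.factorial]
      have := Real.exp_one_gt_d9
      rw [e1]
      nlinarith
    calc (5 : ℝ) ^ Module.finrank ℝ S * Real.exp (-(1.61 * w)) ≤
          Real.exp 1.61 ^ Module.finrank ℝ S * Real.exp (-(1.61 * w)) := by gcongr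
      _ = Real.exp (Module.finrank ℝ S * 1.61 + -(1.61 * w)) := by
          rw [← Real.exp_nat_mul, Real.exp_add]
      _ ≤ Real.exp (-Δ + -(9 / Q) * x) := by
          rw [Real.exp_le_exp, hw]
          have : 0 ≤ 9 / Q * x := by positivity
          linarith
      _ = _ := Real.exp_add _ _
  obtain ⟨hi, hb⟩ := integral_le_of_exp_tail
    ((measurable_const.max ((hmeas.pow_const 2).sub_const _)).indicator hGm)
    (fun ω => Set.indicator_nonneg (fun _ _ => le_max_left _ _) _) (by positivity) htail
  refine ⟨hi, hb.trans_eq ?_⟩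
  field_simp

end

noncomputable section

variable {n d : ℕ} {Ω : Type*} [MeasurableSpace Ω] {μ : Measure Ω}
  {ξ : Fin n → Ω → ℝ} {σ c : ℝ}

/-! ### The event on which the projections of the noise are uniformly small -/

/-- The coordinates of the projections of the noise onto the local polynomials are at most `u`. -/
def goodEvent (ξ : Fin n → Ω → ℝ) (d : ℕ) (S : Submodule ℝ (Vec n)) (u : ℝ) : Set Ω :=
  {ω | ∀ I ∈ stableSets S, ∀ i, |(locPoly d I).starProjection (noise ξ ω) i| ≤ u}

lemma starProjection_apply_eq_inner (U : Submodule ℝ (Vec n)) (v : Vec n) (i : Fin n) :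
    U.starProjection v i = inner ℝ (U.starProjection (EuclideanSpace.single i 1)) v := by
  rw [Submodule.inner_starProjection_left_eq_right, EuclideanSpace.inner_single_left]
  simp

/-- For t the projection of a basis vector, ‖t‖² is its coordinate t i, at most lam ‖t‖. -/
lemma HasLeverage.norm_starProjection_single {S U : Submodule ℝ (Vec n)} {lam : ℝ}
    (h : HasLeverage S lam) (hl : 0 ≤ lam) (hU : U ≤ S) (i : Fin n) :
    ‖U.starProjection (EuclideanSpace.single i 1)‖ ≤ lam := by
  set t := U.starProjection (EuclideanSpace.single i (1 : ℝ)) with ht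
  have h1 := h t (hU (Submodule.starProjection_apply_mem _ _)) i
  have h2 : t i = ‖t‖ ^ 2 := by
    rw [ht, starProjection_apply_eq_inner, real_inner_comm, inner_starProjection_self]
  rw [h2, abs_of_nonneg (sq_nonneg _)] at h1
  by_contra! hcon
  have : 0 < ‖t‖ := hl.trans_lt hcon
  nlinarith

omit [MeasurableSpace Ω] in
lemma abs_starProjection_pw_le {m : BlockPartition n} {S : Submodule ℝ (Vec n)}
    (hm : ∀ I ∈ m.parts, Stable S I) {u : ℝ} {ω : Ω} (hω : ω ∈ goodEvent ξ d S u) (i : Fin n) :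
    |(pw d m).starProjection (noise ξ ω) i| ≤ u := by
  obtain ⟨J, ⟨hJ, hiJ⟩, hu⟩ := m.existsUnique_mem (Finset.mem_univ i)
  rw [starProjection_pw, show (∑ I ∈ m.parts, (locPoly d I).starProjection (noise ξ ω)) i =
    ∑ I ∈ m.parts, (locPoly d I).starProjection (noise ξ ω) i by simp, Finset.sum_eq_single J]
  · exact hω J (mem_stableSets.2 ⟨m.nonempty_of_mem_parts hJ, hm J hJ⟩) i
  · intro I hI hIJ
    have h1 := restr_of_mem_locPoly (d := d) (subset_refl I)
      (Submodule.starProjection_apply_mem (locPoly d I) (noise ξ ω))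
    rw [← h1, restr_apply, if_neg]
    exact fun h => hIJ (hu I ⟨hI, h⟩)
  · exact fun h => absurd hJ h

lemma measurableSet_goodEvent (hξ : ∀ i, Measurable (ξ i)) (S : Submodule ℝ (Vec n)) (u : ℝ) :
    MeasurableSet (goodEvent ξ d S u) := by
  have : goodEvent ξ d S u = ⋂ I ∈ stableSets S, ⋂ i,
      {ω | |(locPoly d I).starProjection (noise ξ ω) i| ≤ u} := by
    ext ω
    simp [goodEvent]
  rw [this]
  refine Finset.measurableSet_biInter _ fun I _ => MeasurableSet.iInter fun i => ?_
  simp_rw [starProjection_apply_eq_inner]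
  exact measurableSet_le (measurable_inner_noise hξ _).abs measurable_const

/-- The threshold in the definition of the good event. -/
def goodLevel (d : ℕ) (a b σ c : ℝ) : ℝ := 2 * √2 * (σ + c) * ((d : ℝ) + 1) * (b + 2) / a

lemma goodLevel_nonneg {a b : ℝ} (hσ : 0 ≤ σ) (hc : 0 ≤ c) (ha : 0 < a) (hb : 0 < b) :
    0 ≤ goodLevel d a b σ c := by
  unfold goodLevel
  positivity

lemma penFactor_eq_goodLevel (a b : ℝ) :
    324 * σ ^ 2 + 36 * (c * goodLevel d a b σ c) = penFactor d a b σ c := by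
  unfold penFactor goodLevel kappa
  ring

lemma lev_mul_dev_le {a b : ℝ} (hσ : 0 ≤ σ) (hc : 0 ≤ c) (ha : 0 < a) (hb : 0 < b)
    (hn : 2 ≤ n) (haL : 1 ≤ a * Real.log n) :
    lev n d a * dev σ c (lev n d a) (2.5 * (b + 2) * Real.log n) ≤ goodLevel d a b σ c := by
  have hL := log_pos_of_two_le hn
  set L := Real.log n
  have hL0 : 0 < L := by linarith
  set D : ℝ := (d : ℝ) + 1 with hD
  have hD1 : 1 ≤ D := by
    have : (0 : ℝ) ≤ d := by positivity
    linarith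
  have hlam : lev n d a ^ 2 = D / (a * L) ^ 2 := by
    rw [lev, div_pow, Real.sq_sqrt (by positivity)]
  have hlam0 := (lev_pos (d := d) hn ha).le
  set lam := lev n d a
  have h2 : 1.4142 ≤ √2 := Real.le_sqrt_of_sq_le (by norm_num)
  have hcpart : lam * (c * lam * (2.5 * (b + 2) * L)) ≤ 2 * √2 * c * D * (b + 2) / a := by
    calc lam * (c * lam * (2.5 * (b + 2) * L)) = c * lam ^ 2 * (2.5 * (b + 2) * L) := by ring
      _ = 2.5 * c * D * (b + 2) / a / (a * L) := by
          rw [hlam]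
          field_simp
      _ ≤ 2.5 * c * D * (b + 2) / a / 1 := by gcongr
      _ ≤ _ := by
          rw [div_one]
          gcongr
          linarith
  have hspart : lam * √(2 * σ ^ 2 * (2.5 * (b + 2) * L)) ≤ 2 * √2 * σ * D * (b + 2) / a := by
    refine (abs_le_of_sq_le_sq' ?_ (by positivity)).2
    rw [mul_pow, Real.sq_sqrt (by positivity), hlam, div_pow]
    have e : (2 * √2 * σ * D * (b + 2)) ^ 2 = 8 * (σ * D * (b + 2)) ^ 2 := by
      have := Real.sq_sqrt (show (0 : ℝ) ≤ 2 by norm_num)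
      calc (2 * √2 * σ * D * (b + 2)) ^ 2 = 4 * √2 ^ 2 * (σ * D * (b + 2)) ^ 2 := by ring
        _ = _ := by rw [this]; ring
    rw [e]
    have h3 : D / (a * L) ^ 2 * (2 * σ ^ 2 * (2.5 * (b + 2) * L)) =
        5 * σ ^ 2 * (D * (b + 2)) / L / a ^ 2 := by
      field_simp
      ring
    rw [h3]
    refine div_le_div_of_nonneg_right ?_ (by positivity)
    rw [div_le_iff₀ hL0]
    have h4 : 1 ≤ D * (b + 2) := by nlinarith
    have h5 : 5 ≤ 8 * (D * (b + 2)) * L := by nlinarith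
    calc 5 * σ ^ 2 * (D * (b + 2)) = σ ^ 2 * (D * (b + 2)) * 5 := by ring
      _ ≤ σ ^ 2 * (D * (b + 2)) * (8 * (D * (b + 2)) * L) := by gcongr
      _ = _ := by ring
  rw [dev, mul_add, goodLevel]
  calc _ ≤ 2 * √2 * σ * D * (b + 2) / a + 2 * √2 * c * D * (b + 2) / a := add_le_add hspart hcpart
    _ = _ := by ring

/-- At most n³ linear functionals, one per stable interval and coordinate, are controlled at level
2.5 (b + 2) log n ≥ 5 log n, each with a two-sided tail. -/
lemma IsBernsteinNoise.goodEvent_compl [IsProbabilityMeasure μ] (hn : IsBernsteinNoise μ ξ σ c)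
    (hσ : 0 < σ) (hn2 : 2 ≤ n) {a b : ℝ} (ha : 0 < a) (hb : 0 < b) (haL : 1 ≤ a * Real.log n)
    {m₀ : BlockPartition n} (hlev : HasLeverage (pw d m₀) (lev n d a)) :
    μ.real (goodEvent ξ d (pw d m₀) (goodLevel d a b σ c))ᶜ ≤ 2 / (n : ℝ) ^ 2 := by
  have hc := hn.c_nonneg
  have hL := log_pos_of_two_le hn2
  have hL0 : 0 < Real.log n := by linarith
  have hl0 := lev_pos (d := d) hn2 ha
  set y := 2.5 * (b + 2) * Real.log n with hy
  set lam := lev n d a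
  have hsub : (goodEvent ξ d (pw d m₀) (goodLevel d a b σ c))ᶜ ⊆
      ⋃ p ∈ stableSets (pw d m₀) ×ˢ (Finset.univ : Finset (Fin n)),
        {ω | lam * dev σ c lam y ≤ |inner ℝ ((locPoly d p.1).starProjection
          (EuclideanSpace.single p.2 1)) (noise ξ ω)|} := by
    intro ω hω
    simp only [goodEvent, Set.mem_compl_iff, Set.mem_ofPred_eq, not_forall, not_le] at hω
    obtain ⟨I, hI, i, hi⟩ := hω
    refine Set.mem_biUnion (x := (I, i)) (Finset.mem_coe.2 (Finset.mem_product.2 ⟨hI, Finset.mem_univ i⟩)) ?_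
    rw [Set.mem_ofPred_eq, ← starProjection_apply_eq_inner]
    exact (lev_mul_dev_le hσ.le hc ha hb hn2 haL).trans hi.le
  refine (measureReal_mono hsub (measure_ne_top _ _)).trans
    ((measureReal_biUnion_finset_le _ _).trans ?_)
  have hterm : ∀ p ∈ stableSets (pw d m₀) ×ˢ (Finset.univ : Finset (Fin n)),
      μ.real {ω | lam * dev σ c lam y ≤ |inner ℝ ((locPoly d p.1).starProjection
          (EuclideanSpace.single p.2 1)) (noise ξ ω)|} ≤ 2 * Real.exp (-y) := by
    intro p hp
    have hst := (mem_stableSets.1 (Finset.mem_product.1 hp).1).2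
    have h1 := hlev.norm_starProjection_single hl0.le hst.locPoly_le p.2
    refine hn.tail_abs _ hσ hl0 h1 hl0.le (fun i => ?_) (by positivity)
    refine (hlev _ (hst.locPoly_le (Submodule.starProjection_apply_mem _ _)) i).trans ?_
    gcongr
  refine (Finset.sum_le_card_nsmul _ _ _ hterm).trans ?_
  rw [nsmul_eq_mul, Finset.card_product, Finset.card_univ, Fintype.card_fin]
  have hnn : (0 : ℝ) < n := by positivity
  have h2 : ((stableSets (pw d m₀)).card : ℝ) ≤ (n : ℝ) ^ 2 := by
    exact_mod_cast card_stableSets_le _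
  have h3 : Real.exp (-y) ≤ ((n : ℝ) ^ 5)⁻¹ := by
    have : (n : ℝ) ^ 5 = Real.exp (5 * Real.log n) := by
      rw [show 5 * Real.log n = (5 : ℕ) * Real.log n by norm_num, Real.exp_nat_mul,
        Real.exp_log hnn]
    rw [this, ← Real.exp_neg, Real.exp_le_exp, hy]
    nlinarith
  push_cast
  calc ((stableSets (pw d m₀)).card : ℝ) * n * (2 * Real.exp (-y)) ≤
        (n : ℝ) ^ 2 * n * (2 * ((n : ℝ) ^ 5)⁻¹) := by gcongr
    _ = _ := by field_simp

lemma norm_sq_starProjection_eq_sum (U : Submodule ℝ (Vec n)) (v : Vec n) :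
    ‖U.starProjection v‖ ^ 2 =
      ∑ i, inner ℝ (U.starProjection (EuclideanSpace.single i 1)) v ^ 2 := by
  rw [vec_norm_sq]
  exact Finset.sum_congr rfl fun i _ => by rw [starProjection_apply_eq_inner]

lemma IsBernsteinNoise.integrable_norm_sq_proj [IsProbabilityMeasure μ]
    (hn : IsBernsteinNoise μ ξ σ c) (U : Submodule ℝ (Vec n)) :
    Integrable (fun ω => ‖U.starProjection (noise ξ ω)‖ ^ 2) μ := by
  simp_rw [norm_sq_starProjection_eq_sum]
  refine integrable_finsetSum _ fun i _ => ?_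
  simpa only [sq_abs] using hn.integrable_inner_pow (U.starProjection (EuclideanSpace.single i 1)) 2

/-- On A each squared coordinate satisfies x² ≤ s x⁴ / 2 + 1 / (2s). With s of order 1 / (n (σ + c
lam)²), fourth moments and the probability of order n⁻² contribute equally, so the sum over n
coordinates is free of n. -/
lemma IsBernsteinNoise.bad_part [IsProbabilityMeasure μ] (hn : IsBernsteinNoise μ ξ σ c)
    (hσ : 0 < σ) (hn2 : 2 ≤ n) {a b : ℝ} (ha : 0 < a) (hb : 0 < b) (haL : 1 ≤ a * Real.log n)
    {S : Submodule ℝ (Vec n)} (hlev : HasLeverage S (lev n d a)) {A : Set Ω}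
    (hAm : MeasurableSet A) (hA : μ.real A ≤ 2 / (n : ℝ) ^ 2) :
    ∫ ω, A.indicator (fun ω => ‖S.starProjection (noise ξ ω)‖ ^ 2) ω ∂μ ≤
      0.06 * penFactor d a b σ c := by
  have hc := hn.c_nonneg
  have hl0 := lev_pos (d := d) hn2 ha
  have hnn : (0 : ℝ) < n := by positivity
  set lam := lev n d a
  set B := σ + c * lam with hB
  have hB0 : 0 < B := by positivity
  set t : Fin n → Vec n := fun i => S.starProjection (EuclideanSpace.single i 1) with ht
  set s : ℝ := 1 / (3 * n * B ^ 2) with hs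
  have hs0 : 0 < s := by positivity
  have hint4 : ∀ i, Integrable (fun ω => inner ℝ (t i) (noise ξ ω) ^ 4) μ := fun i => by
    have := hn.integrable_inner_pow (t i) 4
    simpa only [Even.pow_abs (by decide : Even 4)] using this
  have hindA : Integrable (A.indicator fun _ => (1 : ℝ)) μ := (integrable_const 1).indicator hAm
  have hpt : ∀ ω, A.indicator (fun ω => ‖S.starProjection (noise ξ ω)‖ ^ 2) ω ≤
      ∑ i, (s / 2 * inner ℝ (t i) (noise ξ ω) ^ 4 + 1 / (2 * s) * A.indicator (fun _ => (1 : ℝ)) ω) := by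
    intro ω
    by_cases h : ω ∈ A
    · simp only [Set.indicator_of_mem h]
      rw [norm_sq_starProjection_eq_sum]
      refine Finset.sum_le_sum fun i _ => ?_
      set x := inner ℝ (t i) (noise ξ ω)
      have h1 : s / 2 * x ^ 4 + 1 / (2 * s) * 1 - x ^ 2 = (s * x ^ 2 - 1) ^ 2 / (2 * s) := by
        field_simp
        ring
      have h2 : 0 ≤ (s * x ^ 2 - 1) ^ 2 / (2 * s) := by positivity
      linarith
    · simp only [Set.indicator_of_notMem h]
      refine Finset.sum_nonneg fun i _ => ?_
      rw [mul_zero, add_zero]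
      exact mul_nonneg (by positivity) (Even.pow_nonneg (by decide) _)
  have hti : ∀ i, ∫ ω, inner ℝ (t i) (noise ξ ω) ^ 4 ∂μ ≤ 15.58 * B ^ 4 := fun i => by
    have h1 : ‖t i‖ ≤ 1 := by
      refine (Submodule.norm_starProjection_apply_le _ _).trans ?_
      simp
    have h2 := hn.integral_inner_pow_four_le (t i) hσ h1 hl0.le fun j =>
      (hlev _ (Submodule.starProjection_apply_mem _ _) j).trans
        (mul_le_of_le_one_right hl0.le h1)
    refine h2.trans ?_
    have h3 : Real.exp (1 / 2) ≤ 1.649 := by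
      refine (abs_le_of_sq_le_sq' ?_ (by norm_num)).2
      rw [← Real.exp_nat_mul]
      have := Real.exp_one_lt_d9
      norm_num at this ⊢
      linarith
    gcongr
    linarith
  have hmono := integral_mono
    (hn.integrable_norm_sq_proj S |>.indicator hAm)
    (integrable_finsetSum _ fun i _ => ((hint4 i).const_mul (s / 2)).add (hindA.const_mul (1 / (2 * s))))
    hpt
  refine hmono.trans ?_
  rw [integral_finsetSum _ fun i _ => ((hint4 i).const_mul (s / 2)).add (hindA.const_mul (1 / (2 * s)))]
  have hi : ∀ i ∈ (Finset.univ : Finset (Fin n)), ∫ ω, (s / 2 * inner ℝ (t i) (noise ξ ω) ^ 4 +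
      1 / (2 * s) * A.indicator (fun _ => (1 : ℝ)) ω) ∂μ ≤ 5.6 * B ^ 2 / n := by
    intro i _
    rw [integral_add ((hint4 i).const_mul _) (hindA.const_mul _), integral_const_mul,
      integral_const_mul, integral_indicator_const _ hAm, smul_eq_mul, mul_one]
    calc s / 2 * ∫ ω, inner ℝ (t i) (noise ξ ω) ^ 4 ∂μ + 1 / (2 * s) * μ.real A ≤
          s / 2 * (15.58 * B ^ 4) + 1 / (2 * s) * (2 / (n : ℝ) ^ 2) := by
          gcongr
          exact hti i
      _ = (15.58 / 6 + 3) * B ^ 2 / n := by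
          rw [hs]
          field_simp
          norm_num
      _ ≤ _ := by
          gcongr
          norm_num
  refine (Finset.sum_le_card_nsmul _ _ _ hi).trans ?_
  rw [nsmul_eq_mul, Finset.card_univ, Fintype.card_fin]
  have h5 := noise_scale_sq_le (d := d) (b := b) hσ.le hc ha hb hn2 haL
  have hQ := penFactor_pos (d := d) hσ hc ha hb
  calc (n : ℝ) * (5.6 * B ^ 2 / n) = 5.6 * B ^ 2 := by field_simp
    _ ≤ 5.6 * (0.0103 * penFactor d a b σ c) := by gcongr
    _ ≤ _ := by nlinarith

/-- The map r allows both m' itself and its refinement with a fixed m. On the good event the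
excesses are summed over M; off it, every projection is dominated by the one onto the reference
model. -/
lemma exists_chi_envelope [IsProbabilityMeasure μ] (hn : IsBernsteinNoise μ ξ σ c)
    (hσ : 0 < σ) (hn2 : 2 ≤ n) {a b : ℝ} (ha : 0 < a) (hb : 0 < b) (haL : 1 ≤ a * Real.log n)
    {m₀ : BlockPartition n} (hlev : HasLeverage (pw d m₀) (lev n d a))
    (M : Finset (BlockPartition n)) (r : BlockPartition n → BlockPartition n)
    (hr : ∀ m ∈ M, ∀ I ∈ (r m).parts, Stable (pw d m₀) I) (N Δ : BlockPartition n → ℝ)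
    (hN : ∀ m ∈ M, (((d + 1) * (r m).parts.card : ℕ) : ℝ) ≤ N m) (hΔ : ∀ m ∈ M, 0 ≤ Δ m) :
    ∃ T : Ω → ℝ, Integrable T μ ∧
      (∀ m ∈ M, ∀ ω, ‖(pw d (r m)).starProjection (noise ξ ω)‖ ^ 2 ≤
        penFactor d a b σ c / 9 * (N m + Δ m) + T ω) ∧
      ∫ ω, T ω ∂μ ≤ penFactor d a b σ c / 9 * ∑ m ∈ M, Real.exp (-Δ m) +
        0.06 * penFactor d a b σ c := by
  have hc := hn.c_nonneg
  have hQ := penFactor_pos (d := d) hσ hc ha hb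
  set Q := penFactor d a b σ c with hQd
  set u := goodLevel d a b σ c
  set G := goodEvent ξ d (pw d m₀) u with hG
  have hGm : MeasurableSet G := measurableSet_goodEvent hn.measurable _ _
  have hex : ∀ m ∈ M, _ := fun m hm => hn.proj_excess hσ (pw d (r m)) (u := u) (Q := Q)
    (goodLevel_nonneg hσ.le hc ha hb) (penFactor_eq_goodLevel a b).le
    (N := N m) ((Nat.cast_le.2 (finrank_pw_le (r m))).trans (hN m hm)) (hΔ m hm) hGm
    (fun ω hω => abs_starProjection_pw_le (hr m hm) hω)
  have hbi := (hn.integrable_norm_sq_proj (pw d m₀)).indicator hGm.compl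
  have hbb := hn.bad_part hσ hn2 ha hb haL hlev hGm.compl
    (hn.goodEvent_compl hσ hn2 ha hb haL hlev)
  refine ⟨fun ω => ∑ m ∈ M, G.indicator (fun ω =>
      max 0 (‖(pw d (r m)).starProjection (noise ξ ω)‖ ^ 2 - Q / 9 * (N m + Δ m))) ω +
      Gᶜ.indicator (fun ω => ‖(pw d m₀).starProjection (noise ξ ω)‖ ^ 2) ω, ?_, ?_, ?_⟩
  · exact (integrable_finsetSum _ fun m hm => (hex m hm).1).add hbi
  · intro m hm ω
    have hN0 : 0 ≤ N m := le_trans (by positivity) (hN m hm)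
    have hsum : ∀ m' ∈ M, 0 ≤ G.indicator (fun ω =>
      max 0 (‖(pw d (r m')).starProjection (noise ξ ω)‖ ^ 2 - Q / 9 * (N m' + Δ m'))) ω :=
      fun m' _ => Set.indicator_nonneg (fun _ _ => le_max_left _ _) _
    by_cases h : ω ∈ G
    · have h1 := Finset.single_le_sum hsum hm
      have h2 : Gᶜ.indicator (fun ω => ‖(pw d m₀).starProjection (noise ξ ω)‖ ^ 2) ω = 0 :=
        Set.indicator_of_notMem (Set.notMem_compl_iff.2 h) _
      have h3 : G.indicator (fun ω =>
          max 0 (‖(pw d (r m)).starProjection (noise ξ ω)‖ ^ 2 - Q / 9 * (N m + Δ m))) ω =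
          max 0 (‖(pw d (r m)).starProjection (noise ξ ω)‖ ^ 2 - Q / 9 * (N m + Δ m)) :=
        Set.indicator_of_mem h _
      rw [h3] at h1
      have h4 := le_max_right 0
        (‖(pw d (r m)).starProjection (noise ξ ω)‖ ^ 2 - Q / 9 * (N m + Δ m))
      simp only [h2]
      linarith
    · have h1 := Finset.sum_nonneg hsum
      have h2 : Gᶜ.indicator (fun ω => ‖(pw d m₀).starProjection (noise ξ ω)‖ ^ 2) ω =
          ‖(pw d m₀).starProjection (noise ξ ω)‖ ^ 2 := Set.indicator_of_mem h _
      have h3 : ‖(pw d (r m)).starProjection (noise ξ ω)‖ ^ 2 ≤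
          ‖(pw d m₀).starProjection (noise ξ ω)‖ ^ 2 := by
        have := norm_starProjection_mono (pw_le_of_stable (hr m hm)) (noise ξ ω)
        gcongr
      have h4 : 0 ≤ Q / 9 * (N m + Δ m) := by
        have := hΔ m hm
        positivity
      simp only [h2]
      linarith
  · rw [integral_add (integrable_finsetSum _ fun m hm => (hex m hm).1) hbi,
      integral_finsetSum _ fun m hm => (hex m hm).1, Finset.mul_sum]
    exact add_le_add (Finset.sum_le_sum fun m hm => (hex m hm).2) hbb

end

noncomputable section

variable {n d : ℕ} {Ω : Type*} {ξ : Fin n → Ω → ℝ} {σ c : ℝ}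

/-! ### The oracle inequality -/

lemma lse_eq {m : BlockPartition n} (hm : Admissible d m) (y : Vec n) :
    lse d m y = (pw d m).starProjection y := by
  simp only [lse, model_eq_pw hm]

lemma loss_eq {m : BlockPartition n} (hm : Admissible d m) (f : Vec n) (ω : Ω) :
    loss d f ξ m ω = ‖f - (pw d m).starProjection f‖ ^ 2 +
      ‖(pw d m).starProjection (noise ξ ω)‖ ^ 2 := by
  have h1 : loss d f ξ m ω = ‖(f - (pw d m).starProjection f) -
      (pw d m).starProjection (noise ξ ω)‖ ^ 2 := by
    rw [loss, lse_eq hm, show obs f ξ ω = f + noise ξ ω from rfl, map_add, sub_sub]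
  rw [h1, norm_sub_sq_real, Submodule.starProjection_inner_eq_zero _ _
    (Submodule.starProjection_apply_mem _ _)]
  ring

lemma crit_eq {m : BlockPartition n} (hm : Admissible d m) (pen : BlockPartition n → ℝ) (f : Vec n)
    (ω : Ω) : crit d pen (obs f ξ ω) m = loss d f ξ m ω +
      2 * (inner ℝ f (noise ξ ω) - inner ℝ ((pw d m).starProjection f) (noise ξ ω) -
        ‖(pw d m).starProjection (noise ξ ω)‖ ^ 2) + ‖noise ξ ω‖ ^ 2 + pen m := by
  rw [crit, loss, lse_eq hm, show obs f ξ ω = f + noise ξ ω from rfl]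
  have h1 : f + noise ξ ω - (pw d m).starProjection (f + noise ξ ω) =
      (f - (pw d m).starProjection (f + noise ξ ω)) + noise ξ ω := by abel
  rw [h1, norm_add_sq_real, inner_sub_left, map_add, inner_add_left,
    real_inner_comm (noise ξ ω) ((pw d m).starProjection (noise ξ ω)), inner_starProjection_self]
  ring

/-- Expanding both criteria, ‖ξ‖² and ⟨f, ξ⟩ cancel; the term −2‖Π_m ξ‖² is dropped. -/
lemma loss_add_pen_le {m m' : BlockPartition n} (hm : Admissible d m) (hm' : Admissible d m')
    {pen : BlockPartition n → ℝ} {f : Vec n} {ω : Ω}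
    (h : crit d pen (obs f ξ ω) m' ≤ crit d pen (obs f ξ ω) m) :
    loss d f ξ m' ω + pen m' ≤ loss d f ξ m ω + pen m +
      2 * inner ℝ ((pw d m').starProjection f - (pw d m).starProjection f) (noise ξ ω) +
      2 * ‖(pw d m').starProjection (noise ξ ω)‖ ^ 2 := by
  rw [crit_eq hm, crit_eq hm'] at h
  rw [inner_sub_left]
  have := sq_nonneg ‖(pw d m).starProjection (noise ξ ω)‖
  linarith

lemma norm_apx_starProjection_le {m m₀ : BlockPartition n} (h : pw d m ≤ pw d m₀) (f : Vec n) :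
    ‖apx d m ((pw d m₀).starProjection f)‖ ≤ ‖f - (pw d m).starProjection f‖ := by
  have h1 : apx d m ((pw d m₀).starProjection f) =
      (pw d m₀).starProjection (f - (pw d m).starProjection f) := by
    rw [apx, starProjection_starProjection_of_le h, map_sub,
      Submodule.starProjection_eq_self_iff.2 (h (Submodule.starProjection_apply_mem _ f))]
  rw [h1]
  exact Submodule.norm_starProjection_apply_le _ _

variable [MeasurableSpace Ω] {μ : Measure Ω}

/-- The assumptions of the oracle inequality. -/
structure IsSelection (μ : Measure Ω) (ξ : Fin n → Ω → ℝ) (σ c : ℝ) (d : ℕ) (m₀ : BlockPartition n)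
    (M : Finset (BlockPartition n)) (a b K : ℝ) (Δ pen : BlockPartition n → ℝ) (f : Vec n)
    (mhat : Ω → BlockPartition n) : Prop where
  isNoise : IsBernsteinNoise μ ξ σ c
  σ_nonneg : 0 ≤ σ
  two_le : 2 ≤ n
  a_pos : 0 < a
  b_pos : 0 < b
  log_ge : 1 ≤ a * Real.log n
  leverage : HasLeverage (pw d m₀) (lev n d a)
  admissible : ∀ m ∈ M, Admissible d m
  le : ∀ m ∈ M, pw d m ≤ pw d m₀
  Δ_nonneg : ∀ m ∈ M, 0 ≤ Δ m
  one_lt : 1 < K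
  pen_ge : ∀ m ∈ M, K * penFactor d a b σ c * (((d : ℝ) + 1) * m.parts.card + Δ m) ≤ pen m
  mem : ∀ ω, mhat ω ∈ M
  measurable : ∀ m ∈ M, MeasurableSet {ω | mhat ω = m}
  crit_le : ∀ ω, ∀ m ∈ M, crit d pen (obs f ξ ω) (mhat ω) ≤ crit d pen (obs f ξ ω) m

lemma oracleConst_ge {K : ℝ} (hK : 1 < K) : 1 ≤ oracleConst K := by
  have h : 0 < K - 1 := by linarith
  rw [oracleConst, one_le_div (by positivity)]
  nlinarith

namespace IsSelection

variable {m₀ : BlockPartition n} {M : Finset (BlockPartition n)}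
  {a b K : ℝ} {Δ pen : BlockPartition n → ℝ} {f : Vec n} {mhat : Ω → BlockPartition n}
  (h : IsSelection μ ξ σ c d m₀ M a b K Δ pen f mhat)
include h

lemma stable {m : BlockPartition n} (hm : m ∈ M) : ∀ I ∈ m.parts, Stable (pw d m₀) I :=
  fun _ hI => stable_of_le (h.le m hm) (h.admissible m hm) hI

lemma stable_inf {m m' : BlockPartition n} (hm : m ∈ M) (hm' : m' ∈ M) :
    ∀ I ∈ (m ⊓ m').parts, Stable (pw d m₀) I := by
  intro P hP
  obtain ⟨I, hI, J, hJ, rfl⟩ := exists_inter_of_mem_inf hP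
  exact (h.stable hm I hI).inter (h.stable hm' J hJ)

lemma factor_pos (hσ : 0 < σ) : 0 < penFactor d a b σ c :=
  penFactor_pos hσ h.isNoise.c_nonneg h.a_pos h.b_pos

lemma factor_nonneg : 0 ≤ penFactor d a b σ c := by
  have := h.σ_nonneg
  have := h.isNoise.c_nonneg
  have := h.a_pos
  refine le_trans (by positivity) (penFactor_ge h.σ_nonneg h.isNoise.c_nonneg h.a_pos h.b_pos)

lemma pen_ge_dim {m : BlockPartition n} (hm : m ∈ M) :
    penFactor d a b σ c * (((d : ℝ) + 1) * m.parts.card) ≤ pen m / K := by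
  have hK := h.one_lt
  have hQ := h.factor_nonneg
  have h1 := h.pen_ge m hm
  have h2 := h.Δ_nonneg m hm
  rw [le_div_iff₀ (by linarith)]
  refine le_trans ?_ h1
  have : 0 ≤ K * penFactor d a b σ c * Δ m := by positivity
  nlinarith

lemma factor_le {m : BlockPartition n} (hm : m ∈ M) : penFactor d a b σ c ≤ pen m / K := by
  refine (le_mul_of_one_le_right h.factor_nonneg ?_).trans (h.pen_ge_dim hm)
  have := one_le_card_parts h.two_le m
  have : (0 : ℝ) ≤ d := by positivity
  nlinarith

lemma norm_sq_apx_le_loss {m : BlockPartition n} (hm : m ∈ M) (ω : Ω) :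
    ‖apx d m ((pw d m₀).starProjection f)‖ ^ 2 ≤ loss d f ξ m ω := by
  rw [loss_eq (h.admissible m hm)]
  have h1 := norm_apx_starProjection_le (h.le m hm) f
  have h2 := pow_le_pow_left₀ (norm_nonneg _) h1 2
  have := sq_nonneg ‖(pw d m).starProjection (noise ξ ω)‖
  linarith

variable [IsProbabilityMeasure μ]

lemma integrable_loss {m : BlockPartition n} (hm : m ∈ M) : Integrable (loss d f ξ m) μ := by
  have h1 : loss d f ξ m = fun ω => ‖f - (pw d m).starProjection f‖ ^ 2 +
      ‖(pw d m).starProjection (noise ξ ω)‖ ^ 2 :=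
    funext fun ω => loss_eq (h.admissible m hm) f ω
  rw [h1]
  exact (integrable_const _).add (h.isNoise.integrable_norm_sq_proj _)

lemma integrable_loss_mhat : Integrable (fun ω => loss d f ξ (mhat ω) ω) μ := by
  classical
  have h1 : (fun ω => loss d f ξ (mhat ω) ω) = fun ω => ∑ m ∈ M,
      {ω | mhat ω = m}.indicator (loss d f ξ m) ω := by
    funext ω
    rw [Finset.sum_eq_single (mhat ω)]
    · rw [Set.indicator_of_mem]
      exact rfl
    · intro m _ hne
      exact Set.indicator_of_notMem (fun h' => hne h'.symm) _
    · exact fun h' => absurd (h.mem ω) h'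
  rw [h1]
  exact integrable_finsetSum _ fun m hm => (h.integrable_loss hm).indicator (h.measurable m hm)

/-- The comparison of the selected model with a fixed one, through the common refinement. -/
lemma bound_of_refinement (hσ : 0 < σ) {η θ C : ℝ} (hη : 0 < η) (hη1 : η < 1) (hθ : 0 < θ)
    (hC : 2 - η + 1 / η + 1 / θ = C) (hCK : C / 9 ≤ K) {m : BlockPartition n} (hm : m ∈ M) :
    (1 - η) * ∫ ω, loss d f ξ (mhat ω) ω ∂μ ≤
      (1 + θ) * ∫ ω, loss d f ξ m ω ∂μ + (1 + (C / 9 + 0.06 * C) / K) * pen m +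
        C / 9 * (penFactor d a b σ c * ∑ m ∈ M, Real.exp (-Δ m)) := by
  have hK := h.one_lt
  have hQ := h.factor_pos hσ
  obtain ⟨T, hTi, hT, hTb⟩ := exists_chi_envelope h.isNoise hσ h.two_le h.a_pos h.b_pos h.log_ge
    h.leverage M (fun m' => m ⊓ m') (fun m' hm' => h.stable_inf hm hm')
    (fun m' => ((d : ℝ) + 1) * m.parts.card + ((d : ℝ) + 1) * m'.parts.card) Δ
    (fun m' hm' => by
      have h1 := card_parts_inf_le m m' (fun I hI => (h.admissible m hm I hI).1)
        (fun I hI => (h.admissible m' hm' I hI).1)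
      have h2 : ((m ⊓ m').parts.card : ℝ) ≤ m.parts.card + m'.parts.card := by exact_mod_cast h1
      push_cast
      nlinarith [(by positivity : (0 : ℝ) ≤ d)]) h.Δ_nonneg
  have hC0 : 0 < C := by
    rw [← hC]
    have : 0 < 1 / η := by positivity
    have : 0 < 1 / θ := by positivity
    linarith
  set Q := penFactor d a b σ c
  set φ := (pw d m₀).starProjection f with hφ
  have hpt : ∀ ω, (1 - η) * loss d f ξ (mhat ω) ω ≤ (1 + θ) * loss d f ξ m ω +
      (pen m + C * (Q / 9 * (((d : ℝ) + 1) * m.parts.card))) + C * T ω := by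
    intro ω
    set m' := mhat ω
    have hm' : m' ∈ M := h.mem ω
    have hbasic := loss_add_pen_le (h.admissible m hm) (h.admissible m' hm') (h.crit_le ω m hm)
    have hTω := hT m' hm' ω
    set e := noise ξ ω
    set U := pw d (m ⊓ m')
    have hmU : pw d m ≤ U := pw_le_pw_inf_left m m'
    have hmU' : pw d m' ≤ U := pw_le_pw_inf_right m m'
    -- The bias difference lies in the model of the common refinement, so only the projection of ξ
    -- onto that model matters.
    have h1 : (pw d m').starProjection f - (pw d m).starProjection f =
        apx d m φ - apx d m' φ := by
      rw [apx, apx, hφ, starProjection_starProjection_of_le (h.le m hm),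
        starProjection_starProjection_of_le (h.le m' hm')]
      abel
    have h2 : U.starProjection ((pw d m').starProjection f - (pw d m).starProjection f) =
        (pw d m').starProjection f - (pw d m).starProjection f :=
      Submodule.starProjection_eq_self_iff.2 (Submodule.sub_mem _
        (hmU' (Submodule.starProjection_apply_mem _ _)) (hmU (Submodule.starProjection_apply_mem _ _)))
    have h3 : inner ℝ ((pw d m').starProjection f - (pw d m).starProjection f) e ≤
        (‖apx d m φ‖ + ‖apx d m' φ‖) * ‖U.starProjection e‖ := by
      rw [← h2, Submodule.inner_starProjection_left_eq_right, h1]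
      refine (real_inner_le_norm _ _).trans ?_
      gcongr
      exact norm_sub_le _ _
    set χ := ‖U.starProjection e‖
    have h4 : ‖(pw d m').starProjection e‖ ^ 2 ≤ χ ^ 2 := by
      have := norm_starProjection_mono hmU' e
      gcongr
    have h5 := h.norm_sq_apx_le_loss hm ω
    have h6 : ‖apx d m' φ‖ ^ 2 + ‖(pw d m').starProjection e‖ ^ 2 ≤ loss d f ξ m' ω := by
      rw [loss_eq (h.admissible m' hm')]
      have := norm_apx_starProjection_le (h.le m' hm') f
      gcongr
    set x := ‖apx d m φ‖
    set x' := ‖apx d m' φ‖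
    have h7 : 2 * (x * χ) ≤ θ * x ^ 2 + 1 / θ * χ ^ 2 := by
      have : θ * x ^ 2 + 1 / θ * χ ^ 2 - 2 * (x * χ) = (θ * x - χ) ^ 2 / θ := by
        field_simp
        ring
      have h8 : 0 ≤ (θ * x - χ) ^ 2 / θ := by positivity
      linarith
    have h8 : 2 * (x' * χ) ≤ η * x' ^ 2 + 1 / η * χ ^ 2 := by
      have : η * x' ^ 2 + 1 / η * χ ^ 2 - 2 * (x' * χ) = (η * x' - χ) ^ 2 / η := by
        field_simp
        ring
      have h8 : 0 ≤ (η * x' - χ) ^ 2 / η := by positivity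
      linarith
    have h9 : C * χ ^ 2 = (2 - η) * χ ^ 2 + 1 / η * χ ^ 2 + 1 / θ * χ ^ 2 := by
      rw [← hC]
      ring
    have h10 := mul_le_mul_of_nonneg_left hTω hC0.le
    have h11 : (2 - η) * ‖(pw d m').starProjection e‖ ^ 2 ≤ (2 - η) * χ ^ 2 :=
      mul_le_mul_of_nonneg_left h4 (by linarith)
    have h12 := mul_le_mul_of_nonneg_left h6 hη.le
    have h13 := mul_le_mul_of_nonneg_left h5 hθ.le
    have h14 := h.pen_ge m' hm'
    -- Here C / 9 ≤ K lets the penalty of m' absorb its own dimension and weight.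
    have h15 : C * (Q / 9 * (((d : ℝ) + 1) * m'.parts.card + Δ m')) ≤
        K * Q * (((d : ℝ) + 1) * m'.parts.card + Δ m') := by
      have := h.Δ_nonneg m' hm'
      calc C * (Q / 9 * (((d : ℝ) + 1) * m'.parts.card + Δ m')) =
            C / 9 * (Q * (((d : ℝ) + 1) * m'.parts.card + Δ m')) := by ring
        _ ≤ K * (Q * (((d : ℝ) + 1) * m'.parts.card + Δ m')) := by gcongr
        _ = _ := by ring
    nlinarith
  have hi1 := (h.integrable_loss hm).const_mul (1 + θ)
  have hi2 : Integrable (fun _ : Ω => pen m + C * (Q / 9 * (((d : ℝ) + 1) * m.parts.card))) μ :=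
    integrable_const _
  have hint := integral_mono (h.integrable_loss_mhat.const_mul (1 - η))
    ((hi1.add hi2).add (hTi.const_mul C)) hpt
  rw [integral_const_mul, integral_add' (hi1.add hi2) (hTi.const_mul C), integral_add' hi1 hi2,
    integral_const_mul, integral_const_mul, integral_const, probReal_univ, one_smul] at hint
  refine hint.trans ?_
  have hp := h.pen_ge_dim hm
  have h1 := h.factor_le hm
  have h2 := mul_le_mul_of_nonneg_left hTb hC0.le
  have h3 : (1 + (C / 9 + 0.06 * C) / K) * pen m = pen m + (C / 9 + 0.06 * C) * (pen m / K) := by ring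
  rw [h3]
  have h4 := mul_le_mul_of_nonneg_left h1 (by positivity : 0 ≤ 0.06 * C)
  have h5 := mul_le_mul_of_nonneg_left hp (by positivity : 0 ≤ C / 9)
  linarith

/-- The comparison for large `K`, through the uniform control of the linear functionals. -/
lemma bound_of_envelope (hσ : 0 < σ) (hK : 7.5 ≤ K) {m : BlockPartition n} (hm : m ∈ M) :
    (1 - 3 / K) * ∫ ω, loss d f ξ (mhat ω) ω ∂μ ≤
      ∫ ω, loss d f ξ m ω ∂μ + (1 + 0.12 / K) * pen m +
        2 / 9 * (penFactor d a b σ c * ∑ m ∈ M, Real.exp (-Δ m)) := by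
  have hK0 : 0 < K := by linarith
  have hQ := h.factor_pos hσ
  obtain ⟨T, hTi, hT, hTb⟩ := exists_chi_envelope h.isNoise hσ h.two_le h.a_pos h.b_pos h.log_ge
    h.leverage M id (fun m' hm' => h.stable hm') (fun m' => ((d : ℝ) + 1) * m'.parts.card) Δ
    (fun m' _ => by simp) h.Δ_nonneg
  set φ := (pw d m₀).starProjection f with hφ
  set Q := penFactor d a b σ c with hQd
  -- The shares 0.97 and 0.92 leave room for the factor 1.03 arising when the mean of W is also
  -- charged to the selected model, and for the quadratic term 2Q/9, which K ≥ 7.5 makes small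
  -- compared with the penalty. Their product keeps αB ≥ 2.67 Q D.
  set α := 0.97 * (3 / K) with hα
  set B := 0.92 * (K * Q * ((d : ℝ) + 1)) with hB
  obtain ⟨W, hWi, hW, hWb⟩ := hasEnvelope h.isNoise hσ h.two_le h.a_pos h.b_pos h.log_ge
    (Submodule.starProjection_apply_mem (pw d m₀) f) h.leverage (α := α) (B := B) (by positivity)
    (by positivity) (by
      rw [hα, hB, ← hQd]
      have : 0.97 * (3 / K) * (0.92 * (K * Q * ((d : ℝ) + 1))) =
          (0.97 * 3 * 0.92) * (Q * ((d : ℝ) + 1)) := by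
        field_simp
      rw [this]
      gcongr
      norm_num)
  rw [← hφ] at hW hWb
  -- W appears minus its mean and so vanishes after integration. The mean is bounded, for each ω,
  -- through the selected partition; this is why the envelope bounds its mean by every partition.
  -- The linear term in the fixed m is centred too, leaving coefficient 1 before its loss.
  have hpt : ∀ ω, (1 - 3 / K) * loss d f ξ (mhat ω) ω ≤ (loss d f ξ m ω +
      2 * inner ℝ (apx d m φ) (noise ξ ω)) +
      (W ω + (pen m - ∫ ω, W ω ∂μ)) + 2 * T ω := by
    intro ω
    set m' := mhat ω
    have hm' : m' ∈ M := h.mem ω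
    have hbasic := loss_add_pen_le (h.admissible m hm) (h.admissible m' hm') (h.crit_le ω m hm)
    have hTω := hT m' hm' ω
    simp only [id] at hTω
    have hWω := hW m' (h.stable hm') ω
    have hWm := hWb m' (h.stable hm')
    set e := noise ξ ω
    have h1 : (pw d m').starProjection f - (pw d m).starProjection f =
        apx d m φ - apx d m' φ := by
      rw [apx, apx, hφ, starProjection_starProjection_of_le (h.le m hm),
        starProjection_starProjection_of_le (h.le m' hm')]
      abel
    rw [h1, inner_sub_left] at hbasic
    have h2 : -(2 * inner ℝ (apx d m' φ) e) ≤ ∑ I ∈ m'.parts, 2 * |inner ℝ (res d I φ) e| := by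
      rw [apx_eq_sum, sum_inner, Finset.mul_sum, ← Finset.sum_neg_distrib]
      refine Finset.sum_le_sum fun I _ => ?_
      have := neg_abs_le (inner ℝ (res d I φ) e)
      linarith
    rw [Finset.sum_sub_distrib, Finset.sum_sub_distrib, ← Finset.mul_sum (s := m'.parts) (a := α),
      ← norm_sq_apx, Finset.sum_const, nsmul_eq_mul] at hWω
    have h6 : ‖apx d m' φ‖ ^ 2 + ‖(pw d m').starProjection e‖ ^ 2 ≤ loss d f ξ m' ω := by
      rw [loss_eq (h.admissible m' hm')]
      have := norm_apx_starProjection_le (h.le m' hm') f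
      gcongr
    have hη : 0 < 3 / K := by positivity
    have h7 := mul_le_mul_of_nonneg_left h6 hη.le
    have h8 : 0 ≤ 3 / K * ‖(pw d m').starProjection e‖ ^ 2 := by positivity
    have h9 : 0 ≤ 3 / K * ‖apx d m' φ‖ ^ 2 := by positivity
    have h10 := h.pen_ge m' hm'
    have hΔ := h.Δ_nonneg m' hm'
    set N : ℝ := ((d : ℝ) + 1) * m'.parts.card with hN
    have hN0 : 0 ≤ N := by positivity
    have h11 : B * m'.parts.card = 0.92 * (K * Q * N) := by
      rw [hB, hN]
      ring
    have h12 : α * ‖apx d m' φ‖ ^ 2 = 0.97 * (3 / K * ‖apx d m' φ‖ ^ 2) := by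
      rw [hα]
      ring
    rw [mul_comm (m'.parts.card : ℝ) B, h11, h12] at hWω
    rw [h11, h12] at hWm
    have h13 : 7.5 * (Q * (N + Δ m')) ≤ K * (Q * (N + Δ m')) := by gcongr
    have h14 : 0 ≤ K * Q * N := by positivity
    have h15 : 0 ≤ Q * Δ m' := by positivity
    have h16 : 0 ≤ Q * N := by positivity
    have h17 : 7.5 * (Q * N) ≤ K * (Q * N) := by gcongr
    have h18 : 7.5 * (Q * Δ m') ≤ K * (Q * Δ m') := by gcongr
    linarith
  have hi0 : Integrable (fun ω => 2 * inner ℝ (apx d m φ) (noise ξ ω)) μ :=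
    (h.isNoise.integrable_inner _).const_mul 2
  have hi1 := (h.integrable_loss hm).add hi0
  have hic : Integrable (fun _ : Ω => pen m - ∫ ω, W ω ∂μ) μ := integrable_const _
  have hi2 := hWi.add hic
  have hint := integral_mono (h.integrable_loss_mhat.const_mul (1 - 3 / K))
    ((hi1.add hi2).add (hTi.const_mul 2)) hpt
  have e1 : ∫ ω, (((loss d f ξ m + fun ω => 2 * inner ℝ (apx d m φ)
      (noise ξ ω)) + (W + fun _ : Ω => pen m - ∫ ω, W ω ∂μ)) +
      fun ω => 2 * T ω) ω ∂μ = ∫ ω, loss d f ξ m ω ∂μ + pen m + 2 * ∫ ω, T ω ∂μ := by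
    rw [integral_add' (hi1.add hi2) (hTi.const_mul 2), integral_add' hi1 hi2,
      integral_add' (h.integrable_loss hm) hi0, integral_add' hWi hic, integral_const_mul,
      integral_const_mul, h.isNoise.integral_inner, integral_const, probReal_univ, one_smul]
    ring
  rw [integral_const_mul] at hint
  refine (hint.trans_eq e1).trans ?_
  have h1 := h.factor_le hm
  have h3 : (1 + 0.12 / K) * pen m = pen m + 0.12 * (pen m / K) := by ring
  rw [h3]
  linarith

end IsSelection

end

/-! ### Degenerate noise, comparison with the oracle constant, and conclusion -/

noncomputable section

variable {n d : ℕ} {Ω : Type*} {ξ : Fin n → Ω → ℝ} {σ c : ℝ} [MeasurableSpace Ω] {μ : Measure Ω}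

/-- With σ = 0 the exponential moment is at most 1, while exp x ≥ 1 + x and centring force it to be
at least 1. Equality forces ξ to vanish almost surely. -/
lemma IsBernsteinNoise.ae_eq_zero [IsProbabilityMeasure μ] (h : IsBernsteinNoise μ ξ 0 c) :
    ∀ᵐ ω ∂μ, noise ξ ω = 0 := by
  have hc := h.c_nonneg
  have hi : ∀ i, ∀ᵐ ω ∂μ, ξ i ω = 0 := by
    intro i
    set l : ℝ := (1 + c)⁻¹ with hl
    have hl0 : 0 < l := by positivity
    have hlc : |l| * c < 1 := by
      rw [abs_of_pos hl0, hl, inv_mul_lt_iff₀ (by positivity)]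
      linarith
    obtain ⟨h1, h2⟩ := h.bernstein i l hlc
    have h3 : ∫ ω, Real.exp (l * ξ i ω) ∂μ ≤ 1 := by
      rw [← Real.exp_zero, ← Real.log_le_iff_le_exp (integral_exp_pos h1)]
      simpa using h2
    have h4 : Integrable (ξ i) μ := by
      have := h.integrable_inner (EuclideanSpace.single i 1)
      simpa [EuclideanSpace.inner_single_left] using this
    have hli : Integrable (fun ω => l * ξ i ω + 1) μ := (h4.const_mul l).add (integrable_const 1)
    have h5 : ∫ ω, (Real.exp (l * ξ i ω) - (l * ξ i ω + 1)) ∂μ ≤ 0 := by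
      rw [integral_sub h1 hli, integral_add (h4.const_mul l) (integrable_const 1),
        integral_const_mul, h.centered, integral_const, probReal_univ, one_smul]
      linarith
    have h6 : 0 ≤ fun ω => Real.exp (l * ξ i ω) - (l * ξ i ω + 1) := fun ω =>
      sub_nonneg.2 (Real.add_one_le_exp _)
    have h7 := (integral_eq_zero_iff_of_nonneg h6 (h1.sub hli)).1
      (le_antisymm h5 (integral_nonneg h6))
    filter_upwards [h7] with ω hω
    by_contra hne
    have := Real.add_one_lt_exp (mul_ne_zero hl0.ne' hne)
    simp only [Pi.zero_apply] at hω
    linarith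
  filter_upwards [ae_all_iff.2 hi] with ω hω
  ext i
  exact hω i

lemma one_le_oracleConst_large {K : ℝ} (hK : 7.5 ≤ K) :
    1 + 0.12 / K ≤ oracleConst K * (1 - 3 / K) := by
  have h1 : 0 < K - 1 := by linarith
  have h0 : 0 < K := by linarith
  have e : oracleConst K * (1 - 3 / K) = (K ^ 2 + K - 1) * (K - 3) / (K - 1) ^ 3 := by
    rw [oracleConst]
    field_simp
  rw [e, le_div_iff₀ (by positivity), ← sub_nonneg]
  have e2 : (K ^ 2 + K - 1) * (K - 3) - (1 + 0.12 / K) * (K - 1) ^ 3 =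
      (0.88 * K ^ 3 - 6.64 * K ^ 2 + 3.64 * K + 0.12) / K := by
    field_simp
    ring
  rw [e2]
  refine div_nonneg ?_ h0.le
  have h2 : 0.88 * K ^ 3 - 6.64 * K ^ 2 + 3.64 * K + 0.12 =
      0.87 * K ^ 2 * (K - 7.5) + 0.01 * K * (K - 5.75) ^ 2 + 3.309375 * K + 0.12 := by ring
  rw [h2]
  have h3 : 0 ≤ K - 7.5 := by linarith
  positivity

lemma le_oracleConst_middle {K : ℝ} (hK : 3 ≤ K) (hK' : K ≤ 7.5) :
    1.2 ≤ oracleConst K * (3 / 4) ∧ 1 + 1.8395 / K ≤ oracleConst K * (3 / 4) := by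
  have h1 : 0 < K - 1 := by linarith
  have h0 : 0 < K := by linarith
  have h2 : 0 ≤ (K - 3) * (7.5 - K) := mul_nonneg (by linarith) (by linarith)
  have h3 : 0 ≤ K - 3 := by linarith
  have h4 : 0 ≤ 7.5 - K := by linarith
  rw [oracleConst, div_mul_eq_mul_div]
  constructor
  · rw [le_div_iff₀ (by positivity)]
    nlinarith [mul_nonneg h2 h3, mul_nonneg h2 h4, mul_nonneg h3 h3, mul_nonneg h4 h4]
  · rw [le_div_iff₀ (by positivity), ← sub_nonneg]
    have e2 : K * (K ^ 2 + K - 1) * (3 / 4) - (1 + 1.8395 / K) * (K - 1) ^ 3 =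
        (0.75 * K ^ 2 * (K ^ 2 + K - 1) - (K + 1.8395) * (K - 1) ^ 3) / K := by
      field_simp
      ring
    rw [e2]
    refine div_nonneg ?_ h0.le
    nlinarith [mul_nonneg h2 h3, mul_nonneg h2 h4, mul_nonneg h3 h3, mul_nonneg h4 h4,
      mul_nonneg h2 (mul_nonneg h3 h3), mul_nonneg h2 h2, mul_nonneg h2 (mul_nonneg h4 h4)]

lemma le_oracleConst_small {K : ℝ} (hK1 : 1 < K) (hK : K ≤ 3) : 4 ≤ oracleConst K := by
  have h1 : 0 < K - 1 := by linarith
  rw [oracleConst, le_div_iff₀ (by positivity)]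
  have h2 : 0 ≤ (K - 1) * (3 - K) := mul_nonneg (by linarith) (by linarith)
  nlinarith [mul_nonneg h2 h1.le, mul_nonneg h2 (by linarith : 0 ≤ 3 - K)]

namespace IsSelection

variable {m₀ : BlockPartition n} {M : Finset (BlockPartition n)}
  {a b K : ℝ} {Δ pen : BlockPartition n → ℝ} {f : Vec n} {mhat : Ω → BlockPartition n}

lemma pen_nonneg (h : IsSelection μ ξ σ c d m₀ M a b K Δ pen f mhat) {m : BlockPartition n}
    (hm : m ∈ M) : 0 ≤ pen m := by
  have h1 := h.factor_nonneg
  have h2 := h.one_lt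
  have h3 := h.Δ_nonneg m hm
  refine le_trans (by positivity) (h.pen_ge m hm)

variable [IsProbabilityMeasure μ]

lemma degenerate (h : IsSelection μ ξ 0 c d m₀ M a b K Δ pen f mhat)
    {m : BlockPartition n} (hm : m ∈ M) :
    ∫ ω, loss d f ξ (mhat ω) ω ∂μ ≤ ∫ ω, loss d f ξ m ω ∂μ + pen m := by
  have hi := (h.integrable_loss hm).add (integrable_const (pen m))
  have h1 : ∀ᵐ ω ∂μ, loss d f ξ (mhat ω) ω ≤ (loss d f ξ m + fun _ : Ω => pen m) ω := by
    filter_upwards [h.isNoise.ae_eq_zero] with ω hω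
    have h2 := loss_add_pen_le (h.admissible m hm) (h.admissible _ (h.mem ω)) (h.crit_le ω m hm)
    have h3 := h.pen_nonneg (h.mem ω)
    rw [hω, map_zero, inner_zero_right, norm_zero] at h2
    rw [Pi.add_apply]
    linarith
  refine (integral_mono_ae h.integrable_loss_mhat hi h1).trans_eq ?_
  rw [integral_add' (h.integrable_loss hm) (integrable_const _), integral_const, probReal_univ,
    one_smul]

lemma oracle (h : IsSelection μ ξ σ c d m₀ M a b K Δ pen f mhat)
    {m : BlockPartition n} (hm : m ∈ M) :
    ∫ ω, loss d f ξ (mhat ω) ω ∂μ ≤ oracleConst K * ((∫ ω, loss d f ξ m ω ∂μ + pen m) +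
      penFactor d a b σ c * ∑ m ∈ M, Real.exp (-Δ m)) := by
  have hK := h.one_lt
  have hC := oracleConst_ge hK
  have hp := h.pen_nonneg hm
  have hA : 0 ≤ ∫ ω, loss d f ξ m ω ∂μ := integral_nonneg fun ω => sq_nonneg _
  have hS : 0 ≤ penFactor d a b σ c * ∑ m ∈ M, Real.exp (-Δ m) :=
    mul_nonneg h.factor_nonneg (Finset.sum_nonneg fun _ _ => (Real.exp_pos _).le)
  rcases h.σ_nonneg.eq_or_lt with rfl | hσ
  · have := h.degenerate hm
    nlinarith
  set A := ∫ ω, loss d f ξ m ω ∂μ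
  set E := ∫ ω, loss d f ξ (mhat ω) ω ∂μ
  set S := penFactor d a b σ c * ∑ m ∈ M, Real.exp (-Δ m)
  set C := oracleConst K
  -- reduction to a bound of the form `(1 - η) E ≤ x A + y pen + z S`
  have key : ∀ {η x y z : ℝ}, 0 < η → η * E ≤ x * A + y * pen m + z * S → x ≤ C * η →
      y ≤ C * η → z ≤ C * η → E ≤ C * ((A + pen m) + S) := by
    intro η x y z hη h1 hx hy hz
    refine le_of_mul_le_mul_left ?_ hη
    have := mul_le_mul_of_nonneg_right hx hA
    have := mul_le_mul_of_nonneg_right hy hp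
    have := mul_le_mul_of_nonneg_right hz hS
    linarith
  -- Here η = 1/2 and θ = 1 give C = 4.5, and the requirement (1 + θ) / (1 − η) = 4 is met up to K =
  -- 3. On [3, 7.5] the choice η = 1/4, θ = 1/5 lowers this ratio to 1.6, with C = 10.75.
  rcases le_total K 3 with h3 | h3
  · have h4 := le_oracleConst_small hK h3
    have h5 := h.bound_of_refinement hσ (η := 1 / 2) (θ := 1) (C := 4.5) (by norm_num) (by norm_num)
      (by norm_num) (by norm_num) (by linarith) hm
    have h6 : (4.5 / 9 + 0.06 * 4.5) / K ≤ 1 := by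
      rw [div_le_one (by linarith)]
      linarith
    exact key (by norm_num) h5 (by linarith) (by linarith) (by linarith)
  rcases le_total K 7.5 with h7 | h7
  · obtain ⟨h4, h6⟩ := le_oracleConst_middle h3 h7
    have h5 := h.bound_of_refinement hσ (η := 1 / 4) (θ := 1 / 5) (C := 10.75) (by norm_num)
      (by norm_num) (by norm_num) (by norm_num) (by linarith) hm
    have h8 : (10.75 / 9 + 0.06 * 10.75) / K ≤ 1.8395 / K := by
      gcongr
      norm_num
    exact key (by norm_num) h5 (by linarith) (by linarith) (by linarith)
  · have h4 := one_le_oracleConst_large h7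
    have h5 := h.bound_of_envelope hσ h7 hm
    have h6 : 0 ≤ 0.12 / K := by positivity
    have h8 : 3 / K < 1 := by
      rw [div_lt_one (by linarith)]
      linarith
    exact key (η := 1 - 3 / K) (x := 1) (y := 1 + 0.12 / K) (z := 2 / 9) (by linarith) (by linarith) (by linarith) (by linarith) (by linarith)

end IsSelection

lemma hasLeverage_of_size {m₀ : BlockPartition n} (hm₀ : Admissible d m₀) (hn : 2 ≤ n) {a : ℝ}
    (ha : 0 < a) (hs : ∀ I ∈ m₀.parts, ((d : ℝ) + 1) * a ^ 2 * Real.log n ^ 2 ≤ (I.card : ℝ)) :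
    HasLeverage (pw d m₀) (lev n d a) := by
  have hL := log_pos_of_two_le hn
  have hL0 : 0 < Real.log n := by linarith
  intro v hv i
  have hl := lev_pos (d := d) hn ha
  refine abs_le_of_sq_le_sq ?_ (by positivity)
  have h1 := pw_leverage (d := d) (fun I hI => (hm₀ I hI).1)
    (V := ((d : ℝ) + 1) / (a * Real.log n) ^ 2) (fun I hI => ?_) hv i
  · rw [mul_pow, lev, div_pow, Real.sq_sqrt (by positivity)]
    exact h1
  · rw [div_mul_eq_mul_div, le_div_iff₀ (by positivity)]
    calc ((d : ℝ) + 1) ^ 2 * (a * Real.log n) ^ 2 =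
          ((d : ℝ) + 1) * (((d : ℝ) + 1) * a ^ 2 * Real.log n ^ 2) := by ring
      _ ≤ _ := mul_le_mul_of_nonneg_left (hs I hI) (by positivity)

lemma one_le_mul_log {m₀ : BlockPartition n} (hn : 2 ≤ n) {a : ℝ} (ha : 0 < a)
    (hs : ∀ I ∈ m₀.parts, (d : ℝ) + 1 ≤ ((d : ℝ) + 1) * a ^ 2 * Real.log n ^ 2) :
    1 ≤ a * Real.log n := by
  have hL := log_pos_of_two_le hn
  have hL0 : 0 < Real.log n := by linarith
  have hne : m₀.parts.Nonempty := by
    have := one_le_card_parts hn m₀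
    rw [← Finset.card_pos]
    exact_mod_cast lt_of_lt_of_le one_pos this
  obtain ⟨I, hI⟩ := hne
  have h1 := hs I hI
  have hD : 0 < (d : ℝ) + 1 := by positivity
  have h2 : 1 ≤ (a * Real.log n) ^ 2 := by
    refine le_of_mul_le_mul_left ?_ hD
    linarith [mul_pow a (Real.log n) 2]
  exact (one_le_sq_iff₀ (by positivity)).1 h2

end

end PiecewisePolySelection

open PiecewisePolySelection in
theorem mainTheorem6 {Ω : Type*} [MeasurableSpace Ω] (μ : Measure Ω) [IsProbabilityMeasure μ]
    (n d : ℕ) (hn : 2 ≤ n)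
    -- the regression model
    (F : ℝ → ℝ) (ξ : Fin n → Ω → ℝ) (σ c : ℝ) (hσ : 0 ≤ σ) (hc : 0 ≤ c)
    (hξ_meas : ∀ i, Measurable (ξ i)) (hξ_indep : iIndepFun ξ μ)
    (hξ_centered : ∀ i, ∫ ω, ξ i ω ∂μ = 0)
    (hξ_bernstein : ∀ i, BernsteinCond μ (ξ i) σ c)
    -- the reference partition and the collection of partitions
    (m₀ : BlockPartition n) (hm₀ : Admissible d m₀)
    (M : Finset (BlockPartition n)) (hM : ∀ m ∈ M, Admissible d m) (hM_sub : ∀ m ∈ M, model d m ≤ model d m₀)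
    (a b : ℝ) (ha : 0 < a) (hb : 0 < b)
    (hsize : ∀ I ∈ m₀.parts,
      ((d : ℝ) + 1) * a ^ 2 * Real.log n ^ 2 ≤ (I.card : ℝ) ∧
        (d : ℝ) + 1 ≤ ((d : ℝ) + 1) * a ^ 2 * Real.log n ^ 2)
    -- the weights and the penalty
    (Δ : BlockPartition n → ℝ) (hΔ : ∀ m ∈ M, 0 ≤ Δ m)
    (K : ℝ) (hK : 1 < K) (pen : BlockPartition n → ℝ)
    (hpen : ∀ m ∈ M, K * penFactor d a b σ c * ((modelDim d m : ℝ) + Δ m) ≤ pen m)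
    -- any data-driven minimizer of the criterion
    (mhat : Ω → M) (hmhat_meas : ∀ m : M, MeasurableSet {ω | mhat ω = m})
    (hmhat : ∀ ω, ∀ m ∈ M,
      crit d pen (obs (sample n F) ξ ω) (mhat ω) ≤ crit d pen (obs (sample n F) ξ ω) m) :
    (∀ m ∈ M, Integrable (loss d (sample n F) ξ m) μ) ∧
    Integrable (fun ω => loss d (sample n F) ξ (mhat ω) ω) μ ∧
    ∫ ω, loss d (sample n F) ξ (mhat ω) ω ∂μ ≤
      oracleConst K *
        ((⨅ m : M, (∫ ω, loss d (sample n F) ξ (m : BlockPartition n) ω ∂μ + pen m)) +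
          remainder d n a b σ c (∑ m ∈ M, Real.exp (-Δ m))) := by
  have h : IsSelection μ ξ σ c d m₀ M a b K Δ pen (sample n F) fun ω => (mhat ω : BlockPartition n) :=
    { isNoise := ⟨hc, hξ_meas, hξ_indep, hξ_centered, hξ_bernstein⟩
      σ_nonneg := hσ
      two_le := hn
      a_pos := ha
      b_pos := hb
      log_ge := one_le_mul_log hn ha fun I hI => (hsize I hI).2
      leverage := hasLeverage_of_size hm₀ hn ha fun I hI => (hsize I hI).1
      admissible := hM
      le := fun m hm => by
        rw [← model_eq_pw (hM m hm), ← model_eq_pw hm₀]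
        exact hM_sub m hm
      Δ_nonneg := hΔ
      one_lt := hK
      pen_ge := fun m hm => by
        have h1 := hpen m hm
        rw [modelDim_eq (hM m hm)] at h1
        push_cast at h1
        exact h1
      mem := fun ω => (mhat ω).2
      measurable := fun m hm => by
        have h1 : {ω | (mhat ω : BlockPartition n) = m} = {ω | mhat ω = ⟨m, hm⟩} := by
          ext ω
          exact (Subtype.ext_iff (a2 := ⟨m, hm⟩)).symm
        rw [h1]
        exact hmhat_meas ⟨m, hm⟩
      crit_le := hmhat }
  refine ⟨fun m hm => h.integrable_loss hm, h.integrable_loss_mhat, ?_⟩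
  obtain ⟨ω⟩ : Nonempty Ω := nonempty_of_isProbabilityMeasure μ
  have : Nonempty M := ⟨mhat ω⟩
  obtain ⟨m, hm⟩ := exists_eq_ciInf_of_finite
    (f := fun m : M => ∫ ω, loss d (sample n F) ξ (m : BlockPartition n) ω ∂μ + pen m)
  rw [← hm]
  refine (h.oracle m.2).trans ?_
  have hC := oracleConst_ge hK
  refine mul_le_mul_of_nonneg_left ?_ (by linarith)
  rw [remainder]
  -- The bad event having already been paid for by the penalty, this part of the remainder only
  -- needs to be nonnegative.
  have : 0 ≤ 4 * ((c + σ) ^ 2 * (b + 2) ^ 2 / (a ^ 2 * (n : ℝ) ^ b)) := by positivity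
  linarith
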